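/- Let $a<b$, $\sigma,\mu,\lambda>0$, and let $\varphi$ be a symmetric probability density on $\mathbb R$. Write $(\cdot,\cdot)$ and $\|\cdot\|$ for the scalar product and norm of $L_2(a,b)$, $D$ for the weak derivative, and extend functions on $(a,b)$ by zero to $\mathbb R$. Put $\mathcal I v(x)=\lambda\int_{-\infty}^{\infty}\big(v(x+y)-v(x)\big)\varphi(y)\,dy$ and $$A(u,v)=\int_a^b\big(\tfrac12\sigma^2u'v'+\mu x u'v\big)\,dx-\int_a^b \mathcal I u\,v\,dx ,\qquad u,v\in H^1_0(a,b).$$ For $f\in L_2(a,b)$, a weak solution of $-\tfrac12\sigma^2v''+\mu xv'-\mathcal I v=f$ in $(a,b)$, $v=0$ outside $(a,b)$, is a $v\in H^1_0(a,b)$ with $A(v,\phi)=(f,\phi)$ for all $\phi\in H^1_0(a,b)$; for $g\in L_2(a,b)$, a weak solution of the adjoint problem is a $w\in H^1_0(a,b)$ with $A(\phi,w)=(\phi,g)$ for all $\phi\in H^1_0(a,b)$. Call $c_3$ a regularity constant if for all $f,g\in L_2(a,b)$ all such weak solutions $v,w$ belong to $H^2(a,b)$ and satisfy $\|D^2v\|\le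 c_3\|f\|$ and $\|D^2w\|\le c_3\|g\|$. Let $c_2=(b-a)/\pi$ and $c_1=\tfrac12\sigma^2+c_2\big(\mu\max(|a|,|b|)+2\lambda c_2\big)$. **Theorem.** (i) An explicit regularity constant is $c_3=c_7+c_6c_8$, where $c_7=4\sigma^{-2}$, $c_8=4\sigma^{-2}\big(2\lambda+\mu+\sigma^{-2}\mu^2\max(|a|,|b|)^2\big)$, $c_6=c_2\big(2\sigma^{-2}\mu^{-1}+4\sigma^{-4}\mu^2c_5^2\big)^{1/2}$, $c_5=(b-a)e^{\gamma(b-a)}$ and $\gamma=\frac{\mu b}{\sigma^2}+\sqrt{\frac{\mu^2b^2}{\sigma^4}+\frac{2(\lambda+1)}{\sigma^2}}$. (ii) Let $c_3$ be any regularity constant and $f\in L_2(a,b)$. There is a unique weak solution $v\in H^1_0(a,b)$. Let $a=x_0<x_1<\dots<x_N=b$ be a mesh with $h=\max_j(x_j-x_{j-1})$, and let $V_h\subset H^1_0(a,b)$ be the space of continuous functions vanishing at $a$ and $b$ that are polynomials of degree at most one on each $[x_{j-1},x_j]$. If $$h\le h_0=\frac{\sigma}{\sqrt2\,\mu^{1/2}c_1c_3},$$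 then there is a unique $v_h\in V_h$ with $A(v_h,\phi_h)=(f,\phi_h)$ for all $\phi_h\in V_h$, and $$\|v-v_h\|\le 4c_1^2c_3^2\sigma^{-2}h^2\|f\|,\qquad \|D(v-v_h)\|\le 4c_1c_3\sigma^{-2}h\|f\| .$$ -/

import Mathlib

open MeasureTheory Set
open scoped ContDiff

noncomputable section

namespace JumpOU

/-! ### Lebesgue and Sobolev spaces on the interval `(a, b)` -/

/-- `f ∈ L₂(a,b)`. -/
def MemL2 (a b : ℝ) (f : ℝ → ℝ) : Prop :=
  MemLp f 2 (volume.restrict (Ioo a b))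

/-- The scalar product `(f, g)` of `L₂(a,b)`. -/
def inner2 (a b : ℝ) (f g : ℝ → ℝ) : ℝ :=
  ∫ x in a..b, f x * g x

/-- The norm `‖f‖` of `L₂(a,b)`. -/
def norm2 (a b : ℝ) (f : ℝ → ℝ) : ℝ :=
  Real.sqrt (∫ x in a..b, f x ^ 2)

/-- `g` is a weak (distributional) derivative of `u` on `(a,b)`: integration by parts holds
against every smooth test function with compact support in the open interval. -/
def HasWeakDeriv (a b : ℝ) (u g : ℝ → ℝ) : Prop :=
  ∀ ψ : ℝ → ℝ, ContDiff ℝ ∞ ψ → HasCompactSupport ψ → tsupport ψ ⊆ Ioo a b →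
    ∫ x in a..b, u x * deriv ψ x = -∫ x in a..b, g x * ψ x

/-- `u` has a weak derivative in `L₂(a,b)`. -/
def HasL2WeakDeriv (a b : ℝ) (u : ℝ → ℝ) : Prop :=
  ∃ g : ℝ → ℝ, MemL2 a b g ∧ HasWeakDeriv a b u g

/-- `u ∈ H¹(a,b)`. -/
def MemH1 (a b : ℝ) (u : ℝ → ℝ) : Prop :=
  MemL2 a b u ∧ HasL2WeakDeriv a b u

open Classical in
/-- The weak derivative `Du` of `u ∈ H¹(a,b)`: a representative of the almost everywhere unique
weak derivative in `L₂(a,b)`. -/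
def D (a b : ℝ) (u : ℝ → ℝ) : ℝ → ℝ :=
  if h : HasL2WeakDeriv a b u then h.choose else 0

/-- `u ∈ H²(a,b)`. -/
def MemH2 (a b : ℝ) (u : ℝ → ℝ) : Prop :=
  MemH1 a b u ∧ MemH1 a b (D a b u)

/-- `u ∈ H¹₀(a,b)`. An element of `H¹₀(a,b)` is represented by its continuous representative,
which vanishes at `a` and `b`, extended by zero outside `(a,b)`. -/
structure MemH10 (a b : ℝ) (u : ℝ → ℝ) : Prop where
  memH1 : MemH1 a b u
  continuous : Continuous u
  eq_zero : ∀ x, x ∉ Ioo a b → u x = 0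

/-! ### The integro-differential boundary value problem -/

/-- `φ` is a symmetric probability density on the real line. -/
structure IsSymmDensity (φ : ℝ → ℝ) : Prop where
  measurable : Measurable φ
  nonneg : ∀ y, 0 ≤ φ y
  symm : ∀ y, φ (-y) = φ y
  integral_eq_one : ∫ y, φ y = 1

/-- The jump operator `𝓘v(x) = λ ∫ (v(x+y) - v(x)) φ(y) dy`. -/
def jumpOp (lam : ℝ) (φ v : ℝ → ℝ) (x : ℝ) : ℝ :=
  lam * ∫ y, (v (x + y) - v x) * φ y

/-- The bilinear form
`A(u,v) = ∫ₐᵇ (½ σ² u' v' + μ x u' v) dx - ∫ₐᵇ 𝓘u v dx`. -/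
def bilin (a b σ μ lam : ℝ) (φ u v : ℝ → ℝ) : ℝ :=
  (∫ x in a..b, (1 / 2 * σ ^ 2 * D a b u x * D a b v x + μ * x * D a b u x * v x))
    - ∫ x in a..b, jumpOp lam φ u x * v x

/-- `v ∈ H¹₀(a,b)` is a weak solution of
`-½ σ² v'' + μ x v' - 𝓘v = f` in `(a,b)`, `v = 0` outside `(a,b)`. -/
def IsWeakSolution (a b σ μ lam : ℝ) (φ f v : ℝ → ℝ) : Prop :=
  MemH10 a b v ∧
    ∀ ψ : ℝ → ℝ, MemH10 a b ψ → bilin a b σ μ lam φ v ψ = inner2 a b f ψ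

/-- `w ∈ H¹₀(a,b)` is a weak solution of the adjoint problem
`-½ σ² w'' - μ x w' - μ w - 𝓘w = g` in `(a,b)`, `w = 0` outside `(a,b)`. -/
def IsAdjointSolution (a b σ μ lam : ℝ) (φ g w : ℝ → ℝ) : Prop :=
  MemH10 a b w ∧
    ∀ ψ : ℝ → ℝ, MemH10 a b ψ → bilin a b σ μ lam φ ψ w = inner2 a b ψ g

/-- `c` is an `H²` regularity constant: `‖D²v‖ ≤ c ‖f‖` for the boundary value problem and
`‖D²w‖ ≤ c ‖g‖` for the adjoint problem, for all right-hand sides in `L₂(a,b)`. -/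
def IsRegularityConstant (a b σ μ lam : ℝ) (φ : ℝ → ℝ) (c : ℝ) : Prop :=
  (∀ f v : ℝ → ℝ, MemL2 a b f → IsWeakSolution a b σ μ lam φ f v →
      MemH2 a b v ∧ norm2 a b (D a b (D a b v)) ≤ c * norm2 a b f) ∧
  (∀ g w : ℝ → ℝ, MemL2 a b g → IsAdjointSolution a b σ μ lam φ g w →
      MemH2 a b w ∧ norm2 a b (D a b (D a b w)) ≤ c * norm2 a b g)

/-! ### The constants -/

/-- `M = max(|a|,|b|)`. -/
def cM (a b : ℝ) : ℝ := max |a| |b|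

/-- The Poincaré constant `c₂ = (b-a)/π`. -/
def c2 (a b : ℝ) : ℝ := (b - a) / Real.pi

/-- The boundedness constant `c₁ = ½ σ² + c₂ (μ max(|a|,|b|) + 2 λ c₂)`. -/
def c1 (a b σ μ lam : ℝ) : ℝ :=
  1 / 2 * σ ^ 2 + c2 a b * (μ * cM a b + 2 * lam * c2 a b)

/-- The positive root `γ` of `½ σ² γ² - μ b γ - λ = 1`. -/
def gam (b σ μ lam : ℝ) : ℝ :=
  μ * b / σ ^ 2 + Real.sqrt ((μ * b / σ ^ 2) ^ 2 + 2 * (lam + 1) / σ ^ 2)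

/-- `c₄ = exp(γ (b-a))`. -/
def c4 (a b σ μ lam : ℝ) : ℝ := Real.exp (gam b σ μ lam * (b - a))

/-- `c₅ = (b-a) c₄`. -/
def c5 (a b σ μ lam : ℝ) : ℝ := (b - a) * c4 a b σ μ lam

/-- `c₆ = c₂ (2 σ⁻² μ⁻¹ + 4 σ⁻⁴ μ² c₅²)^½`. -/
def c6 (a b σ μ lam : ℝ) : ℝ :=
  c2 a b * Real.sqrt (2 / (σ ^ 2 * μ) + 4 * μ ^ 2 * c5 a b σ μ lam ^ 2 / σ ^ 4)

/-- `c₇ = 4 σ⁻²`. -/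
def c7 (σ : ℝ) : ℝ := 4 / σ ^ 2

/-- `c₈ = 4 σ⁻² (2 λ + μ + σ⁻² μ² max(|a|,|b|)²)`. -/
def c8 (a b σ μ lam : ℝ) : ℝ :=
  4 / σ ^ 2 * (2 * lam + μ + μ ^ 2 * cM a b ^ 2 / σ ^ 2)

/-- The explicit regularity constant `c₃ = c₇ + c₆ c₈`. -/
def c3 (a b σ μ lam : ℝ) : ℝ := c7 σ + c6 a b σ μ lam * c8 a b σ μ lam

/-- The threshold `h₀ = σ / (2^½ μ^½ c₁ C)` belonging to a regularity constant `C`. -/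
def h0 (a b σ μ lam C : ℝ) : ℝ :=
  σ / (Real.sqrt 2 * Real.sqrt μ * c1 a b σ μ lam * C)

/-! ### The finite element method -/

/-- A mesh `a = x₀ < x₁ < ⋯ < x_N = b`. -/
structure Mesh (a b : ℝ) where
  N : ℕ
  node : Fin (N + 1) → ℝ
  strictMono : StrictMono node
  node_zero : node 0 = a
  node_last : node (Fin.last N) = b

/-- The maximal mesh size `h = max_j (x_j - x_{j-1})`. -/
def Mesh.size {a b : ℝ} (T : Mesh a b) : ℝ :=
  ⨆ j : Fin T.N, (T.node j.succ - T.node j.castSucc)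

/-- `V_h`: the continuous functions that are polynomials of degree at most one on each mesh
interval and vanish at `a` and `b`, extended by zero outside `(a,b)`. -/
structure Mesh.MemV {a b : ℝ} (T : Mesh a b) (v : ℝ → ℝ) : Prop where
  continuous : Continuous v
  eq_zero : ∀ x, x ∉ Ioo a b → v x = 0
  affine : ∀ j : Fin T.N, ∃ p q : ℝ,
    ∀ x ∈ Icc (T.node j.castSucc) (T.node j.succ), v x = p + q * x

/-- `v_h ∈ V_h` solves the finite element problem `A(v_h, φ_h) = (f, φ_h)` for all
`φ_h ∈ V_h`. -/
def IsFEMSolution {a b : ℝ} (T : Mesh a b) (σ μ lam : ℝ) (φ f vh : ℝ → ℝ) : Prop :=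
  T.MemV vh ∧
    ∀ ψ : ℝ → ℝ, T.MemV ψ → bilin a b σ μ lam φ vh ψ = inner2 a b f ψ

end JumpOU

end

/-!
Everything rests on one description of `H¹₀(a,b)`: by the du Bois-Reymond lemma
(`HasWeakDeriv.ae_const`) a continuous function with an `L₂` weak derivative is the primitive of
that derivative (`IsPrim`, `IsPrim.of_hasWeakDeriv`). Primitives are absolutely continuous, so they
obey the product rule (`IsPrim.mul`), and integration by parts is available throughout. It yields
Friedrichs' inequality with the sharp constant `c₂` (`norm2_le_c2_mul`). The jump operator is
`λ (M - 1)`, where `M u (x) = ∫ u (x + y) φ(y) dy` is a symmetric contraction of `L₂`; together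
with `∫ x u' u = -½ ‖u‖²` this gives continuity of the form with the constant `c₁` (`abs_bilin_le`)
and the Gårding inequality `½σ² ‖u'‖² - ½μ ‖u‖² ≤ A(u, u)` (`garding`).

*Regularity.* The equation expresses `u''` through `u'`, `u` and the data. The interpolation
inequality `‖u'‖² ≤ ‖u‖ ‖u''‖` absorbs the `u'` term, so that `‖u''‖ ≤ c₇ ‖f‖ + c₈ ‖u‖` for both
problems.

*Uniqueness.* For continuous data the solution is classical, and comparison with the barrier
`e^{γ(b-a)} - e^{γ(x-a)}` bounds it by `e^{γ(b-a)} sup |f|` (`IsWeakSolution.abs_le_c4`). In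
particular the homogeneous problem has only the zero solution. Gårding's inequality alone would
not give this, since `μ` need not be small.

*Existence.* In terms of derivatives, which range over the functions of mean zero, the form is
represented by the operator `½σ² - Q P R Q` on `L₂(a,b)`, with `Q` the projection onto the functions
of mean zero, `P` the compact primitive operator and `R` the bounded operator of the lower order
terms. It is injective by uniqueness, hence invertible by the Fredholm alternative
(`isUnit_formOp`), and so is its adjoint, which belongs to the adjoint problem.

*The constant `c₃`.* Testing the primal problem with data close to `sign w` turns the maximum
principle into the bound `‖w‖_{L₁} ≤ e^{γ(b-a)} ‖g‖_{L₁}` for adjoint solutions. With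
`‖w‖² ≤ ‖w‖_∞ ‖w‖_{L₁}` and Gårding's inequality this becomes `‖w‖ ≤ c₆ ‖g‖`
(`IsAdjointSolution.norm2_le`). The solution operators of the two problems are adjoint to each
other, so `‖v‖ ≤ c₆ ‖f‖` as well.

*Finite elements.* The slopes of the nodal interpolant are the mean values of the derivative over
the mesh intervals, so the derivative of the interpolation error is at most `h ‖u''‖`
(`exists_interpolant`). Galerkin orthogonality and the adjoint problem give
`‖e‖ ≤ c₁ c₃ h ‖e'‖` for the error `e`; if `h ≤ h₀`, the negative term in Gårding's inequality is
then absorbed, and both estimates follow (`IsFEMSolution.error_le`). Applied to zero data they show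
that the finite-dimensional discrete problem is injective, hence uniquely solvable.
-/

namespace JumpOU

variable {a b : ℝ}

/-! ### Square integrable functions -/

theorem integral_eq_restrict (hab : a < b) (f : ℝ → ℝ) :
    ∫ x in a..b, f x = ∫ x, f x ∂volume.restrict (Ioo a b) := by
  rw [intervalIntegral.integral_of_le hab.le, integral_Ioc_eq_integral_Ioo]

theorem integral_congr_restrict (hab : a < b) {f g : ℝ → ℝ}
    (h : f =ᵐ[volume.restrict (Ioo a b)] g) : ∫ x in a..b, f x = ∫ x in a..b, g x := by
  rw [integral_eq_restrict hab, integral_eq_restrict hab]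
  exact integral_congr_ae h

theorem intervalIntegrable_iff_restrict (hab : a < b) {f : ℝ → ℝ} :
    IntervalIntegrable f volume a b ↔ Integrable f (volume.restrict (Ioo a b)) := by
  rw [intervalIntegrable_iff_integrableOn_Ioo_of_le hab.le]; rfl

namespace MemL2

variable {f g : ℝ → ℝ}

theorem add (hf : MemL2 a b f) (hg : MemL2 a b g) : MemL2 a b (fun x => f x + g x) :=
  MemLp.add hf hg

theorem sub (hf : MemL2 a b f) (hg : MemL2 a b g) : MemL2 a b (fun x => f x - g x) :=
  MemLp.sub hf hg

theorem neg (hf : MemL2 a b f) : MemL2 a b (fun x => -f x) := MemLp.neg hf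

theorem const_mul (hf : MemL2 a b f) (c : ℝ) : MemL2 a b (fun x => c * f x) :=
  MemLp.const_mul hf c

theorem congr (hf : MemL2 a b f) (h : f =ᵐ[volume.restrict (Ioo a b)] g) : MemL2 a b g :=
  (memLp_congr_ae h).1 hf

theorem integrable (hf : MemL2 a b f) : Integrable f (volume.restrict (Ioo a b)) :=
  MemLp.integrable (by norm_num) hf

theorem intervalIntegrable (hab : a < b) (hf : MemL2 a b f) : IntervalIntegrable f volume a b :=
  (intervalIntegrable_iff_restrict hab).2 hf.integrable

theorem integrable_mul (hf : MemL2 a b f) (hg : MemL2 a b g) :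
    Integrable (fun x => f x * g x) (volume.restrict (Ioo a b)) :=
  MemLp.integrable_mul hf hg

theorem integrable_sq (hf : MemL2 a b f) :
    Integrable (fun x => f x ^ 2) (volume.restrict (Ioo a b)) := MemLp.integrable_sq hf

theorem of_bound {B : ℝ} (hf : AEStronglyMeasurable f (volume.restrict (Ioo a b)))
    (hB : ∀ x ∈ Ioo a b, |f x| ≤ B) : MemL2 a b f :=
  MemLp.of_bound hf B ((ae_restrict_iff' measurableSet_Ioo).2 (Filter.Eventually.of_forall hB))

/-- The product of a bounded function and an `L₂` function is in `L₂`. -/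
theorem bdd_mul {B : ℝ} (hg : MemL2 a b g)
    (hf : AEStronglyMeasurable f (volume.restrict (Ioo a b)))
    (hB : ∀ x ∈ Ioo a b, |f x| ≤ B) : MemL2 a b (fun x => f x * g x) := by
  refine MemLp.of_le_mul (c := B) hg (hf.mul hg.1) ?_
  refine (ae_restrict_iff' measurableSet_Ioo).2 (Filter.Eventually.of_forall fun x hx => ?_)
  rw [norm_mul]
  exact mul_le_mul_of_nonneg_right (hB x hx) (norm_nonneg _)

theorem of_continuousOn (hf : ContinuousOn f (Icc a b)) : MemL2 a b f := by
  obtain ⟨B, hB⟩ := isCompact_Icc.exists_bound_of_continuousOn hf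
  exact of_bound ((hf.mono Ioo_subset_Icc_self).aestronglyMeasurable measurableSet_Ioo)
    fun x hx => hB x (Ioo_subset_Icc_self hx)

theorem continuousOn_mul (hg : MemL2 a b g) (hf : ContinuousOn f (Icc a b)) :
    MemL2 a b (fun x => f x * g x) := by
  obtain ⟨B, hB⟩ := isCompact_Icc.exists_bound_of_continuousOn hf
  exact hg.bdd_mul ((hf.mono Ioo_subset_Icc_self).aestronglyMeasurable measurableSet_Ioo)
    fun x hx => hB x (Ioo_subset_Icc_self hx)

end MemL2

theorem memL2_zero : MemL2 a b (fun _ => 0) := MemLp.zero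

/-! ### Norm and scalar product -/

theorem norm2_nonneg (f : ℝ → ℝ) : 0 ≤ norm2 a b f := Real.sqrt_nonneg _

theorem norm2_sq (hab : a < b) (f : ℝ → ℝ) : norm2 a b f ^ 2 = ∫ x in a..b, f x ^ 2 :=
  Real.sq_sqrt (intervalIntegral.integral_nonneg hab.le fun _ _ => sq_nonneg _)

theorem inner2_self (hab : a < b) (f : ℝ → ℝ) : inner2 a b f f = norm2 a b f ^ 2 := by
  rw [norm2_sq hab, inner2]; simp only [sq]

theorem norm2_congr (hab : a < b) {f g : ℝ → ℝ} (h : f =ᵐ[volume.restrict (Ioo a b)] g) :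
    norm2 a b f = norm2 a b g := by
  unfold norm2
  rw [integral_congr_restrict hab]
  filter_upwards [h] with x hx
  rw [hx]

theorem inner2_congr (hab : a < b) {f f' g g' : ℝ → ℝ} (h : f =ᵐ[volume.restrict (Ioo a b)] f')
    (h' : g =ᵐ[volume.restrict (Ioo a b)] g') : inner2 a b f g = inner2 a b f' g' := by
  unfold inner2
  rw [integral_congr_restrict hab]
  filter_upwards [h, h'] with x hx hx'
  rw [hx, hx']

theorem inner2_comm (f g : ℝ → ℝ) : inner2 a b f g = inner2 a b g f := by
  simp only [inner2, mul_comm]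

theorem inner2_add_left (hab : a < b) {f g h : ℝ → ℝ} (hf : MemL2 a b f) (hg : MemL2 a b g)
    (hh : MemL2 a b h) :
    inner2 a b (fun x => f x + g x) h = inner2 a b f h + inner2 a b g h := by
  simp only [inner2, integral_eq_restrict hab, add_mul]
  exact integral_add (hf.integrable_mul hh) (hg.integrable_mul hh)

theorem inner2_sub_left (hab : a < b) {f g h : ℝ → ℝ} (hf : MemL2 a b f) (hg : MemL2 a b g)
    (hh : MemL2 a b h) :
    inner2 a b (fun x => f x - g x) h = inner2 a b f h - inner2 a b g h := by
  simp only [inner2, integral_eq_restrict hab, sub_mul]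
  exact integral_sub (hf.integrable_mul hh) (hg.integrable_mul hh)

theorem inner2_smul_left (c : ℝ) (f g : ℝ → ℝ) :
    inner2 a b (fun x => c * f x) g = c * inner2 a b f g := by
  simp only [inner2, mul_assoc, intervalIntegral.integral_const_mul]

theorem inner2_add_right (hab : a < b) {f g h : ℝ → ℝ} (hf : MemL2 a b f) (hg : MemL2 a b g)
    (hh : MemL2 a b h) :
    inner2 a b h (fun x => f x + g x) = inner2 a b h f + inner2 a b h g := by
  rw [inner2_comm, inner2_add_left hab hf hg hh, inner2_comm f, inner2_comm g]

theorem inner2_sub_right (hab : a < b) {f g h : ℝ → ℝ} (hf : MemL2 a b f) (hg : MemL2 a b g)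
    (hh : MemL2 a b h) :
    inner2 a b h (fun x => f x - g x) = inner2 a b h f - inner2 a b h g := by
  rw [inner2_comm, inner2_sub_left hab hf hg hh, inner2_comm f, inner2_comm g]

theorem inner2_smul_right (c : ℝ) (f g : ℝ → ℝ) :
    inner2 a b f (fun x => c * g x) = c * inner2 a b f g := by
  rw [inner2_comm, inner2_smul_left, inner2_comm]

/-- The Cauchy-Schwarz inequality. -/
theorem abs_inner2_le (hab : a < b) {f g : ℝ → ℝ} (hf : MemL2 a b f) (hg : MemL2 a b g) :
    |inner2 a b f g| ≤ norm2 a b f * norm2 a b g := by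
  have key : inner2 a b f g ^ 2 ≤ norm2 a b f ^ 2 * norm2 a b g ^ 2 := by
    have h : ∀ t : ℝ,
        0 ≤ norm2 a b g ^ 2 * (t * t) + 2 * inner2 a b f g * t + norm2 a b f ^ 2 := by
      intro t
      have h1 : 0 ≤ inner2 a b (fun x => f x + t * g x) (fun x => f x + t * g x) := by
        rw [inner2_self hab]; positivity
      rw [inner2_add_left hab hf (hg.const_mul t) (hf.add (hg.const_mul t)),
        inner2_add_right hab hf (hg.const_mul t) hf,
        inner2_add_right hab hf (hg.const_mul t) (hg.const_mul t), inner2_smul_left,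
        inner2_smul_left, inner2_smul_right, inner2_smul_right, inner2_self hab, inner2_self hab,
        inner2_comm g f] at h1
      linarith
    have := discrim_le_zero h
    unfold discrim at this
    nlinarith
  rw [← mul_pow] at key
  exact abs_le_of_sq_le_sq key
    (mul_nonneg (norm2_nonneg (a := a) (b := b) f) (norm2_nonneg g))

theorem inner2_le (hab : a < b) {f g : ℝ → ℝ} (hf : MemL2 a b f) (hg : MemL2 a b g) :
    inner2 a b f g ≤ norm2 a b f * norm2 a b g :=
  (le_abs_self _).trans (abs_inner2_le hab hf hg)

theorem norm2_add_le (hab : a < b) {f g : ℝ → ℝ} (hf : MemL2 a b f) (hg : MemL2 a b g) :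
    norm2 a b (fun x => f x + g x) ≤ norm2 a b f + norm2 a b g := by
  refine abs_le_of_sq_le_sq' ?_ (add_nonneg (norm2_nonneg _) (norm2_nonneg _)) |>.2
  rw [← inner2_self hab, inner2_add_left hab hf hg (hf.add hg), inner2_add_right hab hf hg hf,
    inner2_add_right hab hf hg hg, inner2_self hab, inner2_self hab, inner2_comm g f]
  nlinarith [inner2_le hab hf hg]

theorem norm2_smul (c : ℝ) (f : ℝ → ℝ) : norm2 a b (fun x => c * f x) = |c| * norm2 a b f := by
  simp only [norm2, mul_pow, intervalIntegral.integral_const_mul]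
  rw [Real.sqrt_mul (sq_nonneg c), Real.sqrt_sq_eq_abs]

theorem norm2_neg (f : ℝ → ℝ) : norm2 a b (fun x => -f x) = norm2 a b f := by
  simp only [norm2, neg_sq]

theorem norm2_sub_le (hab : a < b) {f g : ℝ → ℝ} (hf : MemL2 a b f) (hg : MemL2 a b g) :
    norm2 a b (fun x => f x - g x) ≤ norm2 a b f + norm2 a b g := by
  have := norm2_add_le hab hf hg.neg
  rw [norm2_neg] at this
  simpa only [sub_eq_add_neg] using this

theorem norm2_le_of_abs_le (hab : a < b) {c : ℝ} (hc : 0 ≤ c) {f g : ℝ → ℝ} (hf : MemL2 a b f)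
    (hg : MemL2 a b g) (h : ∀ x ∈ Ioo a b, |f x| ≤ c * |g x|) :
    norm2 a b f ≤ c * norm2 a b g := by
  rw [← abs_of_nonneg hc, ← norm2_smul]
  refine Real.sqrt_le_sqrt ?_
  rw [integral_eq_restrict hab, integral_eq_restrict hab]
  refine setIntegral_mono_on hf.integrable_sq (hg.const_mul c).integrable_sq measurableSet_Ioo ?_
  intro x hx
  rw [sq_le_sq, abs_mul, abs_of_nonneg hc]
  exact h x hx

theorem norm2_le_of_sq_le {f : ℝ → ℝ} {B : ℝ} (hB : 0 ≤ B) (h : ∫ x in a..b, f x ^ 2 ≤ B ^ 2) :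
    norm2 a b f ≤ B := Real.sqrt_le_iff.2 ⟨hB, h⟩

/-- The `L₁` norm is bounded by the `L₂` norm. -/
theorem integral_abs_le (hab : a < b) {f : ℝ → ℝ} (hf : MemL2 a b f) :
    ∫ x in a..b, |f x| ≤ Real.sqrt (b - a) * norm2 a b f := by
  have h1 : MemL2 a b (fun _ => (1 : ℝ)) := .of_continuousOn continuousOn_const
  have h := inner2_le hab h1 (g := fun x => |f x|) hf.abs
  simpa [inner2, norm2, sq_abs] using h

theorem integral_eq_of_eq_zero (hab : a < b) {F : ℝ → ℝ} (h : ∀ x, x ∉ Ioo a b → F x = 0) :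
    ∫ x in a..b, F x = ∫ x, F x := by
  rw [integral_eq_restrict hab]
  exact setIntegral_eq_integral_of_forall_compl_eq_zero h

/-! ### Primitives of square integrable functions -/

theorem primitive_congr {g h : ℝ → ℝ} (hgh : g =ᵐ[volume.restrict (Ioo a b)] h) {x : ℝ}
    (hx : x ∈ Icc a b) : ∫ t in a..x, g t = ∫ t in a..x, h t := by
  refine intervalIntegral.integral_congr_ae ?_
  rw [Filter.EventuallyEq, ae_restrict_iff' measurableSet_Ioo] at hgh
  have hb : ∀ᵐ t : ℝ, t ≠ b := by simp [ae_iff, measure_singleton]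
  filter_upwards [hgh, hb] with t ht htb hmem
  rw [uIoc_of_le hx.1] at hmem
  exact ht ⟨hmem.1, lt_of_le_of_ne (hmem.2.trans hx.2) htb⟩

/-- On `[a, b]`, the function `u` is a primitive of `g ∈ L₂(a,b)`. Only the values of `u` on the
closed interval and the almost everywhere class of `g` on `(a, b)` matter. -/
structure IsPrim (a b : ℝ) (u g : ℝ → ℝ) : Prop where
  memL2 : MemL2 a b g
  eq_add : ∀ x ∈ Icc a b, u x = u a + ∫ t in a..x, g t

namespace IsPrim

variable {u w g h : ℝ → ℝ}

theorem integral_eq (hab : a < b) (hu : IsPrim a b u g) : ∫ x in a..b, g x = u b - u a := by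
  have := hu.eq_add b (right_mem_Icc.2 hab.le)
  linarith

theorem of_eqOn (hu : IsPrim a b u g) (hab : a < b) (h : ∀ x ∈ Icc a b, w x = u x) :
    IsPrim a b w g :=
  ⟨hu.memL2, fun x hx => by rw [h x hx, h a (left_mem_Icc.2 hab.le)]; exact hu.eq_add x hx⟩

theorem integral_eq_sub {c x : ℝ} (hc : c ∈ Icc a b) (hx : x ∈ Icc a b) (hab : a < b)
    (hu : IsPrim a b u g) : ∫ t in c..x, g t = u x - u c := by
  have hi := hu.memL2.intervalIntegrable hab
  have hs : ∀ y ∈ Icc a b, IntervalIntegrable g volume a y := fun y hy =>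
    hi.mono_set (by rw [uIcc_of_le hy.1, uIcc_of_le hab.le]; exact Icc_subset_Icc_right hy.2)
  rw [← intervalIntegral.integral_interval_sub_left (hs x hx) (hs c hc), hu.eq_add x hx,
    hu.eq_add c hc]
  ring

theorem congr_right (hu : IsPrim a b u g)
    (h' : g =ᵐ[volume.restrict (Ioo a b)] h) : IsPrim a b u h := by
  refine ⟨hu.memL2.congr h', fun x hx => ?_⟩
  rw [hu.eq_add x hx, primitive_congr h' hx]

theorem absolutelyContinuous (hab : a < b) (hu : IsPrim a b u g) :
    AbsolutelyContinuousOnInterval (fun x => u a + ∫ t in a..x, g t) a b := by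
  refine AbsolutelyContinuousOnInterval.add (f := fun _ => u a) ?_ ?_
  · exact (LipschitzWith.const (u a)).lipschitzOnWith.absolutelyContinuousOnInterval (K := 0)
  · exact (hu.memL2.intervalIntegrable hab).absolutelyContinuousOnInterval_intervalIntegral
      left_mem_uIcc

theorem continuousOn (hab : a < b) (hu : IsPrim a b u g) : ContinuousOn u (Icc a b) := by
  have := (hu.absolutelyContinuous hab).continuousOn
  rw [uIcc_of_le hab.le] at this
  exact this.congr hu.eq_add

theorem memL2_left (hab : a < b) (hu : IsPrim a b u g) : MemL2 a b u :=
  .of_continuousOn (hu.continuousOn hab)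

theorem ae_deriv (hab : a < b) (hu : IsPrim a b u g) :
    ∀ᵐ x, x ∈ uIcc a b → deriv (fun x => u a + ∫ t in a..x, g t) x = g x := by
  filter_upwards [(hu.memL2.intervalIntegrable hab).ae_hasDerivAt_integral] with x hx hmem
  exact ((hx hmem a left_mem_uIcc).const_add _).deriv

/-- The product rule, which is integration by parts in the form used throughout. -/
theorem mul (hab : a < b) (hu : IsPrim a b u g) (hw : IsPrim a b w h) :
    IsPrim a b (fun x => u x * w x) (fun x => g x * w x + u x * h x) := by
  refine ⟨?_, fun x hx => ?_⟩
  · refine MemL2.add ?_ (hw.memL2.continuousOn_mul (hu.continuousOn hab))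
    simpa only [mul_comm] using hu.memL2.continuousOn_mul (hw.continuousOn hab)
  have hsub : uIcc a x ⊆ uIcc a b := by
    rw [uIcc_of_le hx.1, uIcc_of_le hab.le]; exact Icc_subset_Icc_right hx.2
  have key := ((hu.absolutelyContinuous hab).mono hsub).integral_deriv_mul_eq_sub
    ((hw.absolutelyContinuous hab).mono hsub)
  have e : ∫ t in a..x, (g t * w t + u t * h t) = ∫ t in a..x,
      (deriv (fun x => u a + ∫ t in a..x, g t) t * (w a + ∫ s in a..t, h s)
        + (u a + ∫ s in a..t, g s) * deriv (fun x => w a + ∫ t in a..x, h t) t) := by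
    refine intervalIntegral.integral_congr_ae ?_
    filter_upwards [hu.ae_deriv hab, hw.ae_deriv hab] with t h1 h2 hmem
    have ht : t ∈ uIcc a b := hsub (uIoc_subset_uIcc hmem)
    rw [h1 ht, h2 ht]
    rw [uIcc_of_le hab.le] at ht
    rw [← hu.eq_add t ht, ← hw.eq_add t ht]
  rw [e, key, ← hu.eq_add x hx, ← hw.eq_add x hx]
  simp

theorem add (hu : IsPrim a b u g) (hw : IsPrim a b w h) (hab : a < b) :
    IsPrim a b (fun x => u x + w x) (fun x => g x + h x) := by
  refine ⟨hu.memL2.add hw.memL2, fun x hx => ?_⟩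
  rw [intervalIntegral.integral_add, hu.integral_eq_sub (left_mem_Icc.2 hab.le) hx hab,
    hw.integral_eq_sub (left_mem_Icc.2 hab.le) hx hab]
  · ring
  all_goals
    refine (MemL2.intervalIntegrable hab (by first | exact hu.memL2 | exact hw.memL2)).mono_set ?_
    rw [uIcc_of_le hx.1, uIcc_of_le hab.le]; exact Icc_subset_Icc_right hx.2

theorem const_mul (hu : IsPrim a b u g) (c : ℝ) :
    IsPrim a b (fun x => c * u x) (fun x => c * g x) := by
  refine ⟨hu.memL2.const_mul c, fun x hx => ?_⟩
  rw [intervalIntegral.integral_const_mul, hu.eq_add x hx]; ring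

theorem sub (hu : IsPrim a b u g) (hw : IsPrim a b w h) (hab : a < b) :
    IsPrim a b (fun x => u x - w x) (fun x => g x - h x) := by
  simpa [sub_eq_add_neg] using hu.add (hw.const_mul (-1)) hab

theorem of_hasDerivAt (hu : ∀ x ∈ Icc a b, HasDerivAt u (g x) x)
    (hg : ContinuousOn g (Icc a b)) : IsPrim a b u g := by
  refine ⟨.of_continuousOn hg, fun x hx => ?_⟩
  have hsub : uIcc a x ⊆ Icc a b := by rw [uIcc_of_le hx.1]; exact Icc_subset_Icc_right hx.2
  rw [intervalIntegral.integral_eq_sub_of_hasDerivAt (fun t ht => hu t (hsub ht))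
    (hg.mono hsub).intervalIntegrable]
  ring

theorem id : IsPrim a b (fun x => x) (fun _ => 1) :=
  .of_hasDerivAt (fun x _ => hasDerivAt_id x) continuousOn_const

theorem integral (hg : MemL2 a b g) (c : ℝ) : IsPrim a b (fun x => c + ∫ t in a..x, g t) g :=
  ⟨hg, fun x _ => by simp⟩

/-- A primitive vanishing at `a` is bounded by `√(b - a)` times the norm of its derivative. -/
theorem abs_le (hab : a < b) (hu : IsPrim a b u g) (ha : u a = 0) {x : ℝ} (hx : x ∈ Icc a b) :
    |u x| ≤ Real.sqrt (b - a) * norm2 a b g := by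
  rw [hu.eq_add x hx, ha, zero_add]
  have hi := (hu.memL2.intervalIntegrable hab).abs
  calc |∫ t in a..x, g t| ≤ ∫ t in a..x, |g t| :=
        intervalIntegral.abs_integral_le_integral_abs hx.1
    _ ≤ ∫ t in a..b, |g t| := by
        refine intervalIntegral.integral_mono_interval le_rfl hx.1 hx.2 ?_ hi
        exact Filter.Eventually.of_forall fun t => abs_nonneg _
    _ ≤ _ := integral_abs_le hab hu.memL2

end IsPrim

/-! ### Weak derivatives -/

theorem test_eq_zero {ψ : ℝ → ℝ} (h : tsupport ψ ⊆ Ioo a b) {x : ℝ} (hx : x ∉ Ioo a b) :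
    ψ x = 0 := image_eq_zero_of_notMem_tsupport fun h' => hx (h h')

theorem IsPrim.of_contDiff {ψ : ℝ → ℝ} (h : ContDiff ℝ ∞ ψ) :
    IsPrim a b ψ (deriv ψ) :=
  .of_hasDerivAt (fun x _ => (h.differentiable (by simp) x).hasDerivAt)
    (h.continuous_deriv (by simp)).continuousOn

theorem IsPrim.hasWeakDeriv (hab : a < b) {u g : ℝ → ℝ} (hu : IsPrim a b u g) :
    HasWeakDeriv a b u g := by
  intro ψ hψ _ hs
  have hp : IsPrim a b ψ (deriv ψ) := .of_contDiff hψ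
  have h := (hu.mul hab hp).integral_eq hab
  rw [test_eq_zero hs (x := a) (by simp), test_eq_zero hs (x := b) (by simp)] at h
  rw [intervalIntegral.integral_add] at h
  · linarith
  · rw [intervalIntegrable_iff_restrict hab]; exact hu.memL2.integrable_mul (hp.memL2_left hab)
  · rw [intervalIntegrable_iff_restrict hab]; exact (hu.memL2_left hab).integrable_mul hp.memL2

theorem MemL2.test_mul (hab : a < b) {u ψ : ℝ → ℝ} (hu : MemL2 a b u) (hψ : Continuous ψ) :
    IntervalIntegrable (fun x => u x * ψ x) volume a b := by
  rw [intervalIntegrable_iff_restrict hab]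
  exact hu.integrable_mul (.of_continuousOn hψ.continuousOn)

theorem ae_eq_zero_of_test (hab : a < b) {z : ℝ → ℝ} (hz : MemL2 a b z)
    (h : ∀ ψ : ℝ → ℝ, ContDiff ℝ ∞ ψ → HasCompactSupport ψ → tsupport ψ ⊆ Ioo a b →
      ∫ x in a..b, z x * ψ x = 0) : z =ᵐ[volume.restrict (Ioo a b)] 0 := by
  rw [Filter.EventuallyEq, ae_restrict_iff' measurableSet_Ioo]
  refine isOpen_Ioo.ae_eq_zero_of_integral_contDiff_smul_eq_zero
    (IntegrableOn.locallyIntegrableOn hz.integrable) fun ψ h1 h2 h3 => ?_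
  rw [← h ψ h1 h2 h3, integral_eq_of_eq_zero hab]
  · simp only [smul_eq_mul, mul_comm]
  · intro x hx; rw [test_eq_zero h3 hx, mul_zero]

theorem HasWeakDeriv.ae_eq (hab : a < b) {u g h : ℝ → ℝ} (hg : MemL2 a b g) (hh : MemL2 a b h)
    (h1 : HasWeakDeriv a b u g) (h2 : HasWeakDeriv a b u h) :
    g =ᵐ[volume.restrict (Ioo a b)] h := by
  have := ae_eq_zero_of_test hab (hg.sub hh) fun ψ p1 p2 p3 => by
    have e1 := h1 ψ p1 p2 p3
    have e2 := h2 ψ p1 p2 p3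
    simp only [sub_mul]
    rw [intervalIntegral.integral_sub]
    · linarith
    · exact hg.test_mul hab p1.continuous
    · exact hh.test_mul hab p1.continuous
  filter_upwards [this] with x hx
  exact sub_eq_zero.1 hx

/-- The du Bois-Reymond lemma: a function with vanishing weak derivative is constant. -/
theorem HasWeakDeriv.ae_const (hab : a < b) {z : ℝ → ℝ} (hz : MemL2 a b z)
    (h : HasWeakDeriv a b z fun _ => 0) : ∃ c, z =ᵐ[volume.restrict (Ioo a b)] fun _ => c := by
  -- Fix a test function `ρ` of integral one; every test function `η` differs from a multiple
  -- of `ρ` by the derivative of a test function.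
  let B : ContDiffBump ((a + b) / 2) := ⟨(b - a) / 8, (b - a) / 4, by linarith, by linarith⟩
  let ρ : ℝ → ℝ := B.normed volume
  have hρ1 : ContDiff ℝ ∞ ρ := B.contDiff_normed
  have hρ2 : HasCompactSupport ρ := B.hasCompactSupport_normed
  have hρ3 : tsupport ρ ⊆ Ioo a b := by
    rw [B.tsupport_normed_eq, Real.closedBall_eq_Icc]
    intro x hx
    simp only [B] at hx
    constructor <;> linarith [hx.1, hx.2]
  have hρ4 : ∫ x in a..b, ρ x = 1 := by
    rw [integral_eq_of_eq_zero hab fun x hx => test_eq_zero hρ3 hx]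
    exact B.integral_normed
  refine ⟨∫ x in a..b, z x * ρ x, ?_⟩
  have hc : MemL2 a b fun _ => ∫ x in a..b, z x * ρ x := .of_continuousOn continuousOn_const
  have := ae_eq_zero_of_test hab (hz.sub hc) fun η p1 p2 p3 => by
    set m := ∫ x in a..b, η x with hm
    let κ : ℝ → ℝ := fun x => η x - m * ρ x
    have hκ : ContDiff ℝ ∞ κ := p1.sub (contDiff_const.mul hρ1)
    let ψ : ℝ → ℝ := fun x => ∫ t in a..x, κ t
    have hd : ∀ x, HasDerivAt ψ (κ x) x := fun x =>
      intervalIntegral.integral_hasDerivAt_right (hκ.continuous.intervalIntegrable _ _)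
        (hκ.continuous.stronglyMeasurableAtFilter _ _) hκ.continuous.continuousAt
    have hdψ : deriv ψ = κ := funext fun x => (hd x).deriv
    have hψ : ContDiff ℝ ∞ ψ := by
      rw [contDiff_infty_iff_deriv, hdψ]
      exact ⟨fun x => (hd x).differentiableAt, hκ⟩
    -- both test functions live on a common compact interval `[c, d]` inside `(a, b)`
    obtain ⟨c, d, hac, hdb, hcd⟩ : ∃ c d, a < c ∧ d < b ∧ ∀ x, x ∉ Icc c d → κ x = 0 := by
      let K := tsupport η ∪ tsupport ρ
      have hK : IsCompact K := p2.isCompact.union hρ2.isCompact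
      have hKs : K ⊆ Ioo a b := union_subset p3 hρ3
      have hKn : K.Nonempty := by
        rw [nonempty_iff_ne_empty]
        intro h0
        have : ∀ x, ρ x = 0 := fun x =>
          image_eq_zero_of_notMem_tsupport fun hx => by
            have : x ∈ K := Or.inr hx
            rw [h0] at this; exact this
        simp [this] at hρ4
      refine ⟨sInf K, sSup K, (hKs (hK.sInf_mem hKn)).1, (hKs (hK.sSup_mem hKn)).2, ?_⟩
      intro x hx
      have hxK : x ∉ K := fun h' => hx ⟨csInf_le hK.bddBelow h', le_csSup hK.bddAbove h'⟩
      have h1 : η x = 0 := image_eq_zero_of_notMem_tsupport fun h' => hxK (Or.inl h')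
      have h2 : ρ x = 0 := image_eq_zero_of_notMem_tsupport fun h' => hxK (Or.inr h')
      simp [κ, h1, h2]
    have hκint : ∫ x in a..b, κ x = 0 := by
      simp only [κ]
      rw [intervalIntegral.integral_sub, intervalIntegral.integral_const_mul, hρ4, ← hm]
      · ring
      · exact p1.continuous.intervalIntegrable _ _
      · exact (continuous_const.mul hρ1.continuous).intervalIntegrable _ _
    have hψ0 : ∀ x, x ∉ Icc c d → ψ x = 0 := by
      intro x hx
      rcases lt_or_ge x c with hxc | hxc
      · refine intervalIntegral.integral_zero_ae (Filter.Eventually.of_forall fun t ht => ?_)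
        refine hcd t fun h' => ?_
        have := (uIoc_subset_uIcc ht)
        rw [mem_uIcc] at this
        rcases this with h | h <;> linarith [h'.1, h.1, h.2]
      · have hdx : d < x := by by_contra h'; exact hx ⟨hxc, not_lt.1 h'⟩
        have : ψ x = ψ x - ψ b := by
          change ψ x = ψ x - ∫ t in a..b, κ t
          rw [hκint, sub_zero]
        rw [this]
        simp only [ψ]
        rw [intervalIntegral.integral_interval_sub_left (hκ.continuous.intervalIntegrable _ _)
          (hκ.continuous.intervalIntegrable _ _)]
        refine intervalIntegral.integral_zero_ae (Filter.Eventually.of_forall fun t ht => ?_)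
        refine hcd t fun h' => ?_
        rw [mem_uIoc] at ht
        rcases ht with h | h <;> linarith [h'.2, h.1, h.2]
    have hts : tsupport ψ ⊆ Icc c d := by
      refine closure_minimal (fun x hx => ?_) isClosed_Icc
      by_contra h'
      exact hx (hψ0 x h')
    have hts' : tsupport ψ ⊆ Ioo a b := fun x hx =>
      ⟨hac.trans_le (hts hx).1, (hts hx).2.trans_lt hdb⟩
    have hcs : HasCompactSupport ψ := isCompact_Icc.of_isClosed_subset (isClosed_tsupport ψ) hts
    have h0 := h ψ hψ hcs hts'
    rw [hdψ] at h0
    simp only [zero_mul, intervalIntegral.integral_zero, neg_zero, κ, mul_sub] at h0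
    rw [intervalIntegral.integral_sub (hz.test_mul hab p1.continuous)
      (hz.test_mul hab (ψ := fun x => m * ρ x) (continuous_const.mul hρ1.continuous))] at h0
    simp only [sub_mul]
    rw [intervalIntegral.integral_sub (hz.test_mul hab p1.continuous) (hc.test_mul hab p1.continuous),
      intervalIntegral.integral_const_mul, ← hm]
    have : ∫ x in a..b, z x * (m * ρ x) = (∫ x in a..b, z x * ρ x) * m := by
      rw [← intervalIntegral.integral_mul_const]
      congr 1; ext x; ring
    linarith
  filter_upwards [this] with x hx
  exact sub_eq_zero.1 hx

/-- A function in `H¹` agrees almost everywhere with a primitive of its weak derivative. -/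
theorem HasWeakDeriv.exists_isPrim (hab : a < b) {u g : ℝ → ℝ} (hu : MemL2 a b u)
    (hg : MemL2 a b g) (h : HasWeakDeriv a b u g) :
    ∃ p, IsPrim a b p g ∧ u =ᵐ[volume.restrict (Ioo a b)] p := by
  have hp := IsPrim.integral hg 0
  have h0 : HasWeakDeriv a b (fun x => u x - (0 + ∫ t in a..x, g t)) fun _ => 0 := by
    intro ψ p1 p2 p3
    have e1 := h ψ p1 p2 p3
    have e2 := hp.hasWeakDeriv hab ψ p1 p2 p3
    have hc := p1.continuous_deriv (by simp)
    simp only [sub_mul, zero_mul, intervalIntegral.integral_zero]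
    rw [intervalIntegral.integral_sub (hu.test_mul hab hc) ((hp.memL2_left hab).test_mul hab hc)]
    linarith
  obtain ⟨c, hc⟩ := HasWeakDeriv.ae_const hab (hu.sub (hp.memL2_left hab)) h0
  refine ⟨_, IsPrim.integral hg c, ?_⟩
  filter_upwards [hc] with x hx
  linarith

theorem IsPrim.of_hasWeakDeriv (hab : a < b) {u g : ℝ → ℝ} (hu : ContinuousOn u (Icc a b))
    (hg : MemL2 a b g) (h : HasWeakDeriv a b u g) : IsPrim a b u g := by
  obtain ⟨p, hp, hup⟩ := HasWeakDeriv.exists_isPrim hab (.of_continuousOn hu) hg h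
  have heq : EqOn u p (Icc a b) := by
    have h1 : EqOn u p (Ioo a b) := Measure.eqOn_open_of_ae_eq hup isOpen_Ioo
      (hu.mono Ioo_subset_Icc_self) ((hp.continuousOn hab).mono Ioo_subset_Icc_self)
    exact h1.of_subset_closure hu (hp.continuousOn hab) Ioo_subset_Icc_self
      (by rw [closure_Ioo hab.ne])
  exact hp.of_eqOn hab heq

theorem D_spec {u : ℝ → ℝ} (h : HasL2WeakDeriv a b u) :
    MemL2 a b (D a b u) ∧ HasWeakDeriv a b u (D a b u) := by
  unfold D
  rw [dif_pos h]
  exact h.choose_spec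

theorem D_ae_eq (hab : a < b) {u g : ℝ → ℝ} (hg : MemL2 a b g) (h : HasWeakDeriv a b u g) :
    D a b u =ᵐ[volume.restrict (Ioo a b)] g := by
  have hD := D_spec ⟨g, hg, h⟩
  exact HasWeakDeriv.ae_eq hab hD.1 hg hD.2 h

theorem IsPrim.D_ae_eq (hab : a < b) {u g : ℝ → ℝ} (h : IsPrim a b u g) :
    D a b u =ᵐ[volume.restrict (Ioo a b)] g := JumpOU.D_ae_eq hab h.memL2 (h.hasWeakDeriv hab)

/-! ### The space `H¹₀` -/

namespace MemH10

variable {u v : ℝ → ℝ}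

theorem isPrim (hab : a < b) (hu : MemH10 a b u) : IsPrim a b u (D a b u) :=
  .of_hasWeakDeriv hab hu.continuous.continuousOn (D_spec hu.memH1.2).1 (D_spec hu.memH1.2).2

theorem left_eq_zero (hu : MemH10 a b u) : u a = 0 := hu.eq_zero a (by simp)

theorem right_eq_zero (hu : MemH10 a b u) : u b = 0 := hu.eq_zero b (by simp)

theorem memL2 (hu : MemH10 a b u) : MemL2 a b u := hu.memH1.1

theorem memL2_D (hu : MemH10 a b u) : MemL2 a b (D a b u) := (D_spec hu.memH1.2).1

theorem of_isPrim (hab : a < b) {g : ℝ → ℝ} (hu : IsPrim a b u g)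
    (h0 : ∀ x, x ∉ Ioo a b → u x = 0) : MemH10 a b u := by
  refine ⟨⟨hu.memL2_left hab, g, hu.memL2, hu.hasWeakDeriv hab⟩, ?_, h0⟩
  have hc := hu.continuousOn hab
  have e : u = fun x => u (projIcc a b hab.le x) := by
    funext x
    by_cases hx : x ∈ Icc a b
    · rw [projIcc_of_mem _ hx]
    · rw [h0 x fun h => hx (Ioo_subset_Icc_self h)]
      rcases lt_or_ge x a with h | h
      · rw [projIcc_of_le_left _ h.le, h0 _ (by simp)]
      · rw [projIcc_of_right_le _ (by by_contra h'; exact hx ⟨h, (not_le.1 h').le⟩),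
          h0 _ (by simp)]
  rw [e]
  exact (continuousOn_iff_continuous_domRestrict.1 hc).comp continuous_projIcc

theorem of_test (hab : a < b) {ψ : ℝ → ℝ} (h1 : ContDiff ℝ ∞ ψ) (h3 : tsupport ψ ⊆ Ioo a b) :
    MemH10 a b ψ :=
  .of_isPrim hab (.of_contDiff h1) fun _ hx => test_eq_zero h3 hx

theorem add (hab : a < b) (hu : MemH10 a b u) (hv : MemH10 a b v) :
    MemH10 a b (fun x => u x + v x) :=
  .of_isPrim hab ((hu.isPrim hab).add (hv.isPrim hab) hab) fun x hx => by
    rw [hu.eq_zero x hx, hv.eq_zero x hx, add_zero]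

theorem sub (hab : a < b) (hu : MemH10 a b u) (hv : MemH10 a b v) :
    MemH10 a b (fun x => u x - v x) :=
  .of_isPrim hab ((hu.isPrim hab).sub (hv.isPrim hab) hab) fun x hx => by
    rw [hu.eq_zero x hx, hv.eq_zero x hx, sub_zero]

theorem const_mul (hab : a < b) (hu : MemH10 a b u) (c : ℝ) : MemH10 a b (fun x => c * u x) :=
  .of_isPrim hab ((hu.isPrim hab).const_mul c) fun x hx => by rw [hu.eq_zero x hx, mul_zero]

theorem abs_le (hab : a < b) (hu : MemH10 a b u) (x : ℝ) :
    |u x| ≤ Real.sqrt (b - a) * norm2 a b (D a b u) := by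
  by_cases hx : x ∈ Icc a b
  · exact (hu.isPrim hab).abs_le hab hu.left_eq_zero hx
  · rw [hu.eq_zero x fun h => hx (Ioo_subset_Icc_self h), abs_zero]
    exact mul_nonneg (Real.sqrt_nonneg _) (norm2_nonneg _)

theorem eq_zero_of_norm2_D (hab : a < b) (hu : MemH10 a b u) (h : norm2 a b (D a b u) = 0) :
    u = 0 := by
  funext x
  have := hu.abs_le hab x
  rw [h, mul_zero] at this
  exact abs_nonpos_iff.1 this

end MemH10

/-- **Friedrichs' inequality** with the sharp constant `c₂ = (b - a) / π`. -/
theorem norm2_le_c2_mul (hab : a < b) {u g : ℝ → ℝ} (hu : IsPrim a b u g) (ha : u a = 0)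
    (hb : u b = 0) : norm2 a b u ≤ c2 a b * norm2 a b g := by
  have hba : 0 < b - a := sub_pos.2 hab
  -- For `k < π / (b - a)` expand `0 ≤ ∫ (u' + θ u)²`, where `θ = k tan (k (x - m))` solves
  -- `θ' = k² + θ²` on the whole of `[a, b]`, `m` being the midpoint.
  have key : ∀ k : ℝ, 0 < k → k < Real.pi / (b - a) → k * norm2 a b u ≤ norm2 a b g := by
    intro k hk hk'
    let m := (a + b) / 2
    let θ : ℝ → ℝ := fun x => k * Real.tan (k * (x - m))
    have hcos : ∀ x ∈ Icc a b, 0 < Real.cos (k * (x - m)) := by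
      intro x hx
      have h1 : k * (b - a) < Real.pi := (lt_div_iff₀ hba).1 hk'
      have h2 : -((b - a) / 2) ≤ x - m := by simp only [m]; linarith [hx.1]
      have h3 : x - m ≤ (b - a) / 2 := by simp only [m]; linarith [hx.2]
      exact Real.cos_pos_of_mem_Ioo ⟨by nlinarith, by nlinarith⟩
    have hθ : ∀ x ∈ Icc a b, HasDerivAt θ (k ^ 2 + θ x ^ 2) x := by
      intro x hx
      have h0 : HasDerivAt (fun x => k * (x - m)) k x := by
        simpa using ((hasDerivAt_id x).sub_const m).const_mul k
      have h1 := ((Real.hasDerivAt_tan (hcos x hx).ne').comp x h0).const_mul k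
      refine h1.congr_deriv ?_
      simp only [θ]
      have hne := (hcos x hx).ne'
      rw [Real.tan_eq_sin_div_cos]
      field_simp
      rw [← Real.cos_sq_add_sin_sq (k * (x - m))]
    have hθc : ContinuousOn θ (Icc a b) := fun x hx =>
      (hθ x hx).continuousAt.continuousWithinAt
    have hθp : IsPrim a b θ (fun x => k ^ 2 + θ x ^ 2) :=
      .of_hasDerivAt hθ (continuousOn_const.add (hθc.pow 2))
    have hP := (hθp.mul hab (hu.mul hab hu)).integral_eq hab
    simp only [ha, hb, mul_zero, sub_zero] at hP
    have huL := hu.memL2_left hab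
    have hmθ : MemL2 a b (fun x => θ x * u x) := huL.continuousOn_mul hθc
    have h0 : 0 ≤ ∫ x in a..b, (g x + θ x * u x) ^ 2 :=
      intervalIntegral.integral_nonneg hab.le fun _ _ => sq_nonneg _
    have hsum : ∫ x in a..b, (g x + θ x * u x) ^ 2 = (∫ x in a..b, g x ^ 2)
        + (∫ x in a..b, ((k ^ 2 + θ x ^ 2) * (u x * u x) + θ x * (g x * u x + u x * g x)))
        - k ^ 2 * ∫ x in a..b, u x ^ 2 := by
      rw [← intervalIntegral.integral_const_mul, ← intervalIntegral.integral_add,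
        ← intervalIntegral.integral_sub]
      · congr 1; ext x; ring
      · rw [intervalIntegrable_iff_restrict hab]
        exact hu.memL2.integrable_sq.add (hθp.mul hab (hu.mul hab hu)).memL2.integrable
      · rw [intervalIntegrable_iff_restrict hab]
        exact huL.integrable_sq.const_mul _
      · rw [intervalIntegrable_iff_restrict hab]
        exact hu.memL2.integrable_sq
      · exact (hθp.mul hab (hu.mul hab hu)).memL2.intervalIntegrable hab
    rw [hsum, hP, ← norm2_sq hab, ← norm2_sq hab] at h0
    refine abs_le_of_sq_le_sq' (by rw [mul_pow]; linarith) (norm2_nonneg _) |>.2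
  have hlim : Real.pi / (b - a) * norm2 a b u ≤ norm2 a b g := by
    by_contra! hlt
    have hu0 : 0 < norm2 a b u := by
      refine lt_of_le_of_ne (norm2_nonneg _) fun h0 => ?_
      rw [← h0, mul_zero] at hlt
      exact hlt.not_ge (norm2_nonneg _)
    have hq : norm2 a b g / norm2 a b u < Real.pi / (b - a) := (div_lt_iff₀ hu0).2 hlt
    obtain ⟨k, hk1, hk2⟩ := exists_between hq
    have hk0 : 0 < k := (div_nonneg (norm2_nonneg _) hu0.le).trans_lt hk1
    exact ((div_lt_iff₀ hu0).1 hk1).not_ge (key k hk0 hk2)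
  rw [c2, div_mul_eq_mul_div, le_div_iff₀ Real.pi_pos]
  rw [div_mul_eq_mul_div, div_le_iff₀ hba] at hlim
  linarith

/-! ### The jump operator -/

/-- The averaging part `x ↦ ∫ u (x + y) φ(y) dy` of the jump operator. -/
noncomputable def jumpMean (φ u : ℝ → ℝ) (x : ℝ) : ℝ := ∫ y, u (x + y) * φ y

/-- Bounded measurable functions on the line that vanish outside `(a, b)`. -/
structure BddSupp (a b : ℝ) (u : ℝ → ℝ) : Prop where
  measurable : Measurable u
  bdd : ∃ B, 0 ≤ B ∧ ∀ x, |u x| ≤ B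
  eq_zero : ∀ x, x ∉ Ioo a b → u x = 0

namespace IsSymmDensity

variable {φ : ℝ → ℝ}

theorem integrable (hφ : IsSymmDensity φ) : Integrable φ :=
  .of_integral_ne_zero (by rw [hφ.integral_eq_one]; norm_num)

end IsSymmDensity

namespace BddSupp

variable {φ u v : ℝ → ℝ}

theorem memL2 (hu : BddSupp a b u) : MemL2 a b u := by
  obtain ⟨B, -, hB⟩ := hu.bdd
  exact .of_bound hu.measurable.aestronglyMeasurable fun x _ => hB x

theorem integrable (hu : BddSupp a b u) : Integrable u := by
  have := hu.memL2.integrable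
  exact IntegrableOn.integrable_of_forall_notMem_eq_zero this hu.eq_zero

theorem sq_integrable (hu : BddSupp a b u) : Integrable (fun x => u x ^ 2) := by
  have := hu.memL2.integrable_sq
  exact IntegrableOn.integrable_of_forall_notMem_eq_zero (s := Ioo a b) this
    fun x hx => by rw [hu.eq_zero x hx]; norm_num

theorem integrable_shift_mul (hφ : IsSymmDensity φ) (hu : BddSupp a b u) (x : ℝ) :
    Integrable (fun y => u (x + y) * φ y) := by
  obtain ⟨B, -, hB⟩ := hu.bdd
  exact hφ.integrable.bdd_mul (c := B)
    (hu.measurable.comp (measurable_const_add x)).aestronglyMeasurable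
    (Filter.Eventually.of_forall fun y => hB _)

theorem jumpOp_eq (hφ : IsSymmDensity φ) (hu : BddSupp a b u) (lam x : ℝ) :
    jumpOp lam φ u x = lam * jumpMean φ u x - lam * u x := by
  unfold jumpOp jumpMean
  simp only [sub_mul]
  rw [integral_sub (hu.integrable_shift_mul hφ x) (hφ.integrable.const_mul _),
    integral_const_mul, hφ.integral_eq_one]
  ring

theorem abs_jumpMean_le (hφ : IsSymmDensity φ) (hu : BddSupp a b u) {B : ℝ}
    (hB : ∀ x, |u x| ≤ B) (x : ℝ) : |jumpMean φ u x| ≤ B := by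
  unfold jumpMean
  calc |∫ y, u (x + y) * φ y| ≤ ∫ y, |u (x + y) * φ y| := abs_integral_le_integral_abs
    _ ≤ ∫ y, B * φ y := by
        refine integral_mono (hu.integrable_shift_mul hφ x).abs (hφ.integrable.const_mul _) ?_
        intro y
        simp only [abs_mul, abs_of_nonneg (hφ.nonneg y)]
        exact mul_le_mul_of_nonneg_right (hB _) (hφ.nonneg y)
    _ = B := by rw [integral_const_mul, hφ.integral_eq_one, mul_one]

theorem measurable_jumpMean (hφ : IsSymmDensity φ) (hu : BddSupp a b u) :
    Measurable (jumpMean φ u) := by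
  have h : StronglyMeasurable (Function.uncurry fun x y => u (x + y) * φ y) :=
    ((hu.measurable.comp measurable_add).mul
      (hφ.measurable.comp measurable_snd)).stronglyMeasurable
  exact h.integral_prod_right.measurable

theorem memL2_jumpMean (hφ : IsSymmDensity φ) (hu : BddSupp a b u) :
    MemL2 a b (jumpMean φ u) := by
  obtain ⟨B, -, hB⟩ := hu.bdd
  exact .of_bound (hu.measurable_jumpMean hφ).aestronglyMeasurable
    fun x _ => hu.abs_jumpMean_le hφ hB x

theorem continuous_jumpMean (hφ : IsSymmDensity φ) (hu : BddSupp a b u) (hc : Continuous u) :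
    Continuous (jumpMean φ u) := by
  obtain ⟨B, -, hB⟩ := hu.bdd
  refine continuous_of_dominated (bound := fun y => B * φ y)
    (fun x => (hu.integrable_shift_mul hφ x).aestronglyMeasurable)
    (fun x => Filter.Eventually.of_forall fun y => ?_) (hφ.integrable.const_mul _)
    (Filter.Eventually.of_forall fun y => by fun_prop)
  rw [norm_mul, Real.norm_of_nonneg (hφ.nonneg y)]
  exact mul_le_mul_of_nonneg_right (hB _) (hφ.nonneg y)

/-- Fubini's theorem for the form `(jumpMean φ u, v)`. -/
theorem inner2_jumpMean (hab : a < b) (hφ : IsSymmDensity φ) (hu : BddSupp a b u)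
    (hv : BddSupp a b v) :
    inner2 a b (jumpMean φ u) v = ∫ y, φ y * ∫ x, u (x + y) * v x := by
  obtain ⟨B, hB0, hB⟩ := hu.bdd
  rw [inner2, integral_eq_of_eq_zero hab fun x hx => by rw [hv.eq_zero x hx, mul_zero]]
  have hint : Integrable (Function.uncurry fun x y => v x * (u (x + y) * φ y))
      (volume.prod volume) := by
    have h0 : Integrable (fun z : ℝ × ℝ => v z.1 * φ z.2) (volume.prod volume) :=
      hv.integrable.mul_prod hφ.integrable
    have h1 := h0.bdd_mul (c := B) (f := fun z : ℝ × ℝ => u (z.1 + z.2))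
      (hu.measurable.comp measurable_add).aestronglyMeasurable
      (Filter.Eventually.of_forall fun z => hB _)
    refine h1.congr (Filter.Eventually.of_forall fun z => ?_)
    simp only [Function.uncurry]; ring
  calc ∫ x, jumpMean φ u x * v x = ∫ x, ∫ y, v x * (u (x + y) * φ y) := by
        congr 1; ext x
        rw [integral_const_mul, mul_comm]; rfl
    _ = ∫ y, ∫ x, v x * (u (x + y) * φ y) := integral_integral_swap hint
    _ = _ := by
        congr 1; ext y
        rw [← integral_const_mul]
        congr 1; ext x; ring

theorem integrable_shift (hu : BddSupp a b u) (hv : BddSupp a b v) (y : ℝ) :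
    Integrable (fun x => u (x + y) * v x) := by
  obtain ⟨B, -, hB⟩ := hu.bdd
  exact hv.integrable.bdd_mul (c := B)
    (hu.measurable.comp (measurable_add_const y)).aestronglyMeasurable
    (Filter.Eventually.of_forall fun y => hB _)

/-- Since `φ` is symmetric, so is averaging over the shifts. -/
theorem inner2_jumpMean_comm (hab : a < b) (hφ : IsSymmDensity φ) (hu : BddSupp a b u)
    (hv : BddSupp a b v) :
    inner2 a b (jumpMean φ u) v = inner2 a b u (jumpMean φ v) := by
  rw [inner2_comm u, inner2_jumpMean hab hφ hu hv, inner2_jumpMean hab hφ hv hu,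
    ← integral_neg_eq_self]
  congr 1; ext y
  rw [hφ.symm]
  congr 1
  rw [← integral_add_right_eq_self _ y]
  congr 1; ext x
  rw [add_neg_cancel_right, mul_comm]

/-- The mean over the shifts is a contraction, in the weak form coming from Young's inequality. -/
theorem two_mul_inner2_jumpMean_le (hab : a < b) (hφ : IsSymmDensity φ) (hu : BddSupp a b u)
    (hv : BddSupp a b v) :
    2 * inner2 a b (jumpMean φ u) v ≤ norm2 a b u ^ 2 + norm2 a b v ^ 2 := by
  have hsq : ∀ {w : ℝ → ℝ}, BddSupp a b w → norm2 a b w ^ 2 = ∫ x, w x ^ 2 := fun {w} hw => by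
    rw [norm2_sq hab, integral_eq_of_eq_zero hab fun x hx => by rw [hw.eq_zero x hx]; norm_num]
  have hy : ∀ y, 2 * ∫ x, u (x + y) * v x ≤ norm2 a b u ^ 2 + norm2 a b v ^ 2 := by
    intro y
    rw [hsq hu, hsq hv, ← integral_add_right_eq_self (fun x => u x ^ 2) y, ← integral_const_mul,
      ← integral_add (hu.sq_integrable.comp_add_right y) hv.sq_integrable]
    refine integral_mono ((hu.integrable_shift hv y).const_mul 2)
      ((hu.sq_integrable.comp_add_right y).add hv.sq_integrable) fun x => ?_
    simp only
    nlinarith [sq_nonneg (u (x + y) - v x)]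
  rw [inner2_jumpMean hab hφ hu hv, ← integral_const_mul]
  set S := norm2 a b u ^ 2 + norm2 a b v ^ 2 with hS
  have hS0 : 0 ≤ S := by positivity
  by_cases hi : Integrable fun y => 2 * (φ y * ∫ x, u (x + y) * v x)
  · calc _ ≤ ∫ y, S * φ y := by
          refine integral_mono hi (hφ.integrable.const_mul _) fun y => ?_
          simp only
          nlinarith [mul_le_mul_of_nonneg_left (hy y) (hφ.nonneg y)]
      _ = S := by rw [integral_const_mul, hφ.integral_eq_one, mul_one]
  -- otherwise the integral has the junk value `0`
  · rw [integral_undef hi]; exact hS0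

theorem inner2_jumpMean_self_le (hab : a < b) (hφ : IsSymmDensity φ) (hu : BddSupp a b u) :
    inner2 a b (jumpMean φ u) u ≤ norm2 a b u ^ 2 := by
  linarith [hu.two_mul_inner2_jumpMean_le hab hφ hu]

/-- The mean over the shifts does not increase the `L₂` norm. -/
theorem norm2_jumpMean_le (hab : a < b) (hφ : IsSymmDensity φ) (hu : BddSupp a b u) :
    norm2 a b (jumpMean φ u) ≤ norm2 a b u := by
  obtain ⟨B, hB0, hB⟩ := hu.bdd
  let v := (Ioo a b).indicator (jumpMean φ u)
  have hv : BddSupp a b v := by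
    refine ⟨(hu.measurable_jumpMean hφ).indicator measurableSet_Ioo, ⟨B, hB0, fun x => ?_⟩,
      fun x hx => indicator_of_notMem hx _⟩
    by_cases hx : x ∈ Ioo a b
    · simp only [v, indicator_of_mem hx]; exact hu.abs_jumpMean_le hφ hB x
    · simp only [v, indicator_of_notMem hx, abs_zero]; exact hB0
  have hev : v =ᵐ[volume.restrict (Ioo a b)] jumpMean φ u :=
    indicator_ae_eq_restrict measurableSet_Ioo
  have h := hu.two_mul_inner2_jumpMean_le hab hφ hv
  rw [inner2_congr hab (Filter.EventuallyEq.refl _ _) hev, inner2_self hab,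
    norm2_congr hab hev] at h
  exact abs_le_of_sq_le_sq' (by linarith) (norm2_nonneg _) |>.2

end BddSupp

theorem MemH10.bddSupp (hab : a < b) {u : ℝ → ℝ} (hu : MemH10 a b u) : BddSupp a b u :=
  ⟨hu.continuous.measurable, ⟨_, mul_nonneg (Real.sqrt_nonneg _) (norm2_nonneg _),
    hu.abs_le hab⟩, hu.eq_zero⟩

theorem BddSupp.norm2_jumpOp_le (hab : a < b) {φ u : ℝ → ℝ} (hφ : IsSymmDensity φ)
    (hu : BddSupp a b u) {lam : ℝ} (hlam : 0 < lam) :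
    norm2 a b (jumpOp lam φ u) ≤ 2 * lam * norm2 a b u := by
  have e : jumpOp lam φ u = fun x => lam * jumpMean φ u x - lam * u x :=
    funext (hu.jumpOp_eq hφ lam)
  rw [e]
  refine (norm2_sub_le hab ((hu.memL2_jumpMean hφ).const_mul _) (hu.memL2.const_mul _)).trans ?_
  rw [norm2_smul, norm2_smul, abs_of_pos hlam]
  nlinarith [hu.norm2_jumpMean_le hab hφ]

theorem BddSupp.memL2_jumpOp {φ u : ℝ → ℝ} (hφ : IsSymmDensity φ) (hu : BddSupp a b u)
    (lam : ℝ) : MemL2 a b (jumpOp lam φ u) := by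
  have e : jumpOp lam φ u = fun x => lam * jumpMean φ u x - lam * u x :=
    funext (hu.jumpOp_eq hφ lam)
  rw [e]
  exact ((hu.memL2_jumpMean hφ).const_mul _).sub (hu.memL2.const_mul _)

theorem BddSupp.inner2_jumpOp_comm (hab : a < b) {φ u v : ℝ → ℝ} (hφ : IsSymmDensity φ)
    (hu : BddSupp a b u) (hv : BddSupp a b v) (lam : ℝ) :
    inner2 a b (jumpOp lam φ u) v = inner2 a b u (jumpOp lam φ v) := by
  rw [funext (hu.jumpOp_eq hφ lam), funext (hv.jumpOp_eq hφ lam),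
    inner2_sub_left hab ((hu.memL2_jumpMean hφ).const_mul _) (hu.memL2.const_mul _) hv.memL2,
    inner2_sub_right hab ((hv.memL2_jumpMean hφ).const_mul _) (hv.memL2.const_mul _) hu.memL2,
    inner2_smul_left, inner2_smul_left, inner2_smul_right, inner2_smul_right,
    hu.inner2_jumpMean_comm hab hφ hv]

theorem BddSupp.inner2_jumpOp_self_nonpos (hab : a < b) {φ u : ℝ → ℝ} (hφ : IsSymmDensity φ)
    (hu : BddSupp a b u) {lam : ℝ} (hlam : 0 < lam) : inner2 a b (jumpOp lam φ u) u ≤ 0 := by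
  rw [funext (hu.jumpOp_eq hφ lam),
    inner2_sub_left hab ((hu.memL2_jumpMean hφ).const_mul _) (hu.memL2.const_mul _) hu.memL2,
    inner2_smul_left, inner2_smul_left, inner2_self hab]
  nlinarith [hu.inner2_jumpMean_self_le hab hφ]

theorem BddSupp.jumpOp_add {φ u v : ℝ → ℝ} (hφ : IsSymmDensity φ)
    (hu : BddSupp a b u) (hv : BddSupp a b v) (lam x : ℝ) :
    jumpOp lam φ (fun x => u x + v x) x = jumpOp lam φ u x + jumpOp lam φ v x := by
  unfold jumpOp
  rw [← mul_add, ← integral_add]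
  · refine congrArg (lam * ·) (integral_congr_ae (.of_forall fun y => ?_))
    simp only; ring
  all_goals
    simp only [sub_mul]
    refine (BddSupp.integrable_shift_mul hφ (by assumption) x).sub (hφ.integrable.const_mul _)

theorem jumpOp_smul (φ u : ℝ → ℝ) (lam c x : ℝ) :
    jumpOp lam φ (fun x => c * u x) x = c * jumpOp lam φ u x := by
  unfold jumpOp
  rw [mul_left_comm, ← integral_const_mul c]
  refine congrArg (lam * ·) (integral_congr_ae (.of_forall fun y => ?_))
  simp only; ring

theorem abs_le_cM {x : ℝ} (hx : x ∈ Icc a b) : |x| ≤ cM a b :=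
  abs_le_max_abs_abs hx.1 hx.2

/-! ### The bilinear form -/

section Bilin

variable {σ μ lam : ℝ} {φ u v w g h : ℝ → ℝ}

/-- The form with its lower order terms collected in one `L₂` scalar product; any representatives
of the two derivatives may be used. -/
theorem bilin_eq (hab : a < b) (hφ : IsSymmDensity φ) (hu : MemH10 a b u) (hv : MemH10 a b v)
    (hg : D a b u =ᵐ[volume.restrict (Ioo a b)] g)
    (hh : D a b v =ᵐ[volume.restrict (Ioo a b)] h) :
    bilin a b σ μ lam φ u v = 1 / 2 * σ ^ 2 * inner2 a b g h
      + inner2 a b (fun x => μ * (x * g x) - jumpOp lam φ u x) v := by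
  have hgL : MemL2 a b g := hu.memL2_D.congr hg
  have hhL : MemL2 a b h := hv.memL2_D.congr hh
  have hx : MemL2 a b (fun x => μ * (x * g x)) :=
    (hgL.continuousOn_mul (f := fun x => x) continuousOn_id).const_mul μ
  have hJ := (hu.bddSupp hab).memL2_jumpOp hφ lam
  rw [inner2_sub_left hab hx hJ hv.memL2]
  unfold bilin
  have e : ∫ x in a..b, (1 / 2 * σ ^ 2 * D a b u x * D a b v x + μ * x * D a b u x * v x)
      = ∫ x in a..b, (1 / 2 * σ ^ 2 * (g x * h x) + (μ * (x * g x)) * v x) := by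
    refine integral_congr_restrict hab ?_
    filter_upwards [hg, hh] with x h1 h2
    rw [h1, h2]; ring
  rw [e, intervalIntegral.integral_add, intervalIntegral.integral_const_mul]
  · simp only [inner2]; ring
  · rw [intervalIntegrable_iff_restrict hab]; exact (hgL.integrable_mul hhL).const_mul _
  · rw [intervalIntegrable_iff_restrict hab]; exact hx.integrable_mul hv.memL2

theorem bilin_eq_D (hab : a < b) (hφ : IsSymmDensity φ) (hu : MemH10 a b u)
    (hv : MemH10 a b v) :
    bilin a b σ μ lam φ u v = 1 / 2 * σ ^ 2 * inner2 a b (D a b u) (D a b v)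
      + inner2 a b (fun x => μ * (x * D a b u x) - jumpOp lam φ u x) v :=
  bilin_eq hab hφ hu hv (Filter.EventuallyEq.refl _ _) (Filter.EventuallyEq.refl _ _)

theorem MemH10.memL2_lowerOrder (hab : a < b) (hφ : IsSymmDensity φ) (hu : MemH10 a b u)
    (μ lam : ℝ) : MemL2 a b (fun x => μ * (x * D a b u x) - jumpOp lam φ u x) :=
  ((hu.memL2_D.continuousOn_mul (f := fun x => x) continuousOn_id).const_mul μ).sub
    ((hu.bddSupp hab).memL2_jumpOp hφ lam)

theorem bilin_add_left (hab : a < b) (hφ : IsSymmDensity φ) (hu : MemH10 a b u)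
    (hv : MemH10 a b v) (hw : MemH10 a b w) :
    bilin a b σ μ lam φ (fun x => u x + v x) w
      = bilin a b σ μ lam φ u w + bilin a b σ μ lam φ v w := by
  rw [bilin_eq hab hφ (hu.add hab hv) hw (((hu.isPrim hab).add (hv.isPrim hab) hab).D_ae_eq hab)
    (Filter.EventuallyEq.refl _ _), bilin_eq_D hab hφ hu hw, bilin_eq_D hab hφ hv hw,
    inner2_add_left hab hu.memL2_D hv.memL2_D hw.memL2_D]
  have e : (fun x => μ * (x * (D a b u x + D a b v x)) - jumpOp lam φ (fun x => u x + v x) x)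
      = fun x => (μ * (x * D a b u x) - jumpOp lam φ u x)
        + (μ * (x * D a b v x) - jumpOp lam φ v x) := by
    ext x
    rw [(hu.bddSupp hab).jumpOp_add hφ (hv.bddSupp hab)]; ring
  rw [e, inner2_add_left hab (hu.memL2_lowerOrder hab hφ μ lam)
    (hv.memL2_lowerOrder hab hφ μ lam) hw.memL2]
  ring

theorem bilin_smul_left (hab : a < b) (hφ : IsSymmDensity φ) (hu : MemH10 a b u)
    (hw : MemH10 a b w) (c : ℝ) :
    bilin a b σ μ lam φ (fun x => c * u x) w = c * bilin a b σ μ lam φ u w := by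
  rw [bilin_eq hab hφ (hu.const_mul hab c) hw (((hu.isPrim hab).const_mul c).D_ae_eq hab)
    (Filter.EventuallyEq.refl _ _), bilin_eq_D hab hφ hu hw, inner2_smul_left]
  have e : (fun x => μ * (x * (c * D a b u x)) - jumpOp lam φ (fun x => c * u x) x)
      = fun x => c * (μ * (x * D a b u x) - jumpOp lam φ u x) := by
    ext x
    rw [jumpOp_smul]; ring
  rw [e, inner2_smul_left]
  ring

theorem bilin_sub_left (hab : a < b) (hφ : IsSymmDensity φ) (hu : MemH10 a b u)
    (hv : MemH10 a b v) (hw : MemH10 a b w) :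
    bilin a b σ μ lam φ (fun x => u x - v x) w
      = bilin a b σ μ lam φ u w - bilin a b σ μ lam φ v w := by
  have := bilin_add_left (σ := σ) (μ := μ) (lam := lam) hab hφ hu (hv.const_mul hab (-1)) hw
  rw [bilin_smul_left hab hφ hv hw] at this
  simpa [sub_eq_add_neg] using this

theorem bilin_add_right (hab : a < b) (hφ : IsSymmDensity φ) (hu : MemH10 a b u)
    (hv : MemH10 a b v) (hw : MemH10 a b w) :
    bilin a b σ μ lam φ w (fun x => u x + v x)
      = bilin a b σ μ lam φ w u + bilin a b σ μ lam φ w v := by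
  rw [bilin_eq hab hφ hw (hu.add hab hv) (Filter.EventuallyEq.refl _ _)
    (((hu.isPrim hab).add (hv.isPrim hab) hab).D_ae_eq hab), bilin_eq_D hab hφ hw hu,
    bilin_eq_D hab hφ hw hv, inner2_add_right hab hu.memL2_D hv.memL2_D hw.memL2_D,
    inner2_add_right hab hu.memL2 hv.memL2 (hw.memL2_lowerOrder hab hφ μ lam)]
  ring

theorem bilin_smul_right (hab : a < b) (hφ : IsSymmDensity φ) (hu : MemH10 a b u)
    (hw : MemH10 a b w) (c : ℝ) :
    bilin a b σ μ lam φ w (fun x => c * u x) = c * bilin a b σ μ lam φ w u := by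
  rw [bilin_eq hab hφ hw (hu.const_mul hab c) (Filter.EventuallyEq.refl _ _)
    (((hu.isPrim hab).const_mul c).D_ae_eq hab), bilin_eq_D hab hφ hw hu, inner2_smul_right,
    inner2_smul_right]
  ring

theorem bilin_sub_right (hab : a < b) (hφ : IsSymmDensity φ) (hu : MemH10 a b u)
    (hv : MemH10 a b v) (hw : MemH10 a b w) :
    bilin a b σ μ lam φ w (fun x => u x - v x)
      = bilin a b σ μ lam φ w u - bilin a b σ μ lam φ w v := by
  have := bilin_add_right (σ := σ) (μ := μ) (lam := lam) hab hφ hu (hv.const_mul hab (-1)) hw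
  rw [bilin_smul_right hab hφ hv hw] at this
  simpa [sub_eq_add_neg] using this

theorem MemH10.norm2_le (hab : a < b) (hu : MemH10 a b u) :
    norm2 a b u ≤ c2 a b * norm2 a b (D a b u) :=
  norm2_le_c2_mul hab (hu.isPrim hab) hu.left_eq_zero hu.right_eq_zero

theorem c2_pos (hab : a < b) : 0 < c2 a b := div_pos (sub_pos.2 hab) Real.pi_pos

theorem cM_nonneg : 0 ≤ cM a b := (abs_nonneg a).trans (le_max_left _ _)

theorem c1_pos (hab : a < b) (hσ : 0 < σ) (hμ : 0 < μ) (hlam : 0 < lam) :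
    0 < c1 a b σ μ lam := by
  have := c2_pos hab
  have := cM_nonneg (a := a) (b := b)
  unfold c1
  positivity

theorem norm2_x_mul_le (hab : a < b) (hg : MemL2 a b g) :
    norm2 a b (fun x => x * g x) ≤ cM a b * norm2 a b g := by
  refine norm2_le_of_abs_le hab cM_nonneg
    (hg.continuousOn_mul (f := fun x => x) continuousOn_id) hg fun x hx => ?_
  rw [abs_mul]
  exact mul_le_mul_of_nonneg_right (abs_le_cM (Ioo_subset_Icc_self hx)) (abs_nonneg _)

theorem MemH10.norm2_lowerOrder_le (hab : a < b) (hμ : 0 < μ) (hlam : 0 < lam)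
    (hφ : IsSymmDensity φ) (hu : MemH10 a b u) :
    norm2 a b (fun x => μ * (x * D a b u x) - jumpOp lam φ u x)
      ≤ μ * (cM a b * norm2 a b (D a b u)) + 2 * lam * norm2 a b u := by
  have hx := hu.memL2_D.continuousOn_mul (f := fun x => x) continuousOn_id
  refine (norm2_sub_le hab (hx.const_mul μ)
    ((hu.bddSupp hab).memL2_jumpOp hφ lam)).trans ?_
  rw [norm2_smul, abs_of_pos hμ]
  exact add_le_add (mul_le_mul_of_nonneg_left (norm2_x_mul_le hab hu.memL2_D) hμ.le)
    ((hu.bddSupp hab).norm2_jumpOp_le hab hφ hlam)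

/-- Continuity of the form, with the constant `c₁`. -/
theorem abs_bilin_le (hab : a < b) (hμ : 0 < μ) (hlam : 0 < lam)
    (hφ : IsSymmDensity φ) (hu : MemH10 a b u) (hv : MemH10 a b v) :
    |bilin a b σ μ lam φ u v|
      ≤ c1 a b σ μ lam * norm2 a b (D a b u) * norm2 a b (D a b v) := by
  rw [bilin_eq_D hab hφ hu hv]
  have h1 := abs_inner2_le hab hu.memL2_D hv.memL2_D
  have h2 := abs_inner2_le hab (hu.memL2_lowerOrder hab hφ μ lam) hv.memL2
  have h3 := hu.norm2_lowerOrder_le hab hμ hlam hφ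
  have hu2 := hu.norm2_le hab
  have hv2 := hv.norm2_le hab
  have hc := (c2_pos hab).le
  have hM := cM_nonneg (a := a) (b := b)
  have n1 := norm2_nonneg (a := a) (b := b) (D a b u)
  have n2 := norm2_nonneg (a := a) (b := b) (D a b v)
  have n3 := norm2_nonneg (a := a) (b := b) v
  have h4 : norm2 a b (fun x => μ * (x * D a b u x) - jumpOp lam φ u x)
      ≤ (μ * cM a b + 2 * lam * c2 a b) * norm2 a b (D a b u) := by
    nlinarith [mul_le_mul_of_nonneg_left hu2 hlam.le]
  have h5 := mul_le_mul h4 hv2 n3 (by positivity)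
  calc _ ≤ |1 / 2 * σ ^ 2 * inner2 a b (D a b u) (D a b v)| + |inner2 a b
        (fun x => μ * (x * D a b u x) - jumpOp lam φ u x) v| := abs_add_le _ _
    _ ≤ 1 / 2 * σ ^ 2 * (norm2 a b (D a b u) * norm2 a b (D a b v))
        + (μ * cM a b + 2 * lam * c2 a b) * norm2 a b (D a b u)
          * (c2 a b * norm2 a b (D a b v)) := by
        refine add_le_add ?_ (h2.trans h5)
        rw [abs_mul, abs_of_nonneg (by positivity)]
        exact mul_le_mul_of_nonneg_left h1 (by positivity)
    _ = _ := by unfold c1; ring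

/-- The Gårding inequality: `∫ x u' u = -½ ‖u‖²`, and the jump part of the form is nonnegative. -/
theorem garding (hab : a < b) (hlam : 0 < lam) (hφ : IsSymmDensity φ) (hu : MemH10 a b u) :
    1 / 2 * σ ^ 2 * norm2 a b (D a b u) ^ 2 - 1 / 2 * μ * norm2 a b u ^ 2
      ≤ bilin a b σ μ lam φ u u := by
  have hx := hu.memL2_D.continuousOn_mul (f := fun x => x) continuousOn_id
  have hp := hu.isPrim hab
  have h0 := ((IsPrim.id (a := a) (b := b)).mul hab (hp.mul hab hp)).integral_eq hab
  have h1 : ∫ x in a..b, (1 * (u x * u x) + x * (D a b u x * u x + u x * D a b u x))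
      = norm2 a b u ^ 2 + 2 * inner2 a b (fun x => x * D a b u x) u := by
    rw [← inner2_self hab, inner2, inner2, ← intervalIntegral.integral_const_mul,
      ← intervalIntegral.integral_add]
    · congr 1; ext x; ring
    · rw [intervalIntegrable_iff_restrict hab]; exact hu.memL2.integrable_mul hu.memL2
    · rw [intervalIntegrable_iff_restrict hab]; exact (hx.integrable_mul hu.memL2).const_mul 2
  rw [h1, hu.left_eq_zero, hu.right_eq_zero] at h0
  rw [bilin_eq_D hab hφ hu hu, inner2_self hab, inner2_sub_left hab (hx.const_mul μ)
    ((hu.bddSupp hab).memL2_jumpOp hφ lam) hu.memL2, inner2_smul_left]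
  have hJ := (hu.bddSupp hab).inner2_jumpOp_self_nonpos hab hφ hlam
  have : inner2 a b (fun x => x * D a b u x) u = -(1 / 2) * norm2 a b u ^ 2 := by linarith
  rw [this]
  linarith

end Bilin

variable {σ μ lam : ℝ} {φ f g u v w : ℝ → ℝ}

/-! ### Regularity -/

/-- Integration by parts `‖u'‖² = -(u, u'')` gives `‖u'‖² ≤ ‖u‖ ‖u''‖` for `u ∈ H¹₀ ∩ H²`. -/
theorem norm2_D_sq_le (hab : a < b) (hu : MemH10 a b u) (hg : MemL2 a b g)
    (h : HasWeakDeriv a b (D a b u) g) :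
    norm2 a b (D a b u) ^ 2 ≤ norm2 a b u * norm2 a b g := by
  obtain ⟨p, hp, hup⟩ := h.exists_isPrim hab hu.memL2_D hg
  have h0 := (((hu.isPrim hab).congr_right hup).mul hab hp).integral_eq hab
  rw [hu.left_eq_zero, hu.right_eq_zero, intervalIntegral.integral_add] at h0
  · have h1 : inner2 a b p p = -inner2 a b u g := by
      simp only [inner2]; linarith
    rw [norm2_congr hab hup, ← inner2_self hab, h1]
    exact (neg_le_abs _).trans (abs_inner2_le hab hu.memL2 hg)
  · rw [intervalIntegrable_iff_restrict hab]
    exact (hp.memL2_left hab).integrable_mul (hp.memL2_left hab)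
  · rw [intervalIntegrable_iff_restrict hab]; exact hu.memL2.integrable_mul hg

/-- The equation identifies the second weak derivative of a weak solution. -/
theorem IsWeakSolution.hasWeakDeriv_D (hab : a < b) (hσ : 0 < σ) (hφ : IsSymmDensity φ)
    (hf : MemL2 a b f) (hv : IsWeakSolution a b σ μ lam φ f v) :
    HasWeakDeriv a b (D a b v)
      (fun x => 2 / σ ^ 2 * (μ * (x * D a b v x) - jumpOp lam φ v x - f x)) := by
  intro ψ p1 p2 p3
  have hψ : MemH10 a b ψ := .of_test hab p1 p3
  have hD : D a b ψ =ᵐ[volume.restrict (Ioo a b)] deriv ψ := (IsPrim.of_contDiff p1).D_ae_eq hab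
  have h := hv.2 ψ hψ
  rw [bilin_eq hab hφ hv.1 hψ (Filter.EventuallyEq.refl _ _) hD] at h
  have hL := hv.1.memL2_lowerOrder hab hφ μ lam
  have e : ∫ x in a..b, (2 / σ ^ 2 * (μ * (x * D a b v x) - jumpOp lam φ v x - f x)) * ψ x
      = 2 / σ ^ 2 * (inner2 a b (fun x => μ * (x * D a b v x) - jumpOp lam φ v x) ψ
        - inner2 a b f ψ) := by
    rw [← inner2_sub_left hab hL hf hψ.memL2, ← inner2_smul_left]; rfl
  rw [e, ← h]
  change inner2 a b (D a b v) (deriv ψ) = _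
  field_simp
  ring

/-- The equation identifies the second weak derivative of an adjoint solution. -/
theorem IsAdjointSolution.hasWeakDeriv_D (hab : a < b) (hσ : 0 < σ) (hφ : IsSymmDensity φ)
    (hg : MemL2 a b g) (hw : IsAdjointSolution a b σ μ lam φ g w) :
    HasWeakDeriv a b (D a b w)
      (fun x => 2 / σ ^ 2 * (-(μ * (x * D a b w x)) - μ * w x - jumpOp lam φ w x - g x)) := by
  intro ψ p1 p2 p3
  have hψ : MemH10 a b ψ := .of_test hab p1 p3
  have hψp : IsPrim a b ψ (deriv ψ) := .of_contDiff p1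
  have hψL := hψp.memL2_left hab
  have hψ'L := hψp.memL2
  have h := hw.2 ψ hψ
  rw [bilin_eq hab hφ hψ hw.1 (hψp.D_ae_eq hab) (Filter.EventuallyEq.refl _ _)] at h
  have hxψ := hψ'L.continuousOn_mul (f := fun x => x) continuousOn_id
  have hJψ := (hψ.bddSupp hab).memL2_jumpOp hφ lam
  have hJw := (hw.1.bddSupp hab).memL2_jumpOp hφ lam
  have hwL := hw.1.memL2
  have hxw := hw.1.memL2_D.continuousOn_mul (f := fun x => x) continuousOn_id
  rw [inner2_sub_left hab (hxψ.const_mul μ) hJψ hwL, inner2_smul_left,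
    (hψ.bddSupp hab).inner2_jumpOp_comm hab hφ (hw.1.bddSupp hab)] at h
  -- integrate `(x w ψ)'`
  have hP := ((IsPrim.id (a := a) (b := b)).mul hab ((hw.1.isPrim hab).mul hab hψp)).integral_eq hab
  rw [hψ.left_eq_zero, hψ.right_eq_zero] at hP
  have hsplit : ∫ x in a..b, (1 * (w x * ψ x) + x * (D a b w x * ψ x + w x * deriv ψ x))
      = inner2 a b w ψ + inner2 a b (fun x => x * D a b w x) ψ
        + inner2 a b (fun x => x * deriv ψ x) w := by
    simp only [inner2]
    rw [← intervalIntegral.integral_add, ← intervalIntegral.integral_add]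
    · congr 1; ext x; ring
    · rw [intervalIntegrable_iff_restrict hab]
      exact (hwL.integrable_mul hψL).add (hxw.integrable_mul hψL)
    · rw [intervalIntegrable_iff_restrict hab]; exact hxψ.integrable_mul hwL
    · rw [intervalIntegrable_iff_restrict hab]; exact hwL.integrable_mul hψL
    · rw [intervalIntegrable_iff_restrict hab]; exact hxw.integrable_mul hψL
  rw [hsplit] at hP
  have e : ∫ x in a..b,
        (2 / σ ^ 2 * (-(μ * (x * D a b w x)) - μ * w x - jumpOp lam φ w x - g x)) * ψ x
      = 2 / σ ^ 2 * (-(μ * inner2 a b (fun x => x * D a b w x) ψ) - μ * inner2 a b w ψ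
        - inner2 a b (jumpOp lam φ w) ψ - inner2 a b g ψ) := by
    have hn := (hxw.const_mul μ).neg
    rw [← inner2_smul_left, ← inner2_smul_left]
    have hneg : -inner2 a b (fun x => μ * (x * D a b w x)) ψ
        = inner2 a b (fun x => -(μ * (x * D a b w x))) ψ := by
      simp only [inner2, neg_mul, intervalIntegral.integral_neg]
    rw [hneg, ← inner2_sub_left hab hn (hwL.const_mul μ) hψL,
      ← inner2_sub_left hab (hn.sub (hwL.const_mul μ)) hJw hψL,
      ← inner2_sub_left hab ((hn.sub (hwL.const_mul μ)).sub hJw) hg hψL, ← inner2_smul_left]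
    rfl
  rw [e]
  change inner2 a b (D a b w) (deriv ψ) = _
  rw [inner2_comm (D a b w)]
  have h1 : inner2 a b (deriv ψ) (D a b w)
      = 2 / σ ^ 2 * (inner2 a b ψ g + inner2 a b ψ (jumpOp lam φ w)
        - μ * inner2 a b (fun x => x * deriv ψ x) w) := by
    field_simp
    linarith
  rw [h1, inner2_comm ψ g, inner2_comm ψ]
  have h2 : inner2 a b (fun x => x * deriv ψ x) w
      = -(inner2 a b w ψ + inner2 a b (fun x => x * D a b w x) ψ) := by linarith
  rw [h2]
  ring

/-- The common absorption argument: if `‖u''‖ ≤ 2σ⁻² (μ M ‖u'‖ + R)`, then the term with `u'` can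
be absorbed by means of `‖u'‖² ≤ ‖u‖ ‖u''‖`. -/
theorem le_of_absorb {M n0 n1 n2 R : ℝ} (hσ : 0 < σ) (h0 : 0 ≤ n0) (h2 : 0 ≤ n2)
    (h : n2 ≤ 2 / σ ^ 2 * (μ * (M * n1) + R)) (hsq : n1 ^ 2 ≤ n0 * n2) :
    n2 ≤ 4 / σ ^ 2 * (R + μ ^ 2 * M ^ 2 / σ ^ 2 * n0) := by
  have hs : 0 < σ ^ 2 := by positivity
  have h1 : 2 / σ ^ 2 * (μ * (M * n1)) ≤ n2 / 2 + 1 / 2 * (2 / σ ^ 2 * (μ * M)) ^ 2 * n0 := by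
    set t := 2 / σ ^ 2 * (μ * M) with ht
    have e : 2 / σ ^ 2 * (μ * (M * n1)) = t * n1 := by rw [ht]; ring
    rw [e]
    have : (t * n1) ^ 2 ≤ (n2 / 2 + 1 / 2 * t ^ 2 * n0) ^ 2 := by
      calc (t * n1) ^ 2 = t ^ 2 * n1 ^ 2 := by ring
        _ ≤ t ^ 2 * (n0 * n2) := mul_le_mul_of_nonneg_left hsq (sq_nonneg t)
        _ ≤ _ := by nlinarith [sq_nonneg (n2 / 2 - 1 / 2 * t ^ 2 * n0)]
    exact (abs_le_of_sq_le_sq' this (by positivity)).2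
  have e2 : 1 / 2 * (2 / σ ^ 2 * (μ * M)) ^ 2 * n0 = 2 / σ ^ 2 * (μ ^ 2 * M ^ 2 / σ ^ 2 * n0) := by
    field_simp
  rw [e2] at h1
  have e3 : 4 / σ ^ 2 * (R + μ ^ 2 * M ^ 2 / σ ^ 2 * n0)
      = 2 * (2 / σ ^ 2 * R + 2 / σ ^ 2 * (μ ^ 2 * M ^ 2 / σ ^ 2 * n0)) := by ring
  rw [e3]
  linarith [mul_add (2 / σ ^ 2) (μ * (M * n1)) R]

theorem IsWeakSolution.regularity (hab : a < b) (hσ : 0 < σ) (hμ : 0 < μ) (hlam : 0 < lam)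
    (hφ : IsSymmDensity φ) (hf : MemL2 a b f) (hv : IsWeakSolution a b σ μ lam φ f v) :
    MemH2 a b v ∧ norm2 a b (D a b (D a b v))
      ≤ c7 σ * norm2 a b f + c8 a b σ μ lam * norm2 a b v := by
  have hL := hv.1.memL2_lowerOrder hab hφ μ lam
  have hG := (hL.sub hf).const_mul (2 / σ ^ 2)
  have hW := hv.hasWeakDeriv_D hab hσ hφ hf
  refine ⟨⟨hv.1.memH1, hv.1.memL2_D, _, hG, hW⟩, ?_⟩
  rw [norm2_congr hab (D_ae_eq hab hG hW)]
  have h1 : norm2 a b (fun x => 2 / σ ^ 2 * (μ * (x * D a b v x) - jumpOp lam φ v x - f x))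
      ≤ 2 / σ ^ 2 * (μ * (cM a b * norm2 a b (D a b v))
        + (2 * lam * norm2 a b v + norm2 a b f)) := by
    rw [norm2_smul, abs_of_nonneg (by positivity)]
    refine mul_le_mul_of_nonneg_left ?_ (by positivity)
    linarith [norm2_sub_le hab hL hf, hv.1.norm2_lowerOrder_le hab hμ hlam hφ]
  have h2 := le_of_absorb hσ (norm2_nonneg _) (norm2_nonneg _) h1 (norm2_D_sq_le hab hv.1 hG hW)
  refine h2.trans ?_
  unfold c7 c8
  have : 0 ≤ 4 / σ ^ 2 * μ * norm2 a b v := by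
    have := norm2_nonneg (a := a) (b := b) v
    positivity
  linear_combination this

theorem IsAdjointSolution.regularity (hab : a < b) (hσ : 0 < σ) (hμ : 0 < μ) (hlam : 0 < lam)
    (hφ : IsSymmDensity φ) (hg : MemL2 a b g) (hw : IsAdjointSolution a b σ μ lam φ g w) :
    MemH2 a b w ∧ norm2 a b (D a b (D a b w))
      ≤ c7 σ * norm2 a b g + c8 a b σ μ lam * norm2 a b w := by
  have hx := (hw.1.memL2_D.continuousOn_mul (f := fun x => x) continuousOn_id).const_mul μ
  have hwL := hw.1.memL2.const_mul μ
  have hJ := (hw.1.bddSupp hab).memL2_jumpOp hφ lam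
  have hG := (((hx.neg.sub hwL).sub hJ).sub hg).const_mul (2 / σ ^ 2)
  have hW := hw.hasWeakDeriv_D hab hσ hφ hg
  refine ⟨⟨hw.1.memH1, hw.1.memL2_D, _, hG, hW⟩, ?_⟩
  rw [norm2_congr hab (D_ae_eq hab hG hW)]
  have h1 : norm2 a b
        (fun x => 2 / σ ^ 2 * (-(μ * (x * D a b w x)) - μ * w x - jumpOp lam φ w x - g x))
      ≤ 2 / σ ^ 2 * (μ * (cM a b * norm2 a b (D a b w))
        + (μ * norm2 a b w + 2 * lam * norm2 a b w + norm2 a b g)) := by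
    rw [norm2_smul, abs_of_nonneg (by positivity)]
    refine mul_le_mul_of_nonneg_left ?_ (by positivity)
    have t1 := norm2_sub_le hab ((hx.neg.sub hwL).sub hJ) hg
    have t2 := norm2_sub_le hab (hx.neg.sub hwL) hJ
    have t3 := norm2_sub_le hab hx.neg hwL
    rw [norm2_neg, norm2_smul, norm2_smul, abs_of_pos hμ] at t3
    have t4 := mul_le_mul_of_nonneg_left (norm2_x_mul_le hab hw.1.memL2_D) hμ.le
    linarith [(hw.1.bddSupp hab).norm2_jumpOp_le hab hφ hlam]
  have h2 := le_of_absorb hσ (norm2_nonneg _) (norm2_nonneg _) h1 (norm2_D_sq_le hab hw.1 hG hW)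
  refine h2.trans_eq ?_
  unfold c7 c8
  ring

/-! ### The maximum principle -/

theorem IsPrim.hasDerivAt (hu : IsPrim a b u g) (hg : ContinuousOn g (Icc a b))
    {x : ℝ} (hx : x ∈ Ioo a b) : HasDerivAt u (g x) x := by
  have hI : Icc a b ∈ nhds x := Icc_mem_nhds hx.1 hx.2
  have hgx : ContinuousAt g x := hg.continuousAt hI
  have hsub : uIcc a x ⊆ Icc a b := by rw [uIcc_of_le hx.1.le]; exact Icc_subset_Icc_right hx.2.le
  have h : HasDerivAt (fun y => u a + ∫ t in a..y, g t) (g x) x :=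
    (intervalIntegral.integral_hasDerivAt_right (hg.mono hsub).intervalIntegrable
      (hg.stronglyMeasurableAtFilter_nhdsWithin measurableSet_Icc x |>.filter_mono
        (by rw [nhdsWithin_eq_nhds.2 hI])) hgx).const_add _
  refine h.congr_of_eventuallyEq ?_
  filter_upwards [hI] with y hy
  exact hu.eq_add y hy

/-- A local maximum with vanishing first derivative does not have a positive second derivative. -/
theorem not_isLocalMax_of_deriv2_pos {z z' : ℝ → ℝ} {x c : ℝ}
    (h1 : ∀ᶠ y in nhds x, HasDerivAt z (z' y) y) (h2 : HasDerivAt z' c x) (hc : 0 < c) :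
    ¬ IsLocalMax z x := by
  intro hmax
  have e : deriv z =ᶠ[nhds x] z' := h1.mono fun y hy => hy.deriv
  have hd0 : deriv z x = 0 := hmax.deriv_eq_zero
  have hd2 : deriv (deriv z) x = c := by rw [e.deriv_eq, h2.deriv]
  have hmin := isLocalMin_of_deriv_deriv_pos (by rw [hd2]; exact hc) hd0
    h1.self_of_nhds.continuousAt
  have hconst : z =ᶠ[nhds x] fun _ => z x := by
    filter_upwards [hmax, hmin] with y h h'
    exact le_antisymm h h'
  have h3 : deriv z =ᶠ[nhds x] fun _ => 0 := by
    refine hconst.eventuallyEq_nhds.mono fun y hy => ?_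
    rw [hy.deriv_eq, deriv_const]
  rw [h3.deriv_eq, deriv_const] at hd2
  exact hc.ne hd2

theorem BddSupp.jumpMean_le (hφ : IsSymmDensity φ) (hu : BddSupp a b u) {B : ℝ}
    (hB : ∀ x, u x ≤ B) (x : ℝ) : jumpMean φ u x ≤ B := by
  calc jumpMean φ u x ≤ ∫ y, B * φ y := by
        refine integral_mono (hu.integrable_shift_mul hφ x) (hφ.integrable.const_mul _) fun y => ?_
        exact mul_le_mul_of_nonneg_right (hB _) (hφ.nonneg y)
    _ = B := by rw [integral_const_mul, hφ.integral_eq_one, mul_one]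

theorem gam_pos (hσ : 0 < σ) (hlam : 0 < lam) : 0 < gam b σ μ lam := by
  have h : |μ * b / σ ^ 2| < Real.sqrt ((μ * b / σ ^ 2) ^ 2 + 2 * (lam + 1) / σ ^ 2) := by
    rw [← Real.sqrt_sq_eq_abs]
    refine Real.sqrt_lt_sqrt (sq_nonneg _) ?_
    have : 0 < 2 * (lam + 1) / σ ^ 2 := by positivity
    linarith
  unfold gam
  linarith [neg_abs_le (μ * b / σ ^ 2)]

/-- `γ` is the positive root of the characteristic equation `½σ²γ² - μ b γ = λ + 1`. -/
theorem gam_eq (hσ : 0 < σ) (hlam : 0 < lam) :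
    1 / 2 * σ ^ 2 * gam b σ μ lam ^ 2 - μ * b * gam b σ μ lam = lam + 1 := by
  have h : (gam b σ μ lam - μ * b / σ ^ 2) ^ 2
      = (μ * b / σ ^ 2) ^ 2 + 2 * (lam + 1) / σ ^ 2 := by
    unfold gam
    rw [add_sub_cancel_left, Real.sq_sqrt (by positivity)]
  have h2 : gam b σ μ lam ^ 2 - 2 * (μ * b / σ ^ 2) * gam b σ μ lam = 2 * (lam + 1) / σ ^ 2 := by
    linarith
  field_simp at h2
  linarith

/-- A weak solution with continuous data is twice continuously differentiable. -/
theorem IsWeakSolution.exists_deriv (hab : a < b) (hσ : 0 < σ) (hφ : IsSymmDensity φ)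
    (hf : ContinuousOn f (Icc a b)) (hv : IsWeakSolution a b σ μ lam φ f v) :
    ∃ p : ℝ → ℝ, (∀ x ∈ Ioo a b, HasDerivAt v (p x) x) ∧
      ∀ x ∈ Ioo a b,
        HasDerivAt p (2 / σ ^ 2 * (μ * (x * p x) - jumpOp lam φ v x - f x)) x := by
  have hfL : MemL2 a b f := .of_continuousOn hf
  have hG := ((hv.1.memL2_lowerOrder hab hφ μ lam).sub hfL).const_mul (2 / σ ^ 2)
  obtain ⟨p, hp, hvp⟩ := (hv.hasWeakDeriv_D hab hσ hφ hfL).exists_isPrim hab hv.1.memL2_D hG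
  have hpc := hp.continuousOn hab
  have hvb := hv.1.bddSupp hab
  have hJ : Continuous (jumpOp lam φ v) := by
    rw [funext (hvb.jumpOp_eq hφ lam)]
    have := hvb.continuous_jumpMean hφ hv.1.continuous
    have := hv.1.continuous
    fun_prop
  have hp' : IsPrim a b p (fun x => 2 / σ ^ 2 * (μ * (x * p x) - jumpOp lam φ v x - f x)) := by
    refine hp.congr_right ?_
    filter_upwards [hvp] with x hx
    rw [hx]
  refine ⟨p, fun x hx => ((hv.1.isPrim hab).congr_right hvp).hasDerivAt hpc hx,
    fun x hx => hp'.hasDerivAt ?_ hx⟩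
  have := hJ.continuousOn (s := Icc a b)
  fun_prop

/-- The maximum principle, by comparison with the barrier `e^{γ(b-a)} - e^{γ(x-a)}`, on which the
operator is at least `e^{γ(x-a)} + λ > 1`. -/
theorem IsWeakSolution.le_c4 (hab : a < b) (hσ : 0 < σ) (hμ : 0 < μ) (hlam : 0 < lam)
    (hφ : IsSymmDensity φ) (hf : ContinuousOn f (Icc a b)) (hf1 : ∀ x ∈ Icc a b, f x ≤ 1)
    (hv : IsWeakSolution a b σ μ lam φ f v) (x : ℝ) : v x ≤ c4 a b σ μ lam := by
  obtain ⟨p, hp1, hp2⟩ := hv.exists_deriv hab hσ hφ hf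
  set γ := gam b σ μ lam with hγ
  have hγ0 : 0 < γ := gam_pos hσ hlam
  have hγe : 1 / 2 * σ ^ 2 * γ ^ 2 - μ * b * γ = lam + 1 := gam_eq hσ hlam
  let E : ℝ → ℝ := fun x => Real.exp (γ * (x - a))
  have hE : ∀ x, HasDerivAt E (γ * E x) x := by
    intro x
    have h0 : HasDerivAt (fun x => γ * (x - a)) γ x := by
      simpa using ((hasDerivAt_id x).sub_const a).const_mul γ
    exact h0.exp.congr_deriv (by simp only [E]; ring)
  have hE1 : ∀ x ∈ Icc a b, 1 ≤ E x := fun x hx =>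
    Real.one_le_exp (mul_nonneg hγ0.le (sub_nonneg.2 hx.1))
  have hEb : E b = c4 a b σ μ lam := rfl
  have hc4 : 1 ≤ c4 a b σ μ lam := by rw [← hEb]; exact hE1 b (right_mem_Icc.2 hab.le)
  let z : ℝ → ℝ := fun x => v x - (c4 a b σ μ lam - E x)
  have hzc : ContinuousOn z (Icc a b) := by
    have : Continuous E := continuous_iff_continuousAt.2 fun x => (hE x).continuousAt
    have := hv.1.continuous
    exact Continuous.continuousOn (by fun_prop)
  obtain ⟨x0, hx0, hmax⟩ := isCompact_Icc.exists_isMaxOn (nonempty_Icc.2 hab.le) hzc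
  have hz0 : z x0 ≤ 0 := by
    by_contra! hpos
    have hxa : x0 ≠ a := by
      rintro rfl
      simp only [z, hv.1.left_eq_zero] at hpos
      have : E x0 = 1 := by simp [E]
      linarith
    have hxb : x0 ≠ b := by
      rintro rfl
      simp only [z, hv.1.right_eq_zero, hEb] at hpos
      linarith
    have hx0' : x0 ∈ Ioo a b :=
      ⟨lt_of_le_of_ne hx0.1 hxa.symm, lt_of_le_of_ne hx0.2 hxb⟩
    have hloc : IsLocalMax z x0 := hmax.isLocalMax (Icc_mem_nhds hx0'.1 hx0'.2)
    have hd1 : ∀ y ∈ Ioo a b, HasDerivAt z (p y + γ * E y) y := fun y hy =>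
      ((hp1 y hy).sub ((hasDerivAt_const y (c4 a b σ μ lam)).sub (hE y))).congr_deriv (by ring)
    have hd2 := (hp2 x0 hx0').add ((hE x0).const_mul γ)
    refine not_isLocalMax_of_deriv2_pos
      (Filter.eventually_of_mem (isOpen_Ioo.mem_nhds hx0') hd1) hd2 ?_ hloc
    have hp0 : p x0 = -(γ * E x0) := by
      have := hloc.hasDerivAt_eq_zero (hd1 x0 hx0')
      linarith
    have hvle : ∀ y, v y ≤ c4 a b σ μ lam - 1 + z x0 := by
      intro y
      by_cases hy : y ∈ Icc a b
      · have h1 : z y ≤ z x0 := hmax hy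
        have h2 := hE1 y hy
        simp only [z] at h1 ⊢
        linarith
      · rw [hv.1.eq_zero y fun h => hy (Ioo_subset_Icc_self h)]
        linarith
    have hJ : jumpOp lam φ v x0 ≤ lam * (E x0 - 1) := by
      rw [(hv.1.bddSupp hab).jumpOp_eq hφ, ← mul_sub]
      refine mul_le_mul_of_nonneg_left ?_ hlam.le
      have := (hv.1.bddSupp hab).jumpMean_le hφ hvle x0
      simp only [z] at this
      linarith
    have hf0 := hf1 x0 hx0
    have hE0 := hE1 x0 hx0
    have hkey : 0 < 1 / 2 * σ ^ 2 * (2 / σ ^ 2 * (μ * (x0 * p x0) - jumpOp lam φ v x0 - f x0)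
        + γ * (γ * E x0)) := by
      have e : 1 / 2 * σ ^ 2 * (2 / σ ^ 2 * (μ * (x0 * p x0) - jumpOp lam φ v x0 - f x0)
          + γ * (γ * E x0)) = μ * (x0 * p x0) - jumpOp lam φ v x0 - f x0
          + 1 / 2 * σ ^ 2 * γ ^ 2 * E x0 := by
        field_simp
      rw [e, hp0]
      have h3 : μ * x0 * (γ * E x0) ≤ μ * b * (γ * E x0) :=
        mul_le_mul_of_nonneg_right (mul_le_mul_of_nonneg_left hx0.2 hμ.le) (by positivity)
      have h4 : 1 / 2 * σ ^ 2 * γ ^ 2 * E x0 = (lam + 1) * E x0 + μ * b * (γ * E x0) := by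
        rw [← hγe]; ring
      rw [h4]
      linarith
    exact (mul_pos_iff_of_pos_left (by positivity)).1 hkey
  by_cases hx : x ∈ Icc a b
  · have h1 : z x ≤ z x0 := hmax hx
    have h2 := hE1 x hx
    simp only [z] at h1 hz0
    linarith
  · rw [hv.1.eq_zero x fun h => hx (Ioo_subset_Icc_self h)]
    linarith

theorem IsWeakSolution.const_mul (hab : a < b) (hφ : IsSymmDensity φ)
    (hv : IsWeakSolution a b σ μ lam φ f v) (c : ℝ) :
    IsWeakSolution a b σ μ lam φ (fun x => c * f x) (fun x => c * v x) :=
  ⟨hv.1.const_mul hab c, fun ψ hψ => by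
    rw [bilin_smul_left hab hφ hv.1 hψ, inner2_smul_left, hv.2 ψ hψ]⟩

theorem IsWeakSolution.abs_le_c4 (hab : a < b) (hσ : 0 < σ) (hμ : 0 < μ) (hlam : 0 < lam)
    (hφ : IsSymmDensity φ) (hf : ContinuousOn f (Icc a b)) (hf1 : ∀ x ∈ Icc a b, |f x| ≤ 1)
    (hv : IsWeakSolution a b σ μ lam φ f v) (x : ℝ) : |v x| ≤ c4 a b σ μ lam := by
  have h1 := hv.le_c4 hab hσ hμ hlam hφ hf (fun x hx => (abs_le.1 (hf1 x hx)).2) x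
  have h2 := (hv.const_mul hab hφ (-1)).le_c4 hab hσ hμ hlam hφ
    (hf.const_mul (-1)) (fun x hx => by linarith [(abs_le.1 (hf1 x hx)).1]) x
  exact abs_le.2 ⟨by linarith, h1⟩

/-- Only the zero function solves the homogeneous problem: all its multiples are solutions too,
and they are uniformly bounded. -/
theorem IsWeakSolution.eq_zero (hab : a < b) (hσ : 0 < σ) (hμ : 0 < μ) (hlam : 0 < lam)
    (hφ : IsSymmDensity φ) (hv : IsWeakSolution a b σ μ lam φ (fun _ => 0) v) : v = 0 := by
  funext x
  by_contra hx
  have hx' : 0 < |v x| := abs_pos.2 hx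
  obtain ⟨n, hn⟩ := exists_nat_gt (c4 a b σ μ lam / |v x|)
  have h := hv.const_mul hab hφ n
  simp only [mul_zero] at h
  have := h.abs_le_c4 hab hσ hμ hlam hφ continuousOn_const (by simp) x
  rw [abs_mul, abs_of_nonneg (Nat.cast_nonneg n)] at this
  rw [div_lt_iff₀ hx'] at hn
  linarith

theorem IsWeakSolution.unique (hab : a < b) (hσ : 0 < σ) (hμ : 0 < μ) (hlam : 0 < lam)
    (hφ : IsSymmDensity φ) (hu : IsWeakSolution a b σ μ lam φ f u)
    (hv : IsWeakSolution a b σ μ lam φ f v) : u = v := by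
  have h : IsWeakSolution a b σ μ lam φ (fun _ => 0) (fun x => u x - v x) :=
    ⟨hu.1.sub hab hv.1, fun ψ hψ => by
      rw [bilin_sub_left hab hφ hu.1 hv.1 hψ, hu.2 ψ hψ, hv.2 ψ hψ]
      simp [inner2]⟩
  funext x
  exact sub_eq_zero.1 (congrFun (h.eq_zero hab hσ hμ hlam hφ) x)

/-! ### Existence by the Fredholm alternative -/

/-- The Hilbert space `L₂(a,b)`. -/
abbrev L2 (a b : ℝ) : Type := Lp ℝ 2 (volume.restrict (Ioo a b))

theorem L2.memL2 (x : L2 a b) : MemL2 a b x := Lp.memLp x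

/-- The class in `L₂(a,b)` of a square integrable function. -/
noncomputable def MemL2.toL2 (hf : MemL2 a b f) : L2 a b :=
  MemLp.toLp f (show MemLp f 2 (volume.restrict (Ioo a b)) from hf)

theorem MemL2.coe_toL2 (hf : MemL2 a b f) : hf.toL2 =ᵐ[volume.restrict (Ioo a b)] f :=
  MemLp.coeFn_toLp _

theorem L2.inner_eq (hab : a < b) (x y : L2 a b) : inner ℝ x y = inner2 a b x y := by
  rw [L2.inner_def, inner2, integral_eq_restrict hab]
  refine integral_congr_ae (.of_forall fun t => ?_)
  simp [mul_comm]

theorem L2.norm_eq (hab : a < b) (x : L2 a b) : ‖x‖ = norm2 a b x := by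
  have h : ‖x‖ ^ 2 = norm2 a b x ^ 2 := by
    rw [← inner2_self hab, ← L2.inner_eq hab, real_inner_self_eq_norm_sq]
  exact (sq_eq_sq₀ (norm_nonneg _) (norm2_nonneg _)).1 h

/-- The map `Φ` on functions respects almost everywhere equality and is linear and bounded by `C`
on square integrable functions, so that it induces a bounded operator on `L₂(a,b)`. -/
structure IsL2Op (a b : ℝ) (Φ : (ℝ → ℝ) → ℝ → ℝ) (C : ℝ) : Prop where
  memL2 : ∀ g, MemL2 a b g → MemL2 a b (Φ g)
  congr : ∀ g h, MemL2 a b g → MemL2 a b h → g =ᵐ[volume.restrict (Ioo a b)] h →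
    Φ g =ᵐ[volume.restrict (Ioo a b)] Φ h
  add : ∀ g h, MemL2 a b g → MemL2 a b h →
    Φ (fun x => g x + h x) =ᵐ[volume.restrict (Ioo a b)] fun x => Φ g x + Φ h x
  smul : ∀ (c : ℝ) g, MemL2 a b g →
    Φ (fun x => c * g x) =ᵐ[volume.restrict (Ioo a b)] fun x => c * Φ g x
  bound : ∀ g, MemL2 a b g → norm2 a b (Φ g) ≤ C * norm2 a b g

namespace IsL2Op

variable {Φ : (ℝ → ℝ) → ℝ → ℝ} {C : ℝ}

/-- The bounded operator on `L₂(a,b)` induced by a map on functions. -/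
noncomputable def toCLM (hab : a < b) (h : IsL2Op a b Φ C) : L2 a b →L[ℝ] L2 a b :=
  LinearMap.mkContinuous
    { toFun := fun x => (h.memL2 x x.memL2).toL2
      map_add' := fun x y => by
        refine Lp.ext ?_
        filter_upwards [(h.memL2 _ (L2.memL2 (x + y))).coe_toL2,
          (h.memL2 x x.memL2).coe_toL2, (h.memL2 y y.memL2).coe_toL2,
          Lp.coeFn_add (h.memL2 x x.memL2).toL2 (h.memL2 y y.memL2).toL2,
          h.congr _ _ (L2.memL2 _) (x.memL2.add y.memL2) (Lp.coeFn_add x y),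
          h.add _ _ x.memL2 y.memL2] with t h1 h2 h3 h4 h5 h6
        rw [h1, h4, Pi.add_apply, h2, h3, h5, h6]
      map_smul' := fun c x => by
        refine Lp.ext ?_
        filter_upwards [(h.memL2 _ (L2.memL2 (c • x))).coe_toL2, (h.memL2 x x.memL2).coe_toL2,
          Lp.coeFn_smul c (h.memL2 x x.memL2).toL2,
          h.congr _ _ (L2.memL2 _) (x.memL2.const_mul c) (Lp.coeFn_smul c x),
          h.smul c _ x.memL2] with t h1 h2 h3 h4 h5
        rw [RingHom.id_apply, h1, h3, Pi.smul_apply, h2, h4, h5, smul_eq_mul] } C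
    (fun x => by
      rw [L2.norm_eq hab, L2.norm_eq hab]
      exact le_trans (le_of_eq (norm2_congr hab (h.memL2 x x.memL2).coe_toL2))
        (h.bound x x.memL2))

theorem toCLM_coe (hab : a < b) (h : IsL2Op a b Φ C) (x : L2 a b) :
    h.toCLM hab x =ᵐ[volume.restrict (Ioo a b)] Φ x := (h.memL2 x x.memL2).coe_toL2

end IsL2Op

theorem ae_restrict_of_forall_mem_Ioo {p : ℝ → Prop} (h : ∀ x ∈ Ioo a b, p x) :
    ∀ᵐ x ∂volume.restrict (Ioo a b), p x :=
  (ae_restrict_iff' measurableSet_Ioo).2 (.of_forall h)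

theorem norm2_le_const (hab : a < b) {B : ℝ} (hB : 0 ≤ B) (hf : MemL2 a b f)
    (h : ∀ x ∈ Ioo a b, |f x| ≤ B) : norm2 a b f ≤ B * norm2 a b (fun _ => 1) :=
  norm2_le_of_abs_le hab hB hf (.of_continuousOn continuousOn_const) (by simpa using h)

theorem MemL2.mono_Ioo {c d : ℝ} (hf : MemL2 a b f) (hac : a ≤ c) (hdb : d ≤ b) :
    MemL2 c d f :=
  MemLp.mono_measure (Measure.restrict_mono (Ioo_subset_Ioo hac hdb) le_rfl) hf

/-- Primitives of `L₂` functions are Hölder continuous with exponent `½`. -/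
theorem MemL2.abs_integral_le (hab : a < b) (hf : MemL2 a b f) {c d : ℝ} (hac : a ≤ c)
    (hcd : c ≤ d) (hdb : d ≤ b) :
    |∫ t in c..d, f t| ≤ Real.sqrt (d - c) * norm2 a b f := by
  rcases hcd.eq_or_lt with rfl | hcd'
  · simp
  have hsub : norm2 c d f ≤ norm2 a b f := by
    refine Real.sqrt_le_sqrt (intervalIntegral.integral_mono_interval hac hcd hdb
      (.of_forall fun t => sq_nonneg _) ?_)
    rw [intervalIntegrable_iff_restrict hab]; exact hf.integrable_sq
  calc |∫ t in c..d, f t| ≤ ∫ t in c..d, |f t| :=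
        intervalIntegral.abs_integral_le_integral_abs hcd
    _ ≤ Real.sqrt (d - c) * norm2 c d f := JumpOU.integral_abs_le hcd' (hf.mono_Ioo hac hdb)
    _ ≤ _ := mul_le_mul_of_nonneg_left hsub (Real.sqrt_nonneg _)

theorem isL2Op_primitive (hab : a < b) :
    IsL2Op a b (fun g x => ∫ t in a..x, g t) (Real.sqrt (b - a) * norm2 a b (fun _ => 1)) where
  memL2 g hg := by simpa using (IsPrim.integral hg 0).memL2_left hab
  congr g h _ _ hgh := ae_restrict_of_forall_mem_Ioo fun x hx =>
    primitive_congr hgh (Ioo_subset_Icc_self hx)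
  add g h hg hh := ae_restrict_of_forall_mem_Ioo fun x hx => by
    have hs : ∀ {k}, MemL2 a b k → IntervalIntegrable k volume a x := fun {k} hk =>
      (hk.mono_Ioo le_rfl hx.2.le).intervalIntegrable hx.1
    exact intervalIntegral.integral_add (hs hg) (hs hh)
  smul c g _ := .of_forall fun x => intervalIntegral.integral_const_mul c g
  bound g hg := by
    have h := norm2_le_const hab (B := Real.sqrt (b - a) * norm2 a b g)
      (mul_nonneg (Real.sqrt_nonneg _) (norm2_nonneg _))
      (f := fun x => ∫ t in a..x, g t)
      (by simpa using (IsPrim.integral hg 0).memL2_left hab) fun x hx => by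
        have := (IsPrim.integral hg 0).abs_le hab (by simp) (Ioo_subset_Icc_self hx)
        simpa using this
    linarith

/-- The primitive vanishing at `a`, as an operator on `L₂(a,b)`. -/
noncomputable def primOp (hab : a < b) : L2 a b →L[ℝ] L2 a b := (isL2Op_primitive hab).toCLM hab

/-- The primitive operator is compact: it is the limit in operator norm of the operators of finite
rank that evaluate the primitive at the nearest grid point on the left. -/
theorem isCompactOperator_primOp (hab : a < b) : IsCompactOperator (primOp hab) := by
  have hba : 0 < b - a := sub_pos.2 hab
  let δ : ℕ → ℝ := fun n => (b - a) / (n + 1)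
  have hδ : ∀ n, 0 < δ n := fun n => by positivity
  let k : ℕ → ℝ → ℕ := fun n x => ⌊(x - a) / δ n⌋₊
  let e : ℕ → ℕ → ℝ → ℝ := fun n i x => if k n x = i then 1 else 0
  have he : ∀ n i, MemL2 a b (e n i) := fun n i => by
    have hm : Measurable (e n i) := by
      refine Measurable.ite ?_ measurable_const measurable_const
      have : Measurable (k n) :=
        Nat.measurable_floor.comp ((measurable_id.sub_const a).div_const _)
      exact this (measurableSet_singleton i)
    refine .of_bound hm.aestronglyMeasurable (B := 1) fun x _ => ?_
    simp only [e]; split_ifs <;> simp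
  let pt : ℕ → ℕ → ℝ := fun n i => a + i * δ n
  have hpt : ∀ n i, i < n + 1 → pt n i ∈ Icc a b := fun n i hi => by
    have h0 : (i : ℝ) ≤ n + 1 := by exact_mod_cast hi.le
    have h1 : (i : ℝ) * δ n ≤ b - a := by
      calc (i : ℝ) * δ n ≤ (n + 1) * δ n := mul_le_mul_of_nonneg_right h0 (hδ n).le
        _ = b - a := by simp only [δ]; field_simp
    have h2 : 0 ≤ (i : ℝ) * δ n := mul_nonneg (Nat.cast_nonneg i) (hδ n).le
    simp only [pt]
    constructor <;> linarith
  -- evaluation of the primitive at the `i`-th point of the grid of width `δ n`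
  have hl : ∀ n i, ∃ ℓ : L2 a b →L[ℝ] ℝ, i < n + 1 → ∀ x : L2 a b, ℓ x = ∫ t in a..pt n i, x t := by
    intro n i
    by_cases hi : i < n + 1
    · have hp := hpt n i hi
      refine ⟨LinearMap.mkContinuous
        { toFun := fun x => ∫ t in a..pt n i, x t
          map_add' := fun x y => ?_
          map_smul' := fun c x => ?_ } (Real.sqrt (b - a)) fun x => ?_, fun _ x => rfl⟩
      · rw [primitive_congr (Lp.coeFn_add x y) hp]
        have hs : ∀ z : L2 a b, IntervalIntegrable z volume a (pt n i) := fun z => by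
          refine (z.memL2.intervalIntegrable hab).mono_set ?_
          rw [uIcc_of_le hp.1, uIcc_of_le hab.le]; exact Icc_subset_Icc_right hp.2
        exact intervalIntegral.integral_add (hs x) (hs y)
      · rw [primitive_congr (Lp.coeFn_smul c x) hp]
        exact intervalIntegral.integral_const_mul c _
      · rw [L2.norm_eq hab]
        refine (x.memL2.abs_integral_le hab le_rfl hp.1 hp.2).trans ?_
        exact mul_le_mul_of_nonneg_right (Real.sqrt_le_sqrt (by linarith [hp.2])) (norm2_nonneg _)
    · exact ⟨0, fun h => absurd h hi⟩
  choose ℓ hℓ using hl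
  let A : ℕ → L2 a b →L[ℝ] L2 a b := fun n =>
    ∑ i ∈ Finset.range (n + 1), (ℓ n i).smulRight (he n i).toL2
  have hA : ∀ n, IsCompactOperator (A n) := fun n => by
    have : A n ∈ compactOperator (RingHom.id ℝ) (L2 a b) (L2 a b) := by
      refine Submodule.sum_mem _ fun i _ => ?_
      have h1 := isCompactOperator_of_locallyCompactSpace_dom (ℓ n i)
      exact h1.clm_comp ((ContinuousLinearMap.id ℝ ℝ).smulRight (he n i).toL2)
    exact this
  refine isCompactOperator_of_tendsto (l := Filter.atTop) (F := A) ?_ (.of_forall hA)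
  rw [tendsto_iff_norm_sub_tendsto_zero]
  set N1 := norm2 a b (fun _ => 1) with hN1
  refine squeeze_zero (g := fun n => Real.sqrt (δ n) * N1) (fun n => norm_nonneg _) (fun n => ?_) ?_
  · refine ContinuousLinearMap.opNorm_le_bound _
      (mul_nonneg (Real.sqrt_nonneg _) (norm2_nonneg _)) fun x => ?_
    rw [L2.norm_eq hab, L2.norm_eq hab]
    have hAx : A n x =ᵐ[volume.restrict (Ioo a b)]
        fun y => ∫ t in a..pt n (k n y), x t := by
      have h1 : A n x = ∑ i ∈ Finset.range (n + 1), ℓ n i x • (he n i).toL2 := by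
        simp [A]
      rw [h1]
      refine (Lp.coeFn_finsetSum _ _).trans ?_
      have h2 : ∀ᵐ y ∂volume.restrict (Ioo a b), ∀ i,
          (ℓ n i x • (he n i).toL2 : L2 a b) y = ℓ n i x * e n i y := by
        rw [ae_all_iff]
        intro i
        filter_upwards [Lp.coeFn_smul (ℓ n i x) (he n i).toL2, (he n i).coe_toL2] with y h3 h4
        rw [h3, Pi.smul_apply, h4, smul_eq_mul]
      filter_upwards [h2, ae_restrict_mem measurableSet_Ioo] with y hy hmem
      have hk : k n y < n + 1 := by
        simp only [k]
        rw [Nat.floor_lt (div_nonneg (by linarith [hmem.1]) (hδ n).le), div_lt_iff₀ (hδ n)]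
        push_cast
        have : ((n : ℝ) + 1) * δ n = b - a := by simp only [δ]; field_simp
        linarith [hmem.2]
      rw [Finset.sum_apply, Finset.sum_congr rfl fun i _ => hy i]
      simp only [e, mul_ite, mul_one, mul_zero]
      rw [Finset.sum_ite_eq, if_pos (Finset.mem_range.2 hk)]
      exact hℓ n _ hk x
    have hdiff : (A n - primOp hab) x =ᵐ[volume.restrict (Ioo a b)]
        fun y => -∫ t in pt n (k n y)..y, x t := by
      have hP : primOp hab x =ᵐ[volume.restrict (Ioo a b)] fun y => ∫ t in a..y, x t :=
        (isL2Op_primitive hab).toCLM_coe hab x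
      rw [sub_apply]
      filter_upwards [Lp.coeFn_sub (A n x) (primOp hab x), hAx, hP,
        ae_restrict_mem measurableSet_Ioo] with y h1 h2 h3 hmem
      have hk : pt n (k n y) ≤ y := by
        have h0 := Nat.floor_le (a := (y - a) / δ n)
          (div_nonneg (by linarith [hmem.1]) (hδ n).le)
        have := (le_div_iff₀ (hδ n)).1 h0
        simp only [pt, k]; linarith
      have hak : a ≤ pt n (k n y) := by
        have : 0 ≤ (k n y : ℝ) * δ n := mul_nonneg (Nat.cast_nonneg _) (hδ n).le
        simp only [pt]; linarith
      have hs : ∀ z ∈ Icc a b, IntervalIntegrable x volume a z := fun z hz => by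
        refine (x.memL2.intervalIntegrable hab).mono_set ?_
        rw [uIcc_of_le hz.1, uIcc_of_le hab.le]; exact Icc_subset_Icc_right hz.2
      rw [h1, Pi.sub_apply, h2, h3, ← intervalIntegral.integral_interval_sub_left
        (hs y (Ioo_subset_Icc_self hmem)) (hs _ ⟨hak, hk.trans hmem.2.le⟩)]
      ring
    rw [norm2_congr hab hdiff]
    have hmemL := (L2.memL2 ((A n - primOp hab) x)).congr hdiff
    have := norm2_le_const hab (B := Real.sqrt (δ n) * norm2 a b x)
      (mul_nonneg (Real.sqrt_nonneg _) (norm2_nonneg _)) hmemL fun y hmem => by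
        have hk : pt n (k n y) ≤ y ∧ y ≤ pt n (k n y) + δ n := by
          have h0 := Nat.floor_le (a := (y - a) / δ n)
            (div_nonneg (by linarith [hmem.1]) (hδ n).le)
          have h1 := (le_div_iff₀ (hδ n)).1 h0
          have h2 := Nat.lt_floor_add_one ((y - a) / δ n)
          rw [div_lt_iff₀ (hδ n)] at h2
          simp only [pt, k]
          constructor <;> linarith
        have hak : a ≤ pt n (k n y) := by
          have : 0 ≤ (k n y : ℝ) * δ n := mul_nonneg (Nat.cast_nonneg _) (hδ n).le
          simp only [pt]; linarith
        rw [abs_neg]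
        refine (x.memL2.abs_integral_le hab hak hk.1 hmem.2.le).trans ?_
        exact mul_le_mul_of_nonneg_right (Real.sqrt_le_sqrt (by linarith [hk.2])) (norm2_nonneg _)
    linarith
  · have h1 : Filter.Tendsto δ Filter.atTop (nhds 0) := by
      have := (tendsto_one_div_add_atTop_nhds_zero_nat (𝕜 := ℝ)).const_mul (b - a)
      simpa [δ, div_eq_mul_inv] using this
    have h2 := (Real.continuous_sqrt.tendsto 0).comp h1
    simpa using h2.mul_const N1

/-- The primitive vanishing at `a`, set to zero outside `(a, b)`. -/
noncomputable def primExt (a b : ℝ) (g : ℝ → ℝ) : ℝ → ℝ :=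
  (Ioo a b).indicator fun x => ∫ t in a..x, g t

theorem primExt_of_mem {x : ℝ} (hx : x ∈ Ioo a b) : primExt a b g x = ∫ t in a..x, g t :=
  indicator_of_mem hx _

theorem primExt_of_notMem {x : ℝ} (hx : x ∉ Ioo a b) : primExt a b g x = 0 :=
  indicator_of_notMem hx _

theorem primExt_congr {h : ℝ → ℝ} (hgh : g =ᵐ[volume.restrict (Ioo a b)] h) :
    primExt a b g = primExt a b h :=
  indicator_congr fun _ hx => primitive_congr hgh (Ioo_subset_Icc_self hx)

theorem bddSupp_primExt (hab : a < b) (hg : MemL2 a b g) : BddSupp a b (primExt a b g) := by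
  refine ⟨?_, ⟨Real.sqrt (b - a) * norm2 a b g,
    mul_nonneg (Real.sqrt_nonneg _) (norm2_nonneg _), fun x => ?_⟩, fun x => primExt_of_notMem⟩
  · classical
    rw [primExt, ← piecewise_eq_indicator]
    have h := (IsPrim.integral hg 0).continuousOn hab
    simp only [zero_add] at h
    exact (h.mono Ioo_subset_Icc_self).measurable_piecewise continuousOn_const measurableSet_Ioo
  · by_cases hx : x ∈ Ioo a b
    · rw [primExt_of_mem hx]
      have := (IsPrim.integral hg 0).abs_le hab (by simp) (Ioo_subset_Icc_self hx)
      simpa using this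
    · rw [primExt_of_notMem hx, abs_zero]
      exact mul_nonneg (Real.sqrt_nonneg _) (norm2_nonneg _)

theorem isPrim_primExt (hab : a < b) (hg : MemL2 a b g) (h0 : ∫ t in a..b, g t = 0) :
    IsPrim a b (primExt a b g) g := by
  have h := IsPrim.integral hg 0
  refine h.of_eqOn hab fun x hx => ?_
  by_cases hx' : x ∈ Ioo a b
  · rw [primExt_of_mem hx', zero_add]
  · rw [primExt_of_notMem hx']
    rcases hx.1.eq_or_lt with rfl | hxa
    · simp
    · have : x = b := le_antisymm hx.2 (not_lt.1 fun h => hx' ⟨hxa, h⟩)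
      rw [this, h0, zero_add]

theorem memH10_primExt (hab : a < b) (hg : MemL2 a b g) (h0 : ∫ t in a..b, g t = 0) :
    MemH10 a b (primExt a b g) :=
  .of_isPrim hab (isPrim_primExt hab hg h0) fun _ => primExt_of_notMem

theorem MemH10.primExt_D (hab : a < b) (hu : MemH10 a b u) : primExt a b (D a b u) = u := by
  funext x
  by_cases hx : x ∈ Ioo a b
  · rw [primExt_of_mem hx, (hu.isPrim hab).eq_add x (Ioo_subset_Icc_self hx), hu.left_eq_zero,
      zero_add]
  · rw [primExt_of_notMem hx, hu.eq_zero x hx]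

theorem isL2Op_lowerOrder (hab : a < b) (hμ : 0 < μ) (hlam : 0 < lam) (hφ : IsSymmDensity φ) :
    IsL2Op a b (fun g x => μ * (x * g x) - jumpOp lam φ (primExt a b g) x)
      (μ * cM a b + 2 * lam * (Real.sqrt (b - a) * norm2 a b (fun _ => 1))) where
  memL2 g hg := ((hg.continuousOn_mul (f := fun x => x) continuousOn_id).const_mul μ).sub
    ((bddSupp_primExt hab hg).memL2_jumpOp hφ lam)
  congr g h _ _ hgh := by
    filter_upwards [hgh] with x hx
    rw [hx, primExt_congr hgh]
  add g h hg hh := .of_forall fun x => by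
    have e : primExt a b (fun x => g x + h x) = fun x => primExt a b g x + primExt a b h x := by
      funext y
      by_cases hy : y ∈ Ioo a b
      · have hs : ∀ {k}, MemL2 a b k → IntervalIntegrable k volume a y := fun {k} hk =>
          (hk.mono_Ioo le_rfl hy.2.le).intervalIntegrable hy.1
        rw [primExt_of_mem hy, primExt_of_mem hy, primExt_of_mem hy]
        exact intervalIntegral.integral_add (hs hg) (hs hh)
      · simp only [primExt_of_notMem hy, add_zero]
    simp only [e]
    rw [(bddSupp_primExt hab hg).jumpOp_add hφ (bddSupp_primExt hab hh)]
    ring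
  smul c g _ := .of_forall fun x => by
    have e : primExt a b (fun x => c * g x) = fun x => c * primExt a b g x := by
      funext y
      by_cases hy : y ∈ Ioo a b
      · rw [primExt_of_mem hy, primExt_of_mem hy]
        exact intervalIntegral.integral_const_mul c g
      · simp only [primExt_of_notMem hy, mul_zero]
    simp only [e]
    rw [jumpOp_smul]
    ring
  bound g hg := by
    have hb := bddSupp_primExt hab hg
    have hx := hg.continuousOn_mul (f := fun x => x) continuousOn_id
    refine (norm2_sub_le hab (hx.const_mul μ) (hb.memL2_jumpOp hφ lam)).trans ?_
    rw [norm2_smul, abs_of_pos hμ]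
    have h1 := mul_le_mul_of_nonneg_left (norm2_x_mul_le hab hg) hμ.le
    have h2 := hb.norm2_jumpOp_le hab hφ hlam
    have h3 : norm2 a b (primExt a b g)
        ≤ Real.sqrt (b - a) * norm2 a b g * norm2 a b (fun _ => 1) := by
      refine norm2_le_const hab (mul_nonneg (Real.sqrt_nonneg _) (norm2_nonneg _)) hb.memL2
        fun x hx => ?_
      rw [primExt_of_mem hx]
      have := (IsPrim.integral hg 0).abs_le hab (by simp) (Ioo_subset_Icc_self hx)
      simpa using this
    have h4 := mul_le_mul_of_nonneg_left h3 hlam.le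
    linarith

/-- The Fredholm alternative, for a nonzero multiple of the identity minus a compact operator. -/
theorem isUnit_sub_of_isCompactOperator {E : Type*} [NormedAddCommGroup E] [NormedSpace ℝ E]
    [CompleteSpace E] {K : E →L[ℝ] E} (hK : IsCompactOperator K) {c : ℝ} (hc : c ≠ 0)
    (hinj : ∀ x, c • x - K x = 0 → x = 0) : IsUnit (algebraMap ℝ (E →L[ℝ] E) c - K) := by
  rcases hK.hasEigenvalue_or_mem_resolventSet hc with h | h
  · obtain ⟨x, hx⟩ := h.exists_hasEigenvector
    refine absurd (hinj x ?_) hx.2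
    have := Module.End.mem_eigenspace_iff.1 hx.1
    rw [← this]
    exact sub_self _
  · exact spectrum.mem_resolventSet_iff.1 h

/-- The constant function one, as an element of `L₂(a,b)`. -/
noncomputable def oneL2 (a b : ℝ) : L2 a b :=
  MemL2.toL2 (f := fun _ => 1) (.of_continuousOn continuousOn_const)

theorem inner_oneL2 (hab : a < b) (x : L2 a b) : inner ℝ (oneL2 a b) x = ∫ t in a..b, x t := by
  rw [L2.inner_eq hab, oneL2, inner2_congr hab (MemL2.coe_toL2 _) (Filter.EventuallyEq.refl _ _)]
  simp [inner2]

/-- The closed subspace of the functions of mean zero, that is, of the derivatives of the elements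
of `H¹₀(a,b)`. -/
noncomputable def meanZero (a b : ℝ) : Submodule ℝ (L2 a b) := (ℝ ∙ oneL2 a b)ᗮ

noncomputable instance : (meanZero a b).HasOrthogonalProjection := by
  unfold meanZero; infer_instance

theorem mem_meanZero (hab : a < b) (x : L2 a b) :
    x ∈ meanZero a b ↔ ∫ t in a..b, x t = 0 := by
  rw [meanZero, Submodule.mem_orthogonal_singleton_iff_inner_right, inner_oneL2 hab]

/-- Integration by parts against a primitive vanishing at both ends. -/
theorem inner2_primExt (hab : a < b) {F h : ℝ → ℝ} (hF : MemL2 a b F) (hh : MemL2 a b h)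
    (h0 : ∫ t in a..b, h t = 0) :
    inner2 a b F (primExt a b h) = -inner2 a b (fun x => ∫ t in a..x, F t) h := by
  have hP := IsPrim.integral hF 0
  have hE := isPrim_primExt hab hh h0
  have := (hP.mul hab hE).integral_eq hab
  rw [primExt_of_notMem (x := a) (by simp), primExt_of_notMem (x := b) (by simp),
    intervalIntegral.integral_add] at this
  · simp only [zero_add] at this
    simp only [inner2]
    linarith
  · rw [intervalIntegrable_iff_restrict hab]; exact hF.integrable_mul (hE.memL2_left hab)
  · rw [intervalIntegrable_iff_restrict hab]; exact (hP.memL2_left hab).integrable_mul hh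

/-- The derivative of an element of `H¹₀`, as a class of mean zero. -/
theorem MemH10.exists_meanZero (hab : a < b) (hu : MemH10 a b u) :
    ∃ x ∈ meanZero a b, primExt a b x = u := by
  refine ⟨hu.memL2_D.toL2, ?_, ?_⟩
  · rw [mem_meanZero hab, integral_congr_restrict hab hu.memL2_D.coe_toL2,
      (hu.isPrim hab).integral_eq hab, hu.left_eq_zero, hu.right_eq_zero, sub_zero]
  · rw [primExt_congr hu.memL2_D.coe_toL2, hu.primExt_D hab]

/-- The operator `R g = μ x g - 𝓘 (∫ₐˣ g)` of the lower order terms. -/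
noncomputable def lowerOp (hab : a < b) (hμ : 0 < μ) (hlam : 0 < lam) (hφ : IsSymmDensity φ) :
    L2 a b →L[ℝ] L2 a b := (isL2Op_lowerOrder hab hμ hlam hφ).toCLM hab

/-- The compact part `Q P R Q` of the operator representing the form, where `Q` projects onto the
functions of mean zero, `P` is the primitive and `R` collects the lower order terms. -/
noncomputable def compactPart (hab : a < b) (hμ : 0 < μ) (hlam : 0 < lam)
    (hφ : IsSymmDensity φ) : L2 a b →L[ℝ] L2 a b :=
  (meanZero a b).starProjection.comp ((primOp hab).comp
    ((lowerOp hab hμ hlam hφ).comp (meanZero a b).starProjection))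

theorem isCompactOperator_compactPart (hab : a < b) (hμ : 0 < μ) (hlam : 0 < lam)
    (hφ : IsSymmDensity φ) : IsCompactOperator (compactPart hab hμ hlam hφ) :=
  ((isCompactOperator_primOp hab).comp_clm
    ((lowerOp hab hμ hlam hφ).comp (meanZero a b).starProjection)).clm_comp
      (meanZero a b).starProjection

/-- The operator `½σ² - Q P R Q` on `L₂(a,b)` that represents the form in terms of the derivatives,
see `inner_formOp`. The outer projections make sense of it on all of `L₂(a,b)`, where it is a
compact perturbation of a multiple of the identity and preserves the mean zero condition. -/
noncomputable def formOp (hab : a < b) (σ : ℝ) (hμ : 0 < μ) (hlam : 0 < lam)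
    (hφ : IsSymmDensity φ) : L2 a b →L[ℝ] L2 a b :=
  algebraMap ℝ (L2 a b →L[ℝ] L2 a b) (1 / 2 * σ ^ 2) - compactPart hab hμ hlam hφ

theorem formOp_apply (hab : a < b) (hμ : 0 < μ) (hlam : 0 < lam) (hφ : IsSymmDensity φ)
    (x : L2 a b) :
    formOp hab σ hμ hlam hφ x = (1 / 2 * σ ^ 2) • x - compactPart hab hμ hlam hφ x := by
  simp [formOp, Algebra.algebraMap_eq_smul_one]

theorem inner_starProjection_meanZero {x y : L2 a b} (hy : y ∈ meanZero a b) :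
    inner ℝ ((meanZero a b).starProjection x) y = inner ℝ x y := by
  rw [Submodule.inner_starProjection_left_eq_right, Submodule.starProjection_eq_self_iff.2 hy]

theorem inner_formOp (hab : a < b) (hμ : 0 < μ) (hlam : 0 < lam) (hφ : IsSymmDensity φ)
    {x y : L2 a b} (hx : x ∈ meanZero a b) (hy : y ∈ meanZero a b) :
    inner ℝ (formOp hab σ hμ hlam hφ x) y
      = bilin a b σ μ lam φ (primExt a b x) (primExt a b y) := by
  have hx0 := (mem_meanZero hab x).1 hx
  have hy0 := (mem_meanZero hab y).1 hy
  rw [bilin_eq hab hφ (memH10_primExt hab x.memL2 hx0) (memH10_primExt hab y.memL2 hy0)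
    ((isPrim_primExt hab x.memL2 hx0).D_ae_eq hab) ((isPrim_primExt hab y.memL2 hy0).D_ae_eq hab),
    formOp_apply, inner_sub_left, real_inner_smul_left, L2.inner_eq hab,
    inner2_primExt hab ((isL2Op_lowerOrder hab hμ hlam hφ).memL2 _ x.memL2) y.memL2 hy0]
  simp only [compactPart, ContinuousLinearMap.comp_apply]
  rw [inner_starProjection_meanZero hy, Submodule.starProjection_eq_self_iff.2 hx,
    L2.inner_eq hab, sub_eq_add_neg]
  congr 2
  refine inner2_congr hab ?_ (Filter.EventuallyEq.refl _ _)
  refine ((isL2Op_primitive hab).toCLM_coe hab _).trans ?_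
  exact ae_restrict_of_forall_mem_Ioo fun t ht => primitive_congr
    ((isL2Op_lowerOrder hab hμ hlam hφ).toCLM_coe hab x) (Ioo_subset_Icc_self ht)

/-- Whatever `formOp` maps to mean zero has itself mean zero. -/
theorem mem_meanZero_of_formOp (hab : a < b) (hσ : 0 < σ) (hμ : 0 < μ) (hlam : 0 < lam)
    (hφ : IsSymmDensity φ) {x : L2 a b} (h : formOp hab σ hμ hlam hφ x ∈ meanZero a b) :
    x ∈ meanZero a b := by
  rw [formOp_apply] at h
  have hK : compactPart hab hμ hlam hφ x ∈ meanZero a b :=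
    Submodule.starProjection_apply_mem _ _
  have := (meanZero a b).add_mem h hK
  rw [sub_add_cancel] at this
  exact ((meanZero a b).smul_mem_iff (by positivity)).1 this

theorem isUnit_formOp (hab : a < b) (hσ : 0 < σ) (hμ : 0 < μ) (hlam : 0 < lam)
    (hφ : IsSymmDensity φ) : IsUnit (formOp hab σ hμ hlam hφ) := by
  refine isUnit_sub_of_isCompactOperator (isCompactOperator_compactPart hab hμ hlam hφ)
    (by positivity) fun x hx => ?_
  rw [← formOp_apply] at hx
  have hx0 : x ∈ meanZero a b :=
    mem_meanZero_of_formOp hab hσ hμ hlam hφ (by rw [hx]; exact zero_mem _)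
  have hxi := (mem_meanZero hab x).1 hx0
  have hsol : IsWeakSolution a b σ μ lam φ (fun _ => 0) (primExt a b x) := by
    refine ⟨memH10_primExt hab x.memL2 hxi, fun ψ hψ => ?_⟩
    obtain ⟨y, hy, rfl⟩ := hψ.exists_meanZero hab
    rw [← inner_formOp hab hμ hlam hφ hx0 hy, hx, inner_zero_left]
    simp [inner2]
  have h0 := hsol.eq_zero hab hσ hμ hlam hφ
  have hp := isPrim_primExt hab x.memL2 hxi
  rw [h0] at hp
  have hz : HasWeakDeriv a b 0 fun _ => 0 := fun ψ _ _ _ => by simp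
  have hae := HasWeakDeriv.ae_eq hab x.memL2 memL2_zero (hp.hasWeakDeriv hab) hz
  exact Lp.eq_zero_iff_ae_eq_zero.2 hae

/-- The right-hand side `f`, represented in terms of the derivative of the test function. -/
theorem exists_meanZero_inner (hab : a < b) (hf : MemL2 a b f) :
    ∃ F ∈ meanZero a b, ∀ y ∈ meanZero a b, inner ℝ F y = inner2 a b f (primExt a b y) := by
  refine ⟨-(meanZero a b).starProjection (primOp hab hf.toL2),
    (meanZero a b).neg_mem (Submodule.starProjection_apply_mem _ _), fun y hy => ?_⟩
  rw [inner_neg_left, inner_starProjection_meanZero hy, L2.inner_eq hab,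
    inner2_primExt hab hf y.memL2 ((mem_meanZero hab y).1 hy)]
  refine congrArg Neg.neg (inner2_congr hab ?_ (Filter.EventuallyEq.refl _ _))
  refine ((isL2Op_primitive hab).toCLM_coe hab _).trans ?_
  exact ae_restrict_of_forall_mem_Ioo fun t ht =>
    primitive_congr hf.coe_toL2 (Ioo_subset_Icc_self ht)

theorem surjective_of_isUnit {E : Type*} [NormedAddCommGroup E] [NormedSpace ℝ E]
    {T : E →L[ℝ] E} (h : IsUnit T) (y : E) : ∃ x, T x = y := by
  obtain ⟨S, rfl⟩ := h
  exact ⟨S.inv y, by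
    rw [← mul_apply_eq_comp, Units.inv_eq_val_inv, Units.mul_inv]; rfl⟩

theorem exists_isWeakSolution (hab : a < b) (hσ : 0 < σ) (hμ : 0 < μ) (hlam : 0 < lam)
    (hφ : IsSymmDensity φ) (hf : MemL2 a b f) : ∃ v, IsWeakSolution a b σ μ lam φ f v := by
  obtain ⟨F, hF, hFy⟩ := exists_meanZero_inner hab hf
  obtain ⟨x, hx⟩ := surjective_of_isUnit (isUnit_formOp hab hσ hμ hlam hφ) F
  have hx0 := mem_meanZero_of_formOp hab hσ hμ hlam hφ (hx ▸ hF)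
  refine ⟨primExt a b x, memH10_primExt hab x.memL2 ((mem_meanZero hab x).1 hx0), fun ψ hψ => ?_⟩
  obtain ⟨y, hy, rfl⟩ := hψ.exists_meanZero hab
  rw [← inner_formOp hab hμ hlam hφ hx0 hy, hx, hFy y hy]

/-- The adjoint problem is solvable because the adjoint of an invertible operator is invertible. -/
theorem exists_isAdjointSolution (hab : a < b) (hσ : 0 < σ) (hμ : 0 < μ) (hlam : 0 < lam)
    (hφ : IsSymmDensity φ) (hg : MemL2 a b g) : ∃ w, IsAdjointSolution a b σ μ lam φ g w := by
  obtain ⟨F, hF, hFy⟩ := exists_meanZero_inner hab hg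
  set T := formOp hab σ hμ hlam hφ with hT
  have hTs : IsUnit (ContinuousLinearMap.adjoint T) :=
    isUnit_star.2 (isUnit_formOp hab hσ hμ hlam hφ)
  obtain ⟨x, hx⟩ := surjective_of_isUnit hTs F
  have hx0 : x ∈ meanZero a b := by
    have h1 : inner ℝ (T (oneL2 a b)) x = 0 := by
      rw [← ContinuousLinearMap.adjoint_inner_right, hx]
      exact Submodule.mem_orthogonal_singleton_iff_inner_right.1 hF
    have hQ : (meanZero a b).starProjection (oneL2 a b) = 0 := by
      rw [Submodule.starProjection_apply_eq_zero_iff]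
      exact Submodule.le_orthogonal_orthogonal _ (Submodule.mem_span_singleton_self _)
    rw [hT, formOp_apply] at h1
    simp only [compactPart, ContinuousLinearMap.comp_apply, hQ, map_zero, sub_zero,
      real_inner_smul_left] at h1
    refine Submodule.mem_orthogonal_singleton_iff_inner_right.2 ?_
    exact (mul_eq_zero.1 h1).resolve_left (by positivity)
  refine ⟨primExt a b x, memH10_primExt hab x.memL2 ((mem_meanZero hab x).1 hx0), fun ψ hψ => ?_⟩
  obtain ⟨y, hy, rfl⟩ := hψ.exists_meanZero hab
  rw [← inner_formOp hab hμ hlam hφ hy hx0, ← hT, ← ContinuousLinearMap.adjoint_inner_right, hx,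
    real_inner_comm, hFy y hy, inner2_comm]

/-! ### The explicit regularity constant -/

/-- Duality with the primal problem turns the maximum principle into an `L₁` bound for adjoint
solutions. The data `w / (|w| + ε)` approximate the sign of `w`. -/
theorem IsAdjointSolution.integral_abs_le (hab : a < b) (hσ : 0 < σ) (hμ : 0 < μ)
    (hlam : 0 < lam) (hφ : IsSymmDensity φ) (hg : MemL2 a b g)
    (hw : IsAdjointSolution a b σ μ lam φ g w) :
    ∫ x in a..b, |w x| ≤ c4 a b σ μ lam * (Real.sqrt (b - a) * norm2 a b g) := by
  have hba : 0 < b - a := sub_pos.2 hab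
  have hwc := hw.1.continuous
  have key : ∀ ε : ℝ, 0 < ε → ∫ x in a..b, |w x|
      ≤ c4 a b σ μ lam * (Real.sqrt (b - a) * norm2 a b g) + ε * (b - a) := by
    intro ε hε
    let s : ℝ → ℝ := fun x => w x / (|w x| + ε)
    have hpos : ∀ x, 0 < |w x| + ε := fun x => by positivity
    have hs : Continuous s := hwc.div (by fun_prop) fun x => (hpos x).ne'
    have hs1 : ∀ x, |s x| ≤ 1 := fun x => by
      simp only [s, abs_div, abs_of_pos (hpos x)]
      rw [div_le_one (hpos x)]; linarith
    obtain ⟨v, hv⟩ := exists_isWeakSolution hab hσ hμ hlam hφ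
      (f := s) (.of_continuousOn hs.continuousOn)
    have hvb := hv.abs_le_c4 hab hσ hμ hlam hφ hs.continuousOn fun x _ => hs1 x
    have h1 : inner2 a b s w = inner2 a b v g := by rw [← hv.2 w hw.1, hw.2 v hv.1]
    have h2 : inner2 a b v g ≤ c4 a b σ μ lam * ∫ x in a..b, |g x| := by
      rw [← intervalIntegral.integral_const_mul]
      refine intervalIntegral.integral_mono_on hab.le ?_ ?_ fun x _ => ?_
      · rw [intervalIntegrable_iff_restrict hab]; exact hv.1.memL2.integrable_mul hg
      · exact (hg.intervalIntegrable hab).abs.const_mul _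
      · refine (le_abs_self _).trans ?_
        rw [abs_mul]
        exact mul_le_mul_of_nonneg_right (hvb x) (abs_nonneg _)
    have h3 : ∫ x in a..b, |w x| ≤ inner2 a b s w + ε * (b - a) := by
      have e : ε * (b - a) = ∫ _ in a..b, ε := by simp [mul_comm]
      have hsw : Continuous fun x => s x * w x := hs.mul hwc
      rw [e, inner2, ← intervalIntegral.integral_add (hsw.intervalIntegrable _ _)
        (continuous_const.intervalIntegrable _ _)]
      refine intervalIntegral.integral_mono_on hab.le (hwc.abs.intervalIntegrable _ _)
        ((hsw.add continuous_const).intervalIntegrable _ _) fun x _ => ?_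
      have e2 : s x * w x + ε - |w x| = ε ^ 2 / (|w x| + ε) := by
        have := (hpos x).ne'
        simp only [s]
        field_simp
        rw [← sq_abs (w x)]
        ring
      have : 0 ≤ ε ^ 2 / (|w x| + ε) := div_nonneg (sq_nonneg _) (hpos x).le
      linarith
    have h4 := mul_le_mul_of_nonneg_left (JumpOU.integral_abs_le hab hg)
      (show 0 ≤ c4 a b σ μ lam from (Real.exp_pos _).le)
    linarith
  refine le_of_forall_pos_le_add fun ε hε => ?_
  have := key (ε / (b - a)) (by positivity)
  rwa [div_mul_cancel₀ _ hba.ne'] at this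

/-- The `L₁` bound, Gårding's inequality and `‖w‖² ≤ ‖w‖_∞ ‖w‖₁` give the `L₂` bound. -/
theorem IsAdjointSolution.norm2_le (hab : a < b) (hσ : 0 < σ) (hμ : 0 < μ)
    (hlam : 0 < lam) (hφ : IsSymmDensity φ) (hg : MemL2 a b g)
    (hw : IsAdjointSolution a b σ μ lam φ g w) :
    norm2 a b w ≤ c6 a b σ μ lam * norm2 a b g := by
  have hba : 0 < b - a := sub_pos.2 hab
  have hL1 := hw.integral_abs_le hab hσ hμ hlam hφ hg
  set G := norm2 a b g with hG
  set W := norm2 a b w with hW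
  set W1 := norm2 a b (D a b w) with hW1
  have nG : 0 ≤ G := norm2_nonneg _
  have nW : 0 ≤ W := norm2_nonneg _
  have nW1 : 0 ≤ W1 := norm2_nonneg _
  -- `‖w‖² ≤ ‖w‖_∞ ‖w‖₁ ≤ c₅ ‖w'‖ ‖g‖`
  have h1 : W ^ 2 ≤ c5 a b σ μ lam * W1 * G := by
    have hwc := hw.1.continuous
    have : W ^ 2 ≤ Real.sqrt (b - a) * W1 * ∫ x in a..b, |w x| := by
      rw [hW, norm2_sq hab, ← intervalIntegral.integral_const_mul]
      refine intervalIntegral.integral_mono_on hab.le ((hwc.pow 2).intervalIntegrable _ _)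
        ((continuous_const.mul hwc.abs).intervalIntegrable _ _) fun x _ => ?_
      rw [← sq_abs, sq]
      exact mul_le_mul_of_nonneg_right (hw.1.abs_le hab x) (abs_nonneg _)
    refine this.trans ((mul_le_mul_of_nonneg_left hL1
      (mul_nonneg (Real.sqrt_nonneg _) nW1)).trans_eq ?_)
    unfold c5
    have := Real.mul_self_sqrt hba.le
    linear_combination (W1 * c4 a b σ μ lam * G) * this
  -- Gårding's inequality and the equation
  have h2 : 1 / 2 * σ ^ 2 * W1 ^ 2 - 1 / 2 * μ * W ^ 2 ≤ W * G := by
    have h := garding (σ := σ) (μ := μ) hab hlam hφ hw.1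
    rw [hw.2 w hw.1] at h
    exact h.trans (inner2_le hab hw.1.memL2 hg)
  set C := c5 a b σ μ lam with hC
  have hs : 0 < σ ^ 2 := by positivity
  have h3 : W * G ≤ 1 / 2 * μ * W ^ 2 + 1 / 2 / μ * G ^ 2 := by
    have : 1 / 2 * μ * W ^ 2 + 1 / 2 / μ * G ^ 2 - W * G = (μ * W - G) ^ 2 / (2 * μ) := by
      field_simp; ring
    have h0 : 0 ≤ (μ * W - G) ^ 2 / (2 * μ) := by positivity
    linarith
  have h4 : W1 ^ 2 ≤ (2 / (σ ^ 2 * μ) + 4 * μ ^ 2 * C ^ 2 / σ ^ 4) * G ^ 2 := by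
    have h5 : 1 / 2 * σ ^ 2 * W1 ^ 2 ≤ 1 / 2 / μ * G ^ 2 + μ * (C * W1 * G) := by
      linarith [mul_le_mul_of_nonneg_left h1 hμ.le]
    have h6 : μ * (C * W1 * G) ≤ 1 / 4 * σ ^ 2 * W1 ^ 2 + μ ^ 2 * C ^ 2 / σ ^ 2 * G ^ 2 := by
      have : 1 / 4 * σ ^ 2 * W1 ^ 2 + μ ^ 2 * C ^ 2 / σ ^ 2 * G ^ 2 - μ * (C * W1 * G)
          = (1 / 2 * σ * W1 - μ * C / σ * G) ^ 2 := by
        field_simp; ring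
      linarith [sq_nonneg (1 / 2 * σ * W1 - μ * C / σ * G)]
    have h7 : 1 / 4 * σ ^ 2 * W1 ^ 2 ≤ 1 / 2 / μ * G ^ 2 + μ ^ 2 * C ^ 2 / σ ^ 2 * G ^ 2 := by
      linarith
    have h8 := mul_le_mul_of_nonneg_left h7 (show 0 ≤ 4 / σ ^ 2 by positivity)
    have e1 : 4 / σ ^ 2 * (1 / 4 * σ ^ 2 * W1 ^ 2) = W1 ^ 2 := by field_simp
    have e2 : 4 / σ ^ 2 * (1 / 2 / μ * G ^ 2 + μ ^ 2 * C ^ 2 / σ ^ 2 * G ^ 2)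
        = (2 / (σ ^ 2 * μ) + 4 * μ ^ 2 * C ^ 2 / σ ^ 4) * G ^ 2 := by
      field_simp; ring
    rw [e1, e2] at h8
    exact h8
  have h5 : W1 ≤ Real.sqrt (2 / (σ ^ 2 * μ) + 4 * μ ^ 2 * C ^ 2 / σ ^ 4) * G := by
    refine abs_le_of_sq_le_sq' ?_ (mul_nonneg (Real.sqrt_nonneg _) nG) |>.2
    rw [mul_pow, Real.sq_sqrt (by positivity)]
    exact h4
  calc W ≤ c2 a b * W1 := hw.1.norm2_le hab
    _ ≤ c2 a b * (Real.sqrt (2 / (σ ^ 2 * μ) + 4 * μ ^ 2 * C ^ 2 / σ ^ 4) * G) :=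
        mul_le_mul_of_nonneg_left h5 (c2_pos hab).le
    _ = c6 a b σ μ lam * G := by rw [c6]; ring

/-- The solution operators of the two problems are adjoint to each other, hence have equal
norms. -/
theorem IsWeakSolution.norm2_le (hab : a < b) (hσ : 0 < σ) (hμ : 0 < μ)
    (hlam : 0 < lam) (hφ : IsSymmDensity φ) (hf : MemL2 a b f)
    (hv : IsWeakSolution a b σ μ lam φ f v) :
    norm2 a b v ≤ c6 a b σ μ lam * norm2 a b f := by
  obtain ⟨w, hw⟩ := exists_isAdjointSolution hab hσ hμ hlam hφ hv.1.memL2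
  have h1 : norm2 a b v ^ 2 = inner2 a b f w := by
    rw [← inner2_self hab, ← hw.2 v hv.1, hv.2 w hw.1]
  have h2 := inner2_le hab hf hw.1.memL2
  have h3 := hw.norm2_le hab hσ hμ hlam hφ hv.1.memL2
  have nf := norm2_nonneg (a := a) (b := b) f
  have nv := norm2_nonneg (a := a) (b := b) v
  have h4 := mul_le_mul_of_nonneg_left h3 nf
  rcases nv.eq_or_lt with h0 | h0
  · rw [← h0]
    exact mul_nonneg (mul_nonneg (c2_pos hab).le (Real.sqrt_nonneg _)) nf
  · refine le_of_mul_le_mul_right ?_ h0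
    nlinarith

theorem isRegularityConstant_c3 (hab : a < b) (hσ : 0 < σ) (hμ : 0 < μ) (hlam : 0 < lam)
    (hφ : IsSymmDensity φ) : IsRegularityConstant a b σ μ lam φ (c3 a b σ μ lam) := by
  have h8 : 0 ≤ c8 a b σ μ lam := by unfold c8; positivity
  have e : ∀ F W : ℝ, W ≤ c6 a b σ μ lam * F →
      c7 σ * F + c8 a b σ μ lam * W ≤ c3 a b σ μ lam * F := fun F W h => by
    have := mul_le_mul_of_nonneg_left h h8
    unfold c3
    linarith
  refine ⟨fun f v hf hv => ?_, fun g w hg hw => ?_⟩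
  · have h := hv.regularity hab hσ hμ hlam hφ hf
    exact ⟨h.1, h.2.trans (e _ _ (hv.norm2_le hab hσ hμ hlam hφ hf))⟩
  · have h := hw.regularity hab hσ hμ hlam hφ hg
    exact ⟨h.1, h.2.trans (e _ _ (hw.norm2_le hab hσ hμ hlam hφ hg))⟩

/-! ### Meshes and piecewise linear functions -/

namespace Mesh

/-- The mesh points, indexed by the natural numbers; constantly `b` from index `N` on. -/
noncomputable def pt (T : Mesh a b) (i : ℕ) : ℝ := T.node ⟨min i T.N, by omega⟩

variable (T : Mesh a b)

theorem pt_zero : T.pt 0 = a :=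
  (congrArg T.node (Fin.ext (by simp))).trans T.node_zero

theorem pt_N : T.pt T.N = b :=
  (congrArg T.node (Fin.ext (by simp))).trans T.node_last

theorem pt_castSucc (j : Fin T.N) : T.node j.castSucc = T.pt j := by
  rw [pt]; congr 1; ext; simp [j.2.le]

theorem pt_succ (j : Fin T.N) : T.node j.succ = T.pt (j + 1) := by
  rw [pt]; congr 1; ext; simp

theorem pt_mono : Monotone T.pt := fun i j h =>
  T.strictMono.monotone (by rw [Fin.mk_le_mk]; omega)

theorem pt_lt {i : ℕ} (hi : i < T.N) : T.pt i < T.pt (i + 1) :=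
  T.strictMono (by rw [Fin.mk_lt_mk]; omega)

theorem pt_mem {i : ℕ} (hi : i ≤ T.N) : T.pt i ∈ Icc a b := by
  constructor
  · conv_lhs => rw [← T.pt_zero]
    exact T.pt_mono (Nat.zero_le i)
  · conv_rhs => rw [← T.pt_N]
    exact T.pt_mono hi

theorem N_pos (hab : a < b) : 0 < T.N := by
  rcases Nat.eq_zero_or_pos T.N with h | h
  · have := T.pt_N
    rw [h, T.pt_zero] at this
    exact absurd this hab.ne
  · exact h

theorem pt_sub_le_size {i : ℕ} (hi : i < T.N) : T.pt (i + 1) - T.pt i ≤ T.size := by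
  have h := le_ciSup (f := fun j : Fin T.N => T.node j.succ - T.node j.castSucc)
    (Set.finite_range _).bddAbove ⟨i, hi⟩
  rwa [T.pt_succ, T.pt_castSucc] at h

theorem size_pos (hab : a < b) : 0 < T.size := by
  have h := T.N_pos hab
  linarith [T.pt_sub_le_size h, T.pt_lt h]

/-- Every point of `[a, b]` lies in some mesh interval. -/
theorem exists_cell (hab : a < b) {x : ℝ} (hx : x ∈ Icc a b) :
    ∃ i < T.N, x ∈ Icc (T.pt i) (T.pt (i + 1)) := by
  have key : ∀ n ≤ T.N, x ≤ T.pt n → x = a ∨ ∃ i < n, x ∈ Icc (T.pt i) (T.pt (i + 1)) := by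
    intro n
    induction n with
    | zero => intro _ h; left; rw [T.pt_zero] at h; exact le_antisymm h hx.1
    | succ n ih =>
      intro hn h
      rcases le_total x (T.pt n) with h' | h'
      · rcases ih (by omega) h' with h0 | ⟨i, hi, hmem⟩
        · exact Or.inl h0
        · exact Or.inr ⟨i, by omega, hmem⟩
      · exact Or.inr ⟨n, by omega, h', h⟩
  rcases key T.N le_rfl (by rw [T.pt_N]; exact hx.2) with rfl | h
  · have := T.pt_lt (T.N_pos hab)
    rw [T.pt_zero] at this
    exact ⟨0, T.N_pos hab, by rw [T.pt_zero], this.le⟩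
  · exact h

theorem integral_eq_sum (hab : a < b) {F : ℝ → ℝ} (hF : IntervalIntegrable F volume a b) :
    ∫ x in a..b, F x = ∑ i ∈ Finset.range T.N, ∫ x in T.pt i..T.pt (i + 1), F x := by
  rw [intervalIntegral.sum_integral_adjacent_intervals, T.pt_zero, T.pt_N]
  intro i hi
  refine hF.mono_set ?_
  rw [uIcc_of_le (T.pt_lt hi).le, uIcc_of_le hab.le]
  exact Icc_subset_Icc (T.pt_mem hi.le).1 (T.pt_mem hi).2

/-- The step function with value `s i` on the `i`-th mesh interval. -/
noncomputable def step (s : ℕ → ℝ) (x : ℝ) : ℝ :=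
  ∑ i ∈ Finset.range T.N, (Ioc (T.pt i) (T.pt (i + 1))).indicator (fun _ => s i) x

theorem step_eq (s : ℕ → ℝ) {i : ℕ} (hi : i < T.N) {x : ℝ}
    (hx : x ∈ Ioc (T.pt i) (T.pt (i + 1))) : T.step s x = s i := by
  rw [step, Finset.sum_eq_single_of_mem i (Finset.mem_range.2 hi), indicator_of_mem hx]
  intro j _ hji
  refine indicator_of_notMem (fun h => ?_) _
  rcases lt_or_gt_of_ne hji with h' | h'
  · exact (h.2.trans (T.pt_mono (show j + 1 ≤ i by omega))).not_gt hx.1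
  · exact (hx.2.trans (T.pt_mono (show i + 1 ≤ j by omega))).not_gt h.1

theorem memL2_step (s : ℕ → ℝ) : MemL2 a b (T.step s) :=
  memLp_finsetSum _ fun i _ => (memLp_const (s i)).indicator measurableSet_Ioc

theorem integral_step (s : ℕ → ℝ) {i : ℕ} (hi : i < T.N) {x : ℝ}
    (hx : x ∈ Icc (T.pt i) (T.pt (i + 1))) :
    ∫ t in T.pt i..x, T.step s t = s i * (x - T.pt i) := by
  have : ∫ t in T.pt i..x, T.step s t = ∫ _ in T.pt i..x, s i := by
    refine intervalIntegral.integral_congr_ae (.of_forall fun t ht => ?_)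
    rw [uIoc_of_le hx.1] at ht
    exact T.step_eq s hi ⟨ht.1, ht.2.trans hx.2⟩
  rw [this]
  simp [mul_comm]

/-- A continuous piecewise linear function is a primitive of the step function of its slopes. -/
theorem isPrim_of_affine (hab : a < b) (s : ℕ → ℝ)
    (h : ∀ i < T.N, ∀ x ∈ Icc (T.pt i) (T.pt (i + 1)), v x = v (T.pt i) + s i * (x - T.pt i)) :
    IsPrim a b v (T.step s) := by
  have hP := IsPrim.integral (T.memL2_step s) (v a)
  set P : ℝ → ℝ := fun x => v a + ∫ t in a..x, T.step s t with hPdef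
  have hcell : ∀ i < T.N, ∀ x ∈ Icc (T.pt i) (T.pt (i + 1)),
      P x = P (T.pt i) + s i * (x - T.pt i) := by
    intro i hi x hx
    have h1 := T.pt_mem hi.le
    have h2 : x ∈ Icc a b := ⟨h1.1.trans hx.1, hx.2.trans (T.pt_mem hi).2⟩
    rw [← T.integral_step s hi hx, hP.integral_eq_sub h1 h2 hab]
    ring
  have hnode : ∀ n ≤ T.N, v (T.pt n) = P (T.pt n) := by
    intro n
    induction n with
    | zero => intro _; simp [hPdef, T.pt_zero]
    | succ n ih =>
      intro hn
      have hm : T.pt (n + 1) ∈ Icc (T.pt n) (T.pt (n + 1)) :=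
        right_mem_Icc.2 (T.pt_lt hn).le
      rw [h n hn _ hm, hcell n hn _ hm, ih (by omega)]
  refine hP.of_eqOn hab fun x hx => ?_
  obtain ⟨i, hi, hxi⟩ := T.exists_cell hab hx
  rw [h i hi x hxi, hcell i hi x hxi, hnode i hi.le]

variable {T}

theorem MemV.exists_slopes (hv : T.MemV v) :
    ∃ s : ℕ → ℝ, ∀ i < T.N, ∀ x ∈ Icc (T.pt i) (T.pt (i + 1)),
      v x = v (T.pt i) + s i * (x - T.pt i) := by
  have h : ∀ i, ∃ q : ℝ, i < T.N → ∀ x ∈ Icc (T.pt i) (T.pt (i + 1)),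
      v x = v (T.pt i) + q * (x - T.pt i) := by
    intro i
    by_cases hi : i < T.N
    · obtain ⟨p, q, hpq⟩ := hv.affine ⟨i, hi⟩
      rw [T.pt_succ, T.pt_castSucc] at hpq
      refine ⟨q, fun _ x hx => ?_⟩
      rw [hpq x hx, hpq _ (left_mem_Icc.2 (T.pt_lt hi).le)]
      ring
    · exact ⟨0, fun h => absurd h hi⟩
  choose s hs using h
  exact ⟨s, fun i hi => hs i hi⟩

theorem MemV.memH10 (hab : a < b) (hv : T.MemV v) : MemH10 a b v := by
  obtain ⟨s, hs⟩ := hv.exists_slopes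
  exact .of_isPrim hab (T.isPrim_of_affine hab s hs) hv.eq_zero

/-- An element of `V_h` is determined by its values at the mesh points. -/
theorem MemV.eq_zero_of_nodes (hab : a < b) (hv : T.MemV v) (h : ∀ i < T.N, v (T.pt (i + 1)) = 0) :
    v = 0 := by
  have hn : ∀ i ≤ T.N, v (T.pt i) = 0 := by
    intro i hi
    rcases i with _ | i
    · rw [T.pt_zero]; exact hv.eq_zero a (by simp)
    · exact h i hi
  obtain ⟨s, hs⟩ := hv.exists_slopes
  funext x
  by_cases hx : x ∈ Icc a b
  · obtain ⟨i, hi, hxi⟩ := T.exists_cell hab hx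
    have h1 := hs i hi _ (right_mem_Icc.2 (T.pt_lt hi).le)
    rw [hn _ hi.le, hn _ hi, zero_add] at h1
    have h2 : s i = 0 := by
      rcases mul_eq_zero.1 h1.symm with h0 | h0
      · exact h0
      · linarith [T.pt_lt hi]
    rw [hs i hi x hxi, hn _ hi.le, h2]
    simp
  · exact hv.eq_zero x fun h' => hx (Ioo_subset_Icc_self h')

variable (T) in
/-- The space `V_h` as a subspace of the space of all functions. -/
def V : Submodule ℝ (ℝ → ℝ) where
  carrier := {v | T.MemV v}
  zero_mem' := ⟨continuous_const, fun _ _ => rfl, fun _ => ⟨0, 0, by simp⟩⟩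
  add_mem' {u v} hu hv := by
    refine ⟨hu.continuous.add hv.continuous, fun x hx => ?_, fun j => ?_⟩
    · rw [Pi.add_apply, hu.eq_zero x hx, hv.eq_zero x hx, add_zero]
    · obtain ⟨p, q, h⟩ := hu.affine j
      obtain ⟨p', q', h'⟩ := hv.affine j
      exact ⟨p + p', q + q', fun x hx => by rw [Pi.add_apply, h x hx, h' x hx]; ring⟩
  smul_mem' c v hv := by
    refine ⟨hv.continuous.const_smul c, fun x hx => ?_, fun j => ?_⟩
    · rw [Pi.smul_apply, hv.eq_zero x hx, smul_zero]
    · obtain ⟨p, q, h⟩ := hv.affine j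
      exact ⟨c * p, c * q, fun x hx => by rw [Pi.smul_apply, h x hx, smul_eq_mul]; ring⟩

theorem finiteDimensional_V (hab : a < b) : FiniteDimensional ℝ T.V := by
  let L : T.V →ₗ[ℝ] (Fin T.N → ℝ) :=
    { toFun := fun v i => (v : ℝ → ℝ) (T.pt (i + 1))
      map_add' := fun _ _ => rfl
      map_smul' := fun _ _ => rfl }
  refine FiniteDimensional.of_injective L ((injective_iff_map_eq_zero L).2 fun v hv => ?_)
  exact Subtype.ext (MemV.eq_zero_of_nodes hab v.2 fun i hi => congrFun hv ⟨i, hi⟩)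

end Mesh

/-! ### Interpolation -/

theorem IsPrim.restrict (hab : a < b) {p q : ℝ → ℝ} (h : IsPrim a b p q) {c d : ℝ}
    (hac : a ≤ c) (hdb : d ≤ b) : IsPrim c d p q := by
  refine ⟨h.memL2.mono_Ioo hac hdb, fun x hx => ?_⟩
  rw [h.integral_eq_sub ⟨hac, (hx.1.trans hx.2).trans hdb⟩ ⟨hac.trans hx.1, hx.2.trans hdb⟩ hab]
  ring

/-- A Poincaré inequality on one mesh interval: the mean value is the best constant in mean
square, and is compared here with the value at the left end. -/
theorem IsPrim.integral_sub_mean_sq_le {c d m : ℝ} (hcd : c < d) {p q : ℝ → ℝ}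
    (h : IsPrim c d p q) (hm : m * (d - c) = ∫ x in c..d, p x) :
    ∫ x in c..d, (p x - m) ^ 2 ≤ (d - c) ^ 2 * ∫ x in c..d, q x ^ 2 := by
  have hpc := h.continuousOn hcd
  have hii : ∀ {F : ℝ → ℝ}, ContinuousOn F (Icc c d) → IntervalIntegrable F volume c d :=
    fun {F} hF => ContinuousOn.intervalIntegrable (by rwa [uIcc_of_le hcd.le])
  have e : ∫ x in c..d, (p x - p c) ^ 2
      = (∫ x in c..d, (p x - m) ^ 2) + (d - c) * (m - p c) ^ 2 := by
    have e1 : ∫ x in c..d, (p x - p c) ^ 2 = ∫ x in c..d, ((p x - m) ^ 2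
        + (2 * (m - p c) * p x + ((m - p c) ^ 2 - 2 * (m - p c) * m))) := by
      congr 1; ext x; ring
    rw [e1, intervalIntegral.integral_add (hii (by fun_prop)) (hii (by fun_prop)),
      intervalIntegral.integral_add (hii (by fun_prop)) (hii (by fun_prop)),
      intervalIntegral.integral_const_mul, ← hm]
    simp only [intervalIntegral.integral_const, smul_eq_mul]
    ring
  have h1 : ∫ x in c..d, (p x - p c) ^ 2 ≤ ∫ _ in c..d, (d - c) * norm2 c d q ^ 2 := by
    refine intervalIntegral.integral_mono_on hcd.le (hii (by fun_prop))
      (hii continuousOn_const) fun x hx => ?_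
    have h2 := (h.sub (w := fun _ => p c) (h := fun _ => 0)
      ⟨memL2_zero, fun _ _ => by simp⟩ hcd).abs_le hcd (by simp) hx
    simp only [sub_zero] at h2
    calc (p x - p c) ^ 2 = |p x - p c| ^ 2 := (sq_abs _).symm
      _ ≤ (Real.sqrt (d - c) * norm2 c d q) ^ 2 := pow_le_pow_left₀ (abs_nonneg _) h2 2
      _ = _ := by rw [mul_pow, Real.sq_sqrt (sub_nonneg.2 hcd.le)]
  rw [e, norm2_sq hcd] at h1
  simp only [intervalIntegral.integral_const, smul_eq_mul] at h1
  have h3 : 0 ≤ (d - c) * (m - p c) ^ 2 := mul_nonneg (sub_nonneg.2 hcd.le) (sq_nonneg _)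
  linarith

/-- Nodal interpolation in `V_h`: the slopes of the interpolant are the mean values of `u'` over the
mesh intervals, so its derivative approximates `u'` by the Poincaré inequality. -/
theorem exists_interpolant (hab : a < b) (T : Mesh a b) (hu : MemH10 a b u)
    (h2 : MemH1 a b (D a b u)) :
    ∃ uI, T.MemV uI ∧
      norm2 a b (D a b (fun x => u x - uI x)) ≤ T.size * norm2 a b (D a b (D a b u)) := by
  obtain ⟨hqL, hqW⟩ := D_spec h2.2
  set q := D a b (D a b u) with hq
  obtain ⟨p, hp, hup⟩ := hqW.exists_isPrim hab h2.1 hqL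
  have hupr : IsPrim a b u p := (hu.isPrim hab).congr_right hup
  let s : ℕ → ℝ := fun i => (u (T.pt (i + 1)) - u (T.pt i)) / (T.pt (i + 1) - T.pt i)
  have hsL := T.memL2_step s
  have hs : ∀ i < T.N, s i * (T.pt (i + 1) - T.pt i) = u (T.pt (i + 1)) - u (T.pt i) :=
    fun i hi => div_mul_cancel₀ _ (sub_pos.2 (T.pt_lt hi)).ne'
  have h0 : ∫ t in a..b, T.step s t = 0 := by
    rw [T.integral_eq_sum hab (hsL.intervalIntegrable hab)]
    rw [Finset.sum_congr rfl fun i hi => by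
      rw [T.integral_step s (Finset.mem_range.1 hi)
        (right_mem_Icc.2 (T.pt_lt (Finset.mem_range.1 hi)).le), hs i (Finset.mem_range.1 hi)]]
    rw [Finset.sum_range_sub (fun i => u (T.pt i)), T.pt_N, T.pt_zero, hu.left_eq_zero,
      hu.right_eq_zero, sub_zero]
  have hIp := isPrim_primExt hab hsL h0
  have hIH := memH10_primExt hab hsL h0
  refine ⟨primExt a b (T.step s), ⟨hIH.continuous, hIH.eq_zero, fun j => ?_⟩, ?_⟩
  · rw [T.pt_succ, T.pt_castSucc]
    refine ⟨primExt a b (T.step s) (T.pt j) - s j * T.pt j, s j, fun x hx => ?_⟩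
    have h1 := T.pt_mem j.2.le
    have h3 : x ∈ Icc a b := ⟨h1.1.trans hx.1, hx.2.trans (T.pt_mem j.2).2⟩
    have := hIp.integral_eq_sub h1 h3 hab
    rw [T.integral_step s j.2 hx] at this
    linarith
  · rw [norm2_congr hab ((hupr.sub hIp hab).D_ae_eq hab)]
    have hsz := (T.size_pos hab).le
    refine norm2_le_of_sq_le (mul_nonneg hsz (norm2_nonneg _)) ?_
    have hd := (hp.memL2_left hab).sub hsL
    rw [mul_pow, norm2_sq hab, T.integral_eq_sum hab
      ((intervalIntegrable_iff_restrict hab).2 hd.integrable_sq), T.integral_eq_sum hab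
      ((intervalIntegrable_iff_restrict hab).2 hqL.integrable_sq), Finset.mul_sum]
    refine Finset.sum_le_sum fun i hi => ?_
    have hi' := Finset.mem_range.1 hi
    have hlt := T.pt_lt hi'
    have hpr := hp.restrict hab (T.pt_mem hi'.le).1 (T.pt_mem hi').2
    have e : ∫ x in T.pt i..T.pt (i + 1), (p x - T.step s x) ^ 2
        = ∫ x in T.pt i..T.pt (i + 1), (p x - s i) ^ 2 := by
      refine intervalIntegral.integral_congr_ae (.of_forall fun x hx => ?_)
      rw [uIoc_of_le hlt.le] at hx
      simp only [T.step_eq s hi' hx]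
    rw [e]
    refine (hpr.integral_sub_mean_sq_le hlt (m := s i) ?_).trans ?_
    · rw [hs i hi', hupr.integral_eq_sub (T.pt_mem hi'.le) (T.pt_mem hi') hab]
    · refine mul_le_mul_of_nonneg_right ?_
        (intervalIntegral.integral_nonneg hlt.le fun _ _ => sq_nonneg _)
      exact pow_le_pow_left₀ (sub_nonneg.2 hlt.le) (T.pt_sub_le_size hi') 2

/-! ### The finite element method -/

/-- Schatz's argument: duality bounds `‖e‖` by a small multiple of `‖e'‖`, which makes the negative
term in Gårding's inequality absorbable. A positive mesh size below the threshold forces the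
regularity constant to be positive. -/
theorem IsFEMSolution.error_le (hab : a < b) (hσ : 0 < σ) (hμ : 0 < μ) (hlam : 0 < lam)
    (hφ : IsSymmDensity φ) {C : ℝ} (hC : IsRegularityConstant a b σ μ lam φ C)
    (hf : MemL2 a b f) (hv : IsWeakSolution a b σ μ lam φ f v) {T : Mesh a b}
    (hT : T.size ≤ h0 a b σ μ lam C) {vh : ℝ → ℝ} (hvh : IsFEMSolution T σ μ lam φ f vh) :
    norm2 a b (v - vh) ≤ 4 * c1 a b σ μ lam ^ 2 * C ^ 2 / σ ^ 2 * T.size ^ 2 * norm2 a b f ∧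
    norm2 a b (D a b (v - vh)) ≤ 4 * c1 a b σ μ lam * C / σ ^ 2 * T.size * norm2 a b f := by
  have hh := T.size_pos hab
  have hc1 := c1_pos hab hσ hμ hlam
  set h := T.size with hhdef
  set k := c1 a b σ μ lam with hk
  have hCpos : 0 < C := by
    have h1 : 0 < h0 a b σ μ lam C := hh.trans_le hT
    by_contra hC0
    refine h1.not_ge (div_nonpos_of_nonneg_of_nonpos hσ.le ?_)
    exact mul_nonpos_of_nonneg_of_nonpos (by positivity) (not_lt.1 hC0)
  have hsmall : 2 * μ * (k * C * h) ^ 2 ≤ σ ^ 2 := by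
    have h1 : h * (Real.sqrt 2 * Real.sqrt μ * k * C) ≤ σ := by
      refine (le_div_iff₀ ?_).1 hT
      have := Real.sqrt_pos.2 hμ
      positivity
    have h2 := pow_le_pow_left₀ (by positivity) h1 2
    have e : (h * (Real.sqrt 2 * Real.sqrt μ * k * C)) ^ 2
        = Real.sqrt 2 ^ 2 * Real.sqrt μ ^ 2 * (k * C * h) ^ 2 := by ring
    rwa [e, Real.sq_sqrt (by norm_num), Real.sq_sqrt hμ.le] at h2
  have hvhH : MemH10 a b vh := hvh.1.memH10 hab
  have heH : MemH10 a b (fun x => v x - vh x) := hv.1.sub hab hvhH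
  change norm2 a b (fun x => v x - vh x) ≤ _ ∧ norm2 a b (D a b (fun x => v x - vh x)) ≤ _
  set e : ℝ → ℝ := fun x => v x - vh x with he
  -- Galerkin orthogonality
  have horth : ∀ ψ, T.MemV ψ → bilin a b σ μ lam φ e ψ = 0 := fun ψ hψ => by
    rw [he, bilin_sub_left hab hφ hv.1 hvhH (hψ.memH10 hab), hv.2 ψ (hψ.memH10 hab), hvh.2 ψ hψ,
      sub_self]
  -- the interpolation error of `z` bounds `A(e, z)`; used below for `z = w` and for `z = v`
  have hbest : ∀ z F : ℝ → ℝ, MemH10 a b z → MemH1 a b (D a b z) →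
      norm2 a b (D a b (D a b z)) ≤ C * norm2 a b F →
      bilin a b σ μ lam φ e z ≤ k * norm2 a b (D a b e) * (h * (C * norm2 a b F)) := by
    intro z F hz hz2 hzC
    obtain ⟨zI, hzI, hzle⟩ := exists_interpolant hab T hz hz2
    have h1 : bilin a b σ μ lam φ e z = bilin a b σ μ lam φ e (fun x => z x - zI x) := by
      rw [bilin_sub_right hab hφ hz (hzI.memH10 hab) heH, horth zI hzI, sub_zero]
    rw [h1]
    refine (le_abs_self _).trans ((abs_bilin_le hab hμ hlam hφ heH
      (hz.sub hab (hzI.memH10 hab))).trans ?_)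
    refine mul_le_mul_of_nonneg_left (hzle.trans (mul_le_mul_of_nonneg_left hzC hh.le)) ?_
    exact mul_nonneg hc1.le (norm2_nonneg _)
  set E := norm2 a b (D a b e) with hE
  set W := norm2 a b e with hW
  have nE : 0 ≤ E := norm2_nonneg _
  have nW : 0 ≤ W := norm2_nonneg _
  have nF : 0 ≤ norm2 a b f := norm2_nonneg _
  -- test the adjoint problem with data `e` against `e` itself
  have hdual : W ≤ k * C * h * E := by
    obtain ⟨w, hw⟩ := exists_isAdjointSolution hab hσ hμ hlam hφ heH.memL2
    have hreg := hC.2 e w heH.memL2 hw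
    have h1 := hbest w e hw.1 hreg.1.2 hreg.2
    rw [hw.2 e heH, inner2_self hab] at h1
    rcases nW.eq_or_lt with h0 | h0
    · rw [← h0]; positivity
    · refine le_of_mul_le_mul_right ?_ h0
      calc W * W = W ^ 2 := (sq W).symm
        _ ≤ _ := h1
        _ = _ := by ring
  have henergy : E ≤ 4 * k * C / σ ^ 2 * h * norm2 a b f := by
    have hreg := hC.1 f v hf hv
    have h1 := hbest v f hv.1 hreg.1.2 hreg.2
    have h2 := garding (σ := σ) (μ := μ) hab hlam hφ heH
    have h3 : bilin a b σ μ lam φ e e = bilin a b σ μ lam φ e v := by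
      conv_lhs => rw [he, bilin_sub_right hab hφ hv.1 hvhH heH]
      rw [horth vh hvh.1, sub_zero]
    rw [h3] at h2
    have h4 : W ^ 2 ≤ (k * C * h) ^ 2 * E ^ 2 := by
      rw [← mul_pow]; exact pow_le_pow_left₀ nW hdual 2
    have h5 : 1 / 2 * μ * W ^ 2 ≤ 1 / 4 * σ ^ 2 * E ^ 2 := by
      have := mul_le_mul_of_nonneg_right hsmall (sq_nonneg E)
      have := mul_le_mul_of_nonneg_left h4 hμ.le
      linarith
    have h6 : 1 / 4 * σ ^ 2 * E * E ≤ k * h * (C * norm2 a b f) * E := by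
      linarith
    rcases nE.eq_or_lt with h0 | h0
    · rw [← h0]; positivity
    · have h7 := le_of_mul_le_mul_right h6 h0
      have e1 : 4 * k * C / σ ^ 2 * h * norm2 a b f = 4 / σ ^ 2 * (k * h * (C * norm2 a b f)) := by
        ring
      have e2 : E = 4 / σ ^ 2 * (1 / 4 * σ ^ 2 * E) := by field_simp
      rw [e1]
      conv_lhs => rw [e2]
      exact mul_le_mul_of_nonneg_left h7 (by positivity)
  refine ⟨?_, henergy⟩
  refine hdual.trans ((mul_le_mul_of_nonneg_left henergy (by positivity)).trans_eq ?_)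
  ring

theorem isWeakSolution_zero (hab : a < b) (hφ : IsSymmDensity φ) :
    IsWeakSolution a b σ μ lam φ (fun _ => 0) (fun _ => 0) := by
  have h0 : MemH10 a b (fun _ => (0 : ℝ)) :=
    .of_isPrim hab (g := fun _ => 0) ⟨memL2_zero, fun _ _ => by simp⟩ fun _ _ => rfl
  refine ⟨h0, fun ψ hψ => ?_⟩
  have := bilin_smul_left (σ := σ) (μ := μ) (lam := lam) hab hφ h0 hψ 0
  simp only [zero_mul] at this
  rw [this]
  simp [inner2]

/-- The discrete problem with zero right-hand side has only the zero solution, since the error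
bounds apply to it. -/
theorem IsFEMSolution.eq_zero (hab : a < b) (hσ : 0 < σ) (hμ : 0 < μ) (hlam : 0 < lam)
    (hφ : IsSymmDensity φ) {C : ℝ} (hC : IsRegularityConstant a b σ μ lam φ C) {T : Mesh a b}
    (hT : T.size ≤ h0 a b σ μ lam C) {vh : ℝ → ℝ}
    (hvh : IsFEMSolution T σ μ lam φ (fun _ => 0) vh) : vh = 0 := by
  have h := (hvh.error_le hab hσ hμ hlam hφ hC memL2_zero (isWeakSolution_zero hab hφ) hT).2
  have e0 : norm2 a b (fun _ => (0 : ℝ)) = 0 := by simp [norm2]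
  rw [e0, mul_zero] at h
  have hz := (isWeakSolution_zero (σ := σ) (μ := μ) (lam := lam) hab hφ).1
  have h1 := MemH10.eq_zero_of_norm2_D hab (hz.sub hab (hvh.1.memH10 hab))
    (le_antisymm h (norm2_nonneg _))
  funext x
  have := congrFun h1 x
  simpa using this

/-- The discrete problem is a square linear system, so injectivity suffices. -/
theorem existsUnique_isFEMSolution (hab : a < b) (hσ : 0 < σ) (hμ : 0 < μ) (hlam : 0 < lam)
    (hφ : IsSymmDensity φ) {C : ℝ} (hC : IsRegularityConstant a b σ μ lam φ C)
    (hf : MemL2 a b f) {T : Mesh a b} (hT : T.size ≤ h0 a b σ μ lam C) :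
    ∃! vh, IsFEMSolution T σ μ lam φ f vh := by
  have hH : ∀ x : T.V, MemH10 a b x := fun x => x.2.memH10 hab
  let B : T.V →ₗ[ℝ] Module.Dual ℝ T.V := LinearMap.mk₂ ℝ
    (fun x y => bilin a b σ μ lam φ x y)
    (fun x x' y => bilin_add_left hab hφ (hH x) (hH x') (hH y))
    (fun c x y => bilin_smul_left hab hφ (hH x) (hH y) c)
    (fun x y y' => bilin_add_right hab hφ (hH y) (hH y') (hH x))
    (fun c x y => bilin_smul_right hab hφ (hH y) (hH x) c)
  have hinj : Function.Injective B := by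
    refine (injective_iff_map_eq_zero B).2 fun x hx => Subtype.ext ?_
    have hsol : IsFEMSolution T σ μ lam φ (fun _ => 0) x := by
      refine ⟨x.2, fun ψ hψ => ?_⟩
      have := LinearMap.congr_fun hx (⟨ψ, hψ⟩ : T.V)
      refine Eq.trans this ?_
      simp [inner2]
    exact hsol.eq_zero hab hσ hμ hlam hφ hC hT
  have := Mesh.finiteDimensional_V (T := T) hab
  have hsurj : Function.Surjective B :=
    (LinearMap.injective_iff_surjective_of_finrank_eq_finrank
      Subspace.dual_finrank_eq.symm).1 hinj
  let ℓ : Module.Dual ℝ T.V :=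
    { toFun := fun y => inner2 a b f y
      map_add' := fun y y' => inner2_add_right hab (hH y).memL2 (hH y').memL2 hf
      map_smul' := fun c y => inner2_smul_right c f y }
  obtain ⟨x, hx⟩ := hsurj ℓ
  refine ⟨x, ⟨x.2, fun ψ hψ => LinearMap.congr_fun hx (⟨ψ, hψ⟩ : T.V)⟩, fun y hy => ?_⟩
  have hyx : B ⟨y, hy.1⟩ = B x := by
    rw [hx]
    exact LinearMap.ext fun z => hy.2 z z.2
  exact congrArg Subtype.val (hinj hyx)

end JumpOU

theorem theorem3 (a b σ μ lam : ℝ) (φ : ℝ → ℝ)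
    (hab : a < b) (hσ : 0 < σ) (hμ : 0 < μ) (hlam : 0 < lam)
    (hφ : JumpOU.IsSymmDensity φ) :
    JumpOU.IsRegularityConstant a b σ μ lam φ (JumpOU.c3 a b σ μ lam) ∧
    (∀ C : ℝ, JumpOU.IsRegularityConstant a b σ μ lam φ C →
      ∀ f : ℝ → ℝ, JumpOU.MemL2 a b f →
        (∃! v : ℝ → ℝ, JumpOU.IsWeakSolution a b σ μ lam φ f v) ∧
        ∀ v : ℝ → ℝ, JumpOU.IsWeakSolution a b σ μ lam φ f v →
          ∀ T : JumpOU.Mesh a b, T.size ≤ JumpOU.h0 a b σ μ lam C →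
            (∃! vh : ℝ → ℝ, JumpOU.IsFEMSolution T σ μ lam φ f vh) ∧
            ∀ vh : ℝ → ℝ, JumpOU.IsFEMSolution T σ μ lam φ f vh →
              JumpOU.norm2 a b (v - vh) ≤
                4 * JumpOU.c1 a b σ μ lam ^ 2 * C ^ 2 / σ ^ 2 * T.size ^ 2
                  * JumpOU.norm2 a b f ∧
              JumpOU.norm2 a b (JumpOU.D a b (v - vh)) ≤
                4 * JumpOU.c1 a b σ μ lam * C / σ ^ 2 * T.size
                  * JumpOU.norm2 a b f) := by
  refine ⟨JumpOU.isRegularityConstant_c3 hab hσ hμ hlam hφ, fun C hC f hf => ⟨?_, ?_⟩⟩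
  · obtain ⟨v, hv⟩ := JumpOU.exists_isWeakSolution hab hσ hμ hlam hφ hf
    exact ⟨v, hv, fun u hu => hu.unique hab hσ hμ hlam hφ hv⟩
  · intro v hv T hT
    exact ⟨JumpOU.existsUnique_isFEMSolution hab hσ hμ hlam hφ hC hf hT,
      fun vh hvh => hvh.error_le hab hσ hμ hlam hφ hC hf hv hT⟩
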